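/- There is an algorithm that, given a graph $G$ with $n$ vertices and a tree decomposition of $G$ of width $k \ge 1$ with $O(n)$ nodes, computes the number of perfect matchings in $G$ in $O\bigl(n\,k^2\,2^k\, i_\times(n\log (k+1))\bigr)$ time. Here a tree decomposition of $G=(V,E)$ is a tree $T$ with a set $X_x\subseteq V$ (a bag) for each node $x$ such that the bags cover $V$, both endpoints of every edge of $G$ lie in a common bag, and if $v\in X_x\cap X_y$ then $v \in X_z$ for every node $z$ on the path from $x$ to $y$ in $T$; its width is the size of the largest bag minus one. The graph and the tree are given by lists of their edges, in any order, and the bags by lists of their vertices. Time is measured on a random access machine on which every operation takes one step plus the time for arithmetic on the numbers (including addresses) involved: $i_\times(b)$ for the multiplication of $b$-bit numbers, and $i_+(b)$ for the addition, subtraction, comparison or copying of $b$-bit numbers or for their use as addresses. Here $i_\times$ is positive (on $b \ge 1$) and nondecreasing, with $i_\times(2b) = O(i_\times(b))$ and $i_+(b)=O(i_\times(b))$. The algorithm is one and the same program for all inputs and all such $i_+, i_\times$. The implied constant in the running time depends only on the implied constants in these two conditions and in the number $O(n)$ of nodes of the tree decomposition; thus $i_+,i_\times$ may also depend on the instance,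 for example through a machine word size of order $k$. -/

import Mathlib

/-! ### Tree decompositions -/

/-- A tree decomposition of `G`: a tree on the node set `ι`, with a bag of vertices at every node,
such that the bags cover all vertices and all edges, and such that a vertex lying in the bags of
`x` and `y` lies in the bag of every node on the path from `x` to `y`. -/
structure TreeDecomposition {V : Type*} (G : SimpleGraph V) (ι : Type*) where
  tree : SimpleGraph ι
  isTree : tree.IsTree
  bag : ι → Finset V
  vertex_mem : ∀ v, ∃ x, v ∈ bag x
  edge_mem : ∀ u v, G.Adj u v → ∃ x, u ∈ bag x ∧ v ∈ bag x
  path_mem : ∀ (x y : ι) (p : tree.Walk x y), p.IsPath → ∀ z ∈ p.support,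
    ∀ v, v ∈ bag x → v ∈ bag y → v ∈ bag z

/-- The size of the largest bag minus one. -/
def TreeDecomposition.width {V ι : Type*} [Fintype ι] {G : SimpleGraph V}
    (T : TreeDecomposition G ι) : ℕ :=
  (Finset.univ.sup fun x => (T.bag x).card) - 1

/-! ### Random access machines -/

namespace RAM

/-- The contents of the memory: integer registers, and integer arrays (numbered by the first
argument) that can be addressed indirectly. -/
structure State where
  reg : ℕ → ℤ
  mem : ℕ → ℤ → ℤ

/-- Arithmetic expressions. `get a e` reads the cell of array `a` whose index is the value
of `e`. -/
inductive Exp where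
  | lit (z : ℤ)
  | var (r : ℕ)
  | get (a : ℕ) (e : Exp)
  | add (e f : Exp)
  | sub (e f : Exp)
  | mul (e f : Exp)

/-- Programs. `set r e` is the assignment `reg r := e`, `store a e f` is the assignment
`mem a e := f`, `ite e f c d` branches on `e < f`, and `loop e f c` repeats `c` while `e < f`. -/
inductive Cmd where
  | skip
  | set (r : ℕ) (e : Exp)
  | store (a : ℕ) (e f : Exp)
  | seq (c d : Cmd)
  | ite (e f : Exp) (c d : Cmd)
  | loop (e f : Exp) (c : Cmd)

/-- The number of bits of the absolute value of an integer. -/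
def bits (z : ℤ) : ℕ := z.natAbs.size

/-- The time needed for arithmetic on `b`-bit numbers: `mul b` is the time needed to multiply them,
and `add b` is the time needed to add, subtract, compare or copy them, or to use them as
addresses. -/
structure ArithCost where
  add : ℕ → ℕ
  mul : ℕ → ℕ

/-- The usual regularity of these times, with constant `A`: the time for multiplication is positive
and nondecreasing, it grows by at most a factor `A` when the number of bits is doubled, and it is at
least a constant fraction `1 / A` of the time for addition. -/
structure ArithCost.IsRegular (i : ArithCost) (A : ℕ) : Prop where
  mul_pos : 0 < i.mul 1
  mul_mono : Monotone i.mul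
  mul_double : ∀ b, i.mul (2 * b) ≤ A * i.mul b
  add_le : ∀ b, i.add b ≤ A * i.mul b

/-- The value of an expression. -/
def Exp.eval (s : State) : Exp → ℤ
  | lit z => z
  | var r => s.reg r
  | get a e => s.mem a (e.eval s)
  | add e f => e.eval s + f.eval s
  | sub e f => e.eval s - f.eval s
  | mul e f => e.eval s * f.eval s

/-- The time needed to evaluate an expression: every operation costs one step plus the time for the
arithmetic on the numbers involved. -/
def Exp.cost (i : ArithCost) (s : State) : Exp → ℕ
  | lit z => 1 + i.add (bits z)
  | var r => 1 + i.add (bits (s.reg r))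
  | get a e => e.cost i s + 1 + i.add (max (bits (e.eval s)) (bits (s.mem a (e.eval s))))
  | add e f => e.cost i s + f.cost i s + 1 + i.add (max (bits (e.eval s)) (bits (f.eval s)))
  | sub e f => e.cost i s + f.cost i s + 1 + i.add (max (bits (e.eval s)) (bits (f.eval s)))
  | mul e f => e.cost i s + f.cost i s + 1 + i.mul (max (bits (e.eval s)) (bits (f.eval s)))

/-- The time needed to evaluate two expressions and then to use the pair of their values, in a
comparison or as the address and the contents of a cell. -/
def pairCost (i : ArithCost) (s : State) (e f : Exp) : ℕ :=
  e.cost i s + f.cost i s + 1 + i.add (max (bits (e.eval s)) (bits (f.eval s)))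

/-- The state after writing `z` into register `r`. -/
def State.setReg (s : State) (r : ℕ) (z : ℤ) : State :=
  { s with reg := Function.update s.reg r z }

/-- The state after writing `z` into cell `j` of array `a`. -/
def State.setMem (s : State) (a : ℕ) (j z : ℤ) : State :=
  { s with mem := Function.update s.mem a (Function.update (s.mem a) j z) }

/-- `Exec i c s τ s'`: the program `c`, started in state `s`, halts in state `s'` after
time `τ`. -/
inductive Exec (i : ArithCost) : Cmd → State → ℕ → State → Prop where
  | skip (s : State) : Exec i Cmd.skip s 1 s
  | set (s : State) (r : ℕ) (e : Exp) :
      Exec i (Cmd.set r e) s (e.cost i s + 1 + i.add (bits (e.eval s))) (s.setReg r (e.eval s))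
  | store (s : State) (a : ℕ) (e f : Exp) :
      Exec i (Cmd.store a e f) s (pairCost i s e f) (s.setMem a (e.eval s) (f.eval s))
  | seq {s s₁ s₂ : State} {c d : Cmd} {τ₁ τ₂ : ℕ} :
      Exec i c s τ₁ s₁ → Exec i d s₁ τ₂ s₂ → Exec i (Cmd.seq c d) s (τ₁ + τ₂) s₂
  | ite_true {s s₁ : State} {e f : Exp} {c d : Cmd} {τ : ℕ} :
      e.eval s < f.eval s → Exec i c s τ s₁ →
      Exec i (Cmd.ite e f c d) s (pairCost i s e f + τ) s₁
  | ite_false {s s₁ : State} {e f : Exp} {c d : Cmd} {τ : ℕ} :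
      ¬ e.eval s < f.eval s → Exec i d s τ s₁ →
      Exec i (Cmd.ite e f c d) s (pairCost i s e f + τ) s₁
  | loop_true {s s₁ s₂ : State} {e f : Exp} {c : Cmd} {τ₁ τ₂ : ℕ} :
      e.eval s < f.eval s → Exec i c s τ₁ s₁ → Exec i (Cmd.loop e f c) s₁ τ₂ s₂ →
      Exec i (Cmd.loop e f c) s (pairCost i s e f + τ₁ + τ₂) s₂
  | loop_false {s : State} {e f : Exp} {c : Cmd} :
      ¬ e.eval s < f.eval s → Exec i (Cmd.loop e f c) s (pairCost i s e f) s

/-- `H` has exactly `m` edges, and their pairs of endpoints are listed, in some order, in the first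
`m` cells of the two arrays `a` and `b`. -/
def ListsEdges {N : ℕ} (H : SimpleGraph (Fin N)) (m : ℕ) (a b : ℤ → ℤ) : Prop :=
  H.edgeSet.ncard = m ∧
  ∀ u v : Fin N, H.Adj u v ↔ ∃ j : ℕ, j < m ∧
    ((a j = (u : ℕ) ∧ b j = (v : ℕ)) ∨ (a j = (v : ℕ) ∧ b j = (u : ℕ)))

/-- The input format for an `n`-vertex graph `G` with a tree decomposition `T` with `t` nodes.
Registers 0, 1, 2 hold `n`, the number of edges of `G`, and `t`; arrays 0 and 1 list the edges of
`G`, arrays 2 and 3 list the edges of the tree, array 4 holds the sizes of the bags, and the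
vertices of the bag of node `x` are listed, in some order, in array 5 from position `x * n` on. The
other registers and arrays are blank. -/
structure Encodes {n t : ℕ} {G : SimpleGraph (Fin n)} (T : TreeDecomposition G (Fin t))
    (s : State) : Prop where
  reg_zero : s.reg 0 = n
  reg_one : s.reg 1 = G.edgeSet.ncard
  reg_two : s.reg 2 = t
  reg_blank : ∀ r, 3 ≤ r → s.reg r = 0
  graph_edges : ListsEdges G G.edgeSet.ncard (s.mem 0) (s.mem 1)
  tree_edges : ListsEdges T.tree (t - 1) (s.mem 2) (s.mem 3)
  bag_card : ∀ x : Fin t, s.mem 4 (x : ℕ) = (T.bag x).card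
  mem_bag : ∀ (x : Fin t) (v : Fin n), v ∈ T.bag x ↔
    ∃ j : ℕ, j < (T.bag x).card ∧ s.mem 5 ((x : ℕ) * n + j) = (v : ℕ)
  mem_blank : ∀ a, 6 ≤ a → ∀ j, s.mem a j = 0

end RAM

/-! The decomposition tree is contracted leaf by leaf, and each remaining node `y` carries a
polynomial `P y` in the vertices, of which only the squarefree coefficients matter. Let `Z` be the
set of eliminated vertices, and let `pmPoly G` be the polynomial whose coefficient at the monomial
of `W` counts the perfect matchings of `G[W]`. The invariant (`DPInv`) is that the coefficient of
`(∏ P y) * pmPoly G` at the complement of `Z` is the number sought. It holds for `Z = ∅` and `P y =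
1`; once every vertex is eliminated, the answer is the constant term of the last polynomial
(`DPInv.finish`).

Let `x` be a leaf with neighbor `p`. A vertex `v` in the bag of `x` but not in that of `p` lies in
no other remaining bag (`bag_of_leaf`). So no other polynomial involves `v`, and the bag of `x`
contains all its remaining neighbors `N`. A coefficient at `U` with `v ∈ U` is the coefficient of
the derivative by `v` at `U \ {v}`. By the choice of the partner of `v` (`pmCount_insert`), the
derivative of `pmPoly G` acts there like multiplication with `∑ u ∈ N, X u`. The Leibniz rule
therefore eliminates `v` by replacing `P x` with its derivative by `v` plus `(∑ u ∈ N, X u) * P x`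
(`sqCoeff_forget_mul`). When all such `v` are gone, `P p` is multiplied by `P x` (`DPInv.merge`).

A table has at most `2 ^ (k + 1)` relevant entries. An elimination costs `O(k 2 ^ k)` instructions
and happens at most `k + 1` times per node. The product is a subset convolution: the slices of both
factors by set size are summed over subsets, multiplied pointwise as polynomials in the size, and
transformed back. A pair of sets with union `A` whose sizes add up to that of `A` is disjoint
(`ranked_convolution`). This takes `O(k ^ 2 2 ^ k)` instructions.

The numbers stay short because the sum of the absolute values of the squarefree coefficients is
submultiplicative, and an elimination increases it by a factor of at most `k + 1`. So table entries
are at most `(k + 1) ^ n`, and all stored numbers have `O(n log (k + 1))` bits (`big_of_le`).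

The machine has no bit operations. Sets are coded in base four, and a set of marked codes decides
whether `u ∈ A` by looking up `code A - 4 ^ u` (`Subsets.val_sub`). Correctness and time are proved
together by the rules for `Reach`, which count instructions; `Exp.cost_le` converts instructions
into time. -/

namespace RAM

/-! ### A program logic with time -/

/-- Whether a program assigns to a register. -/
def Cmd.wr : Cmd → ℕ → Bool
  | .skip, _ => false
  | .set r _, q => r == q
  | .store _ _ _, _ => false
  | .seq c d, q => c.wr q || d.wr q
  | .ite _ _ c d, q => c.wr q || d.wr q
  | .loop _ _ c, q => c.wr q

/-- Whether a program writes into an array. -/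
def Cmd.wm : Cmd → ℕ → Bool
  | .skip, _ => false
  | .set _ _, _ => false
  | .store a _ _, q => a == q
  | .seq c d, q => c.wm q || d.wm q
  | .ite _ _ c d, q => c.wm q || d.wm q
  | .loop _ _ c, q => c.wm q

/-- `s'` agrees with `s` on everything that `c` does not write. -/
structure Frame (c : Cmd) (s s' : State) : Prop where
  reg : ∀ r, c.wr r = false → s'.reg r = s.reg r
  mem : ∀ a, c.wm a = false → s'.mem a = s.mem a

theorem Frame.refl (c : Cmd) (s : State) : Frame c s s := ⟨fun _ _ => rfl, fun _ _ => rfl⟩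

theorem Frame.trans {c : Cmd} {s s₁ s₂ : State} (h : Frame c s s₁) (h' : Frame c s₁ s₂) :
    Frame c s s₂ :=
  ⟨fun r hr => (h'.reg r hr).trans (h.reg r hr), fun r hr => (h'.mem r hr).trans (h.mem r hr)⟩

theorem Frame.mono {c d : Cmd} {s s' : State} (h : Frame c s s')
    (hr : ∀ r, d.wr r = false → c.wr r = false) (hm : ∀ r, d.wm r = false → c.wm r = false) :
    Frame d s s' :=
  ⟨fun r h' => h.reg r (hr r h'), fun r h' => h.mem r (hm r h')⟩

@[simp] theorem setReg_mem (s : State) (r : ℕ) (z : ℤ) : (s.setReg r z).mem = s.mem := rfl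
@[simp] theorem setMem_reg (s : State) (a : ℕ) (j z : ℤ) : (s.setMem a j z).reg = s.reg := rfl
@[simp] theorem setReg_self (s : State) (r : ℕ) (z : ℤ) : (s.setReg r z).reg r = z := by
  simp [State.setReg]
theorem setReg_ne (s : State) {r q : ℕ} (z : ℤ) (h : q ≠ r) :
    (s.setReg r z).reg q = s.reg q := by
  simp [State.setReg, h]
theorem setReg_reg (s : State) (r q : ℕ) (z : ℤ) :
    (s.setReg r z).reg q = if q = r then z else s.reg q := by
  simp [State.setReg, Function.update_apply]
theorem setMem_ne (s : State) {a b : ℕ} (j z : ℤ) (h : b ≠ a) :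
    (s.setMem a j z).mem b = s.mem b := by
  simp [State.setMem, h]
@[simp] theorem setMem_same (s : State) (a : ℕ) (j z : ℤ) (l : ℤ) :
    (s.setMem a j z).mem a l = if l = j then z else s.mem a l := by
  simp [State.setMem, Function.update_apply]

/-- All registers, and all arrays except for the input, contain numbers of at most `B` bits. -/
structure Good (B : ℕ) (s : State) : Prop where
  reg : ∀ r, |s.reg r| < 2 ^ B
  mem : ∀ a, 6 ≤ a → ∀ j, |s.mem a j| < 2 ^ B

/-- All array cells read in the evaluation of an expression contain at most `B` bits. -/
def Exp.Safe (B : ℕ) (s : State) : Exp → Prop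
  | .lit _ => True
  | .var _ => True
  | .get a e => e.Safe B s ∧ |s.mem a (e.eval s)| < 2 ^ B
  | .add e f => e.Safe B s ∧ f.Safe B s
  | .sub e f => e.Safe B s ∧ f.Safe B s
  | .mul e f => e.Safe B s ∧ f.Safe B s

/-- The expression does not read the input arrays. -/
def Exp.hi : Exp → Bool
  | .lit _ => true
  | .var _ => true
  | .get a e => e.hi && (6 ≤ a)
  | .add e f => e.hi && f.hi
  | .sub e f => e.hi && f.hi
  | .mul e f => e.hi && f.hi

/-- `Good` leaves out the input arrays because the input format does not restrict their unlisted
cells. So safety is automatic except for expressions that read the input. -/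
theorem Exp.safe_of_hi {B : ℕ} {s : State} (hs : Good B s) :
    ∀ e : Exp, e.hi = true → e.Safe B s
  | .lit _, _ => trivial
  | .var _, _ => trivial
  | .get a e, h => by
    simp only [Exp.hi, Bool.and_eq_true, decide_eq_true_eq] at h
    exact ⟨safe_of_hi hs e h.1, hs.mem a h.2 _⟩
  | .add e f, h => by
    simp only [Exp.hi, Bool.and_eq_true] at h
    exact ⟨safe_of_hi hs e h.1, safe_of_hi hs f h.2⟩
  | .sub e f, h => by
    simp only [Exp.hi, Bool.and_eq_true] at h
    exact ⟨safe_of_hi hs e h.1, safe_of_hi hs f h.2⟩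
  | .mul e f, h => by
    simp only [Exp.hi, Bool.and_eq_true] at h
    exact ⟨safe_of_hi hs e h.1, safe_of_hi hs f h.2⟩

/-- The value of an expression has at most `e.wt * B` bits. -/
def Exp.wt : Exp → ℕ
  | .lit z => bits z + 1
  | .var _ => 1
  | .get _ _ => 1
  | .add e f => e.wt + f.wt
  | .sub e f => e.wt + f.wt
  | .mul e f => e.wt + f.wt

theorem Exp.wt_pos : ∀ e : Exp, 1 ≤ e.wt
  | .lit z => by simp [wt]
  | .var _ => le_rfl
  | .get _ _ => le_rfl
  | .add e f => le_trans (wt_pos e) (Nat.le_add_right _ _)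
  | .sub e f => le_trans (wt_pos e) (Nat.le_add_right _ _)
  | .mul e f => le_trans (wt_pos e) (Nat.le_add_right _ _)

theorem bits_le_iff {z : ℤ} {b : ℕ} : bits z ≤ b ↔ |z| < 2 ^ b := by
  rw [bits, Nat.size_le, Int.abs_eq_natAbs]
  constructor
  · intro h; exact_mod_cast h
  · intro h; exact_mod_cast h

/-- For positive exponents `2 ^ a + 2 ^ b ≤ 2 ^ (a + b)`. The bound is wasteful, but it lets sums
follow the same rule as products in `Exp.wt`. -/
theorem bits_add_le (x y : ℤ) {a b : ℕ} (ha : 1 ≤ a) (hb : 1 ≤ b) (hx : bits x ≤ a)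
    (hy : bits y ≤ b) : bits (x + y) ≤ a + b := by
  rw [bits_le_iff] at *
  have h1 : (2 : ℤ) ≤ 2 ^ a := by
    calc (2 : ℤ) = 2 ^ 1 := by norm_num
      _ ≤ 2 ^ a := pow_le_pow_right₀ (by norm_num) ha
  have h2 : (2 : ℤ) ≤ 2 ^ b := by
    calc (2 : ℤ) = 2 ^ 1 := by norm_num
      _ ≤ 2 ^ b := pow_le_pow_right₀ (by norm_num) hb
  calc |x + y| ≤ |x| + |y| := abs_add_le x y
    _ < 2 ^ a + 2 ^ b := add_lt_add hx hy
    _ ≤ 2 ^ a * 2 ^ b := by nlinarith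
    _ = 2 ^ (a + b) := (pow_add _ _ _).symm

theorem bits_neg (x : ℤ) : bits (-x) = bits x := by simp [bits]

theorem bits_mul_le (x y : ℤ) {a b : ℕ} (hx : bits x ≤ a) (hy : bits y ≤ b) :
    bits (x * y) ≤ a + b := by
  rw [bits_le_iff] at *
  rw [abs_mul, pow_add]
  exact mul_lt_mul'' hx hy (abs_nonneg _) (abs_nonneg _)

theorem Exp.bits_eval_le {B : ℕ} (hB : 1 ≤ B) {s : State} (hs : Good B s) :
    ∀ e : Exp, e.Safe B s → bits (e.eval s) ≤ e.wt * B
  | .lit z, _ => by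
    simp only [eval, wt]
    nlinarith [Nat.zero_le (bits z)]
  | .var r, _ => by
    simp only [eval, wt, one_mul]
    exact bits_le_iff.2 (hs.reg r)
  | .get a e, h => by
    simp only [eval, wt, one_mul]
    exact bits_le_iff.2 h.2
  | .add e f, h => by
    simp only [eval, wt, add_mul]
    exact bits_add_le _ _ (by nlinarith [e.wt_pos]) (by nlinarith [f.wt_pos])
      (bits_eval_le hB hs e h.1) (bits_eval_le hB hs f h.2)
  | .sub e f, h => by
    simp only [eval, wt, add_mul, sub_eq_add_neg]
    exact bits_add_le _ _ (by nlinarith [e.wt_pos]) (by nlinarith [f.wt_pos])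
      (bits_eval_le hB hs e h.1) ((bits_neg _).trans_le (bits_eval_le hB hs f h.2))
  | .mul e f, h => by
    simp only [eval, wt, add_mul]
    exact bits_mul_le _ _ (bits_eval_le hB hs e h.1) (bits_eval_le hB hs f h.2)

theorem ArithCost.IsRegular.one_le {i : ArithCost} {A : ℕ} (h : i.IsRegular A) : 1 ≤ A := by
  rcases Nat.eq_zero_or_pos A with rfl | hA
  · have h1 := h.mul_double 1
    have h2 := h.mul_mono (show 1 ≤ 2 * 1 by norm_num)
    have := h.mul_pos
    omega
  · exact hA

theorem ArithCost.IsRegular.mul_two_pow {i : ArithCost} {A : ℕ} (h : i.IsRegular A) (b : ℕ) :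
    ∀ j, i.mul (2 ^ j * b) ≤ A ^ j * i.mul b
  | 0 => by simp
  | j + 1 => by
    calc i.mul (2 ^ (j + 1) * b) = i.mul (2 * (2 ^ j * b)) := by ring_nf
      _ ≤ A * i.mul (2 ^ j * b) := h.mul_double _
      _ ≤ A * (A ^ j * i.mul b) := Nat.mul_le_mul_left _ (h.mul_two_pow b j)
      _ = _ := by ring

/-- Only doubling is controlled, so the factor `w` is rounded up to `2 ^ w`. The constant `A ^ w`
does not depend on `b`. -/
theorem ArithCost.IsRegular.mul_le {i : ArithCost} {A : ℕ} (h : i.IsRegular A) {w x b : ℕ}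
    (hx : x ≤ w * b) : i.mul x ≤ A ^ w * i.mul b :=
  (h.mul_mono (hx.trans (Nat.mul_le_mul_right _ Nat.lt_two_pow_self.le))).trans
    (h.mul_two_pow b w)

theorem ArithCost.IsRegular.add_le' {i : ArithCost} {A : ℕ} (h : i.IsRegular A) {w x b : ℕ}
    (hx : x ≤ w * b) : i.add x ≤ A ^ (w + 1) * i.mul b :=
  (h.add_le x).trans ((Nat.mul_le_mul_left _ (h.mul_le hx)).trans_eq (by ring))

theorem ArithCost.IsRegular.one_le_mul {i : ArithCost} {A : ℕ} (h : i.IsRegular A) {b : ℕ}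
    (hb : 1 ≤ b) : 1 ≤ i.mul b :=
  h.mul_pos.trans_le (h.mul_mono hb)

/-- The constant in the cost of an expression. -/
def Exp.con (A : ℕ) : Exp → ℕ
  | .lit z => 1 + A ^ (bits z + 2)
  | .var _ => 1 + A ^ (1 + 1)
  | .get _ e => e.con A + 1 + A ^ (e.wt + 2)
  | .add e f => e.con A + f.con A + 1 + A ^ (e.wt + f.wt + 1)
  | .sub e f => e.con A + f.con A + 1 + A ^ (e.wt + f.wt + 1)
  | .mul e f => e.con A + f.con A + 1 + A ^ (e.wt + f.wt + 1)

/-- Each intermediate value has at most a constant multiple of `B` bits, so each operation costs at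
most a constant times `i.mul B`. The unit step is absorbed because `i.mul B` is at least one. -/
theorem Exp.cost_le {B A : ℕ} {i : ArithCost} (hi : i.IsRegular A) (hB : 1 ≤ B) {s : State}
    (hs : Good B s) : ∀ e : Exp, e.Safe B s → e.cost i s ≤ e.con A * i.mul B
  | .lit z, h => by
    have h1 := hi.add_le' (Exp.bits_eval_le hB hs (.lit z) h)
    have h2 := hi.one_le_mul hB
    simp only [cost, con, eval, wt] at *
    nlinarith
  | .var r, h => by
    have h1 := hi.add_le' (Exp.bits_eval_le hB hs (.var r) h)
    have h2 := hi.one_le_mul hB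
    simp only [cost, con, eval, wt] at *
    nlinarith
  | .get a e, h => by
    have h0 := cost_le hi hB hs e h.1
    have h1 := hi.add_le' (w := e.wt + 1) (b := B)
      (x := max (bits (e.eval s)) (bits (s.mem a (e.eval s))))
      (max_le ((Exp.bits_eval_le hB hs e h.1).trans (Nat.mul_le_mul_right _ (by omega)))
        ((bits_le_iff.2 h.2).trans (by nlinarith)))
    have h2 := hi.one_le_mul hB
    simp only [cost, con] at *
    nlinarith
  | .add e f, h => by
    have h0 := cost_le hi hB hs e h.1
    have h0' := cost_le hi hB hs f h.2
    have h1 := hi.add_le' (w := e.wt + f.wt) (b := B)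
      (x := max (bits (e.eval s)) (bits (f.eval s)))
      (max_le ((Exp.bits_eval_le hB hs e h.1).trans (Nat.mul_le_mul_right _ (by omega)))
        ((Exp.bits_eval_le hB hs f h.2).trans (Nat.mul_le_mul_right _ (by omega))))
    have h2 := hi.one_le_mul hB
    simp only [cost, con] at *
    nlinarith
  | .sub e f, h => by
    have h0 := cost_le hi hB hs e h.1
    have h0' := cost_le hi hB hs f h.2
    have h1 := hi.add_le' (w := e.wt + f.wt) (b := B)
      (x := max (bits (e.eval s)) (bits (f.eval s)))
      (max_le ((Exp.bits_eval_le hB hs e h.1).trans (Nat.mul_le_mul_right _ (by omega)))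
        ((Exp.bits_eval_le hB hs f h.2).trans (Nat.mul_le_mul_right _ (by omega))))
    have h2 := hi.one_le_mul hB
    simp only [cost, con] at *
    nlinarith
  | .mul e f, h => by
    have h0 := cost_le hi hB hs e h.1
    have h0' := cost_le hi hB hs f h.2
    have h1 := hi.mul_le (w := e.wt + f.wt) (b := B)
      (x := max (bits (e.eval s)) (bits (f.eval s)))
      (max_le ((Exp.bits_eval_le hB hs e h.1).trans (Nat.mul_le_mul_right _ (by omega)))
        ((Exp.bits_eval_le hB hs f h.2).trans (Nat.mul_le_mul_right _ (by omega))))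
    have h2 := hi.one_le_mul hB
    have h3 := hi.one_le
    have h4 : A ^ (e.wt + f.wt) ≤ A ^ (e.wt + f.wt + 1) := Nat.pow_le_pow_right h3 (by omega)
    have h5 := h1.trans (Nat.mul_le_mul_right (i.mul B) h4)
    simp only [cost, con] at *
    nlinarith

theorem pairCost_le {B A : ℕ} {i : ArithCost} (hi : i.IsRegular A) (hB : 1 ≤ B) {s : State}
    (hs : Good B s) (e f : Exp) (he : e.Safe B s) (hf : f.Safe B s) :
    pairCost i s e f ≤ (Exp.add e f).con A * i.mul B :=
  Exp.cost_le hi hB hs (.add e f) ⟨he, hf⟩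

/-- The constant in the cost of a program. -/
def Cmd.con (A : ℕ) : Cmd → ℕ
  | .skip => 1
  | .set _ e => e.con A + 1 + A ^ (e.wt + 1)
  | .store _ e f => (Exp.add e f).con A
  | .seq c d => c.con A + d.con A
  | .ite e f c d => (Exp.add e f).con A + c.con A + d.con A
  | .loop e f c => (Exp.add e f).con A + c.con A

/-- Started in the state `s` with numbers of at most `B` bits, the program `c` halts after at most
`m` instructions, in a state with the property `Q`, and its numbers keep to `B` bits. -/
def Reach (B : ℕ) (c : Cmd) (s : State) (m : ℕ) (Q : State → Prop) : Prop :=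
  Good B s → ∃ s', Q s' ∧ Good B s' ∧ Frame c s s' ∧
    ∀ A i, ArithCost.IsRegular i A → ∃ τ, Exec i c s τ s' ∧ τ ≤ c.con A * m * i.mul B

variable {B : ℕ}

theorem Reach.conseq {c : Cmd} {s : State} {m m' : ℕ} {Q Q' : State → Prop}
    (h : Reach B c s m Q) (hm : m ≤ m')
    (hQ : ∀ s', Good B s' → Frame c s s' → Q s' → Q' s') : Reach B c s m' Q' := by
  intro hs
  obtain ⟨s', h1, h2, h3, h4⟩ := h hs
  refine ⟨s', hQ s' h2 h3 h1, h2, h3, fun A i hi => ?_⟩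
  obtain ⟨τ, h5, h6⟩ := h4 A i hi
  exact ⟨τ, h5, h6.trans (Nat.mul_le_mul_right _ (Nat.mul_le_mul_left _ hm))⟩

theorem Reach.with_good {c : Cmd} {s : State} {m : ℕ} {Q : State → Prop}
    (h : Good B s → Reach B c s m Q) : Reach B c s m Q := fun hs => h hs hs

theorem Reach.skip {s : State} {Q : State → Prop} (hB : 1 ≤ B) (h : Q s) :
    Reach B .skip s 1 Q := by
  intro hs
  refine ⟨s, h, hs, Frame.refl _ _, fun A i hi => ⟨1, .skip s, ?_⟩⟩
  have := hi.one_le_mul hB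
  simp only [Cmd.con]; omega

theorem Good.setReg {s : State} (hs : Good B s) (r : ℕ) {z : ℤ} (hz : |z| < 2 ^ B) :
    Good B (s.setReg r z) := by
  refine ⟨fun q => ?_, hs.mem⟩
  rw [setReg_reg]
  split
  · exact hz
  · exact hs.reg q

theorem Good.setMem {s : State} (hs : Good B s) (a : ℕ) (j : ℤ) {z : ℤ} (hz : |z| < 2 ^ B) :
    Good B (s.setMem a j z) := by
  refine ⟨hs.reg, fun b hb l => ?_⟩
  by_cases h : b = a
  · subst h
    rw [setMem_same]
    split
    · exact hz
    · exact hs.mem b hb l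
  · rw [setMem_ne _ _ _ h]
    exact hs.mem b hb l

theorem Reach.set' {s : State} {Q : State → Prop} {r : ℕ} {e : Exp} (hB : 1 ≤ B)
    (he : e.Safe B s) (hz : |e.eval s| < 2 ^ B) (h : Q (s.setReg r (e.eval s))) :
    Reach B (.set r e) s 1 Q := by
  intro hs
  refine ⟨_, h, hs.setReg r hz, ⟨fun q hq => ?_, fun _ _ => rfl⟩, fun A i hi =>
    ⟨_, .set s r e, ?_⟩⟩
  · simp only [Cmd.wr, beq_eq_false_iff_ne] at hq
    exact setReg_ne _ _ (Ne.symm hq)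
  · have h1 := Exp.cost_le hi hB hs e he
    have h2 := hi.add_le' (Exp.bits_eval_le hB hs e he)
    have h3 := hi.one_le_mul hB
    simp only [Cmd.con]
    nlinarith

theorem Reach.set {s : State} {Q : State → Prop} {r : ℕ} {e : Exp} (hB : 1 ≤ B)
    (he : e.hi = true) (hz : |e.eval s| < 2 ^ B) (h : Q (s.setReg r (e.eval s))) :
    Reach B (.set r e) s 1 Q :=
  Reach.with_good fun hs => Reach.set' hB (Exp.safe_of_hi hs e he) hz h

theorem Reach.store' {s : State} {Q : State → Prop} {a : ℕ} {e f : Exp} (hB : 1 ≤ B)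
    (he : e.Safe B s) (hf : f.Safe B s) (hz : |f.eval s| < 2 ^ B)
    (h : Q (s.setMem a (e.eval s) (f.eval s))) : Reach B (.store a e f) s 1 Q := by
  intro hs
  refine ⟨_, h, hs.setMem a _ hz, ⟨fun _ _ => rfl, fun q hq => ?_⟩, fun A i hi =>
    ⟨_, .store s a e f, ?_⟩⟩
  · simp only [Cmd.wm, beq_eq_false_iff_ne] at hq
    exact setMem_ne _ _ _ (Ne.symm hq)
  · have h1 := pairCost_le hi hB hs e f he hf
    simp only [Cmd.con]
    linarith

theorem Reach.store {s : State} {Q : State → Prop} {a : ℕ} {e f : Exp} (hB : 1 ≤ B)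
    (he : e.hi = true) (hf : f.hi = true) (hz : |f.eval s| < 2 ^ B)
    (h : Q (s.setMem a (e.eval s) (f.eval s))) : Reach B (.store a e f) s 1 Q :=
  Reach.with_good fun hs =>
    Reach.store' hB (Exp.safe_of_hi hs e he) (Exp.safe_of_hi hs f hf) hz h

theorem Reach.seq {c d : Cmd} {s : State} {m₁ m₂ : ℕ} {R Q : State → Prop}
    (h₁ : Reach B c s m₁ R)
    (h₂ : ∀ s', Good B s' → Frame c s s' → R s' → Reach B d s' m₂ Q) :
    Reach B (.seq c d) s (m₁ + m₂) Q := by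
  intro hs
  obtain ⟨s₁, a1, a2, a3, a4⟩ := h₁ hs
  obtain ⟨s₂, b1, b2, b3, b4⟩ := h₂ s₁ a2 a3 a1 a2
  refine ⟨s₂, b1, b2, Frame.trans (a3.mono ?_ ?_) (b3.mono ?_ ?_), fun A i hi => ?_⟩
  · intro r hr; simp only [Cmd.wr, Bool.or_eq_false_iff] at hr; exact hr.1
  · intro r hr; simp only [Cmd.wm, Bool.or_eq_false_iff] at hr; exact hr.1
  · intro r hr; simp only [Cmd.wr, Bool.or_eq_false_iff] at hr; exact hr.2
  · intro r hr; simp only [Cmd.wm, Bool.or_eq_false_iff] at hr; exact hr.2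
  · obtain ⟨τ₁, a5, a6⟩ := a4 A i hi
    obtain ⟨τ₂, b5, b6⟩ := b4 A i hi
    refine ⟨_, .seq a5 b5, (add_le_add a6 b6).trans ?_⟩
    rw [← add_mul]
    refine Nat.mul_le_mul_right _ ?_
    simp only [Cmd.con]
    nlinarith [Nat.zero_le (c.con A * m₂), Nat.zero_le (d.con A * m₁)]

theorem Reach.ite' {c d : Cmd} {e f : Exp} {s : State} {m : ℕ} {Q : State → Prop} (hB : 1 ≤ B)
    (he : e.hi = true) (hf : f.hi = true)
    (h₁ : e.eval s < f.eval s → Reach B c s m Q)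
    (h₂ : ¬ e.eval s < f.eval s → Reach B d s m Q) :
    Reach B (.ite e f c d) s (m + 1) Q := by
  intro hs
  have hp := fun A i (hi : ArithCost.IsRegular i A) => pairCost_le hi hB hs e f
    (Exp.safe_of_hi hs e he) (Exp.safe_of_hi hs f hf)
  by_cases hc : e.eval s < f.eval s
  · obtain ⟨s₁, a1, a2, a3, a4⟩ := h₁ hc hs
    refine ⟨s₁, a1, a2, a3.mono ?_ ?_, fun A i hi => ?_⟩
    · intro r hr; simp only [Cmd.wr, Bool.or_eq_false_iff] at hr; exact hr.1
    · intro r hr; simp only [Cmd.wm, Bool.or_eq_false_iff] at hr; exact hr.1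
    · obtain ⟨τ₁, a5, a6⟩ := a4 A i hi
      refine ⟨_, .ite_true hc a5, (add_le_add (hp A i hi) a6).trans ?_⟩
      rw [← add_mul]
      refine Nat.mul_le_mul_right _ ?_
      simp only [Cmd.con]
      nlinarith [Nat.zero_le ((Exp.add e f).con A * m), Nat.zero_le (d.con A * (m + 1))]
  · obtain ⟨s₁, a1, a2, a3, a4⟩ := h₂ hc hs
    refine ⟨s₁, a1, a2, a3.mono ?_ ?_, fun A i hi => ?_⟩
    · intro r hr; simp only [Cmd.wr, Bool.or_eq_false_iff] at hr; exact hr.2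
    · intro r hr; simp only [Cmd.wm, Bool.or_eq_false_iff] at hr; exact hr.2
    · obtain ⟨τ₁, a5, a6⟩ := a4 A i hi
      refine ⟨_, .ite_false hc a5, (add_le_add (hp A i hi) a6).trans ?_⟩
      rw [← add_mul]
      refine Nat.mul_le_mul_right _ ?_
      simp only [Cmd.con]
      nlinarith [Nat.zero_le ((Exp.add e f).con A * m), Nat.zero_le (c.con A * (m + 1))]

/-- A loop, with a bound `μ` on the number of remaining rounds. -/
theorem Reach.loop {e f : Exp} {c : Cmd} {s : State} {m : ℕ} (hB : 1 ≤ B)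
    (he : e.hi = true) (hf : f.hi = true) (I : ℕ → State → Prop)
    (step : ∀ μ s', Good B s' → Frame c s s' → I μ s' → e.eval s' < f.eval s' →
      ∃ ν, μ = ν + 1 ∧ Reach B c s' m (I ν)) (μ : ℕ) (h : I μ s) :
    Reach B (.loop e f c) s (1 + μ * (m + 1))
      (fun s' => (∃ ν, I ν s') ∧ ¬ e.eval s' < f.eval s') := by
  -- The induction runs over the later states of the loop; the frame ties them to the initial state,
  -- as `step` requires.
  suffices H : ∀ μ s', Frame c s s' → I μ s' → Reach B (.loop e f c) s' (1 + μ * (m + 1))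
      (fun s' => (∃ ν, I ν s') ∧ ¬ e.eval s' < f.eval s') from H μ s (Frame.refl _ _) h
  intro μ
  induction μ with
  | zero =>
    intro s' hF hI hs
    by_cases hc : e.eval s' < f.eval s'
    · obtain ⟨ν, h, -⟩ := step 0 s' hs hF hI hc
      omega
    · refine ⟨s', ⟨⟨_, hI⟩, hc⟩, hs, Frame.refl _ _, fun A i hi => ⟨_, .loop_false hc, ?_⟩⟩
      refine (pairCost_le hi hB hs e f (Exp.safe_of_hi hs e he) (Exp.safe_of_hi hs f hf)).trans
        (Nat.mul_le_mul_right _ ?_)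
      simp only [Cmd.con]
      omega
  | succ μ ih =>
    intro s' hF hI hs
    have hp := fun A i (hi : ArithCost.IsRegular i A) => pairCost_le hi hB hs e f
      (Exp.safe_of_hi hs e he) (Exp.safe_of_hi hs f hf)
    by_cases hc : e.eval s' < f.eval s'
    · obtain ⟨ν, h, hR⟩ := step _ s' hs hF hI hc
      obtain rfl : ν = μ := by omega
      obtain ⟨s₁, a1, a2, a3, a4⟩ := hR hs
      obtain ⟨s₂, b1, b2, b3, b4⟩ := ih s₁ (hF.trans a3) a1 a2
      refine ⟨s₂, b1, b2, Frame.trans ⟨a3.reg, a3.mem⟩ b3, fun A i hi => ?_⟩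
      obtain ⟨τ₁, a5, a6⟩ := a4 A i hi
      obtain ⟨τ₂, b5, b6⟩ := b4 A i hi
      refine ⟨_, .loop_true hc a5 b5, (add_le_add (add_le_add (hp A i hi) a6) b6).trans ?_⟩
      rw [← add_mul, ← add_mul]
      refine Nat.mul_le_mul_right _ ?_
      simp only [Cmd.con]
      nlinarith [Nat.zero_le ((Exp.add e f).con A * m)]
    · refine ⟨s', ⟨⟨_, hI⟩, hc⟩, hs, Frame.refl _ _, fun A i hi => ⟨_, .loop_false hc, ?_⟩⟩
      refine (hp A i hi).trans (Nat.mul_le_mul_right _ ?_)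
      simp only [Cmd.con]
      nlinarith [Nat.zero_le ((Exp.add e f).con A * (1 + (μ + 1) * (m + 1))),
        Nat.zero_le (c.con A * (1 + (μ + 1) * (m + 1))),
        Nat.zero_le ((Exp.add e f).con A * ((μ + 1) * (m + 1)))]

/-- Repeat `c` for all values of the register `r` from `0` to the value of `e`, exclusive. -/
def Cmd.for (r : ℕ) (e : Exp) (c : Cmd) : Cmd :=
  .seq (.set r (.lit 0)) (.loop (.var r) e (.seq c (.set r (.add (.var r) (.lit 1)))))

/-- The bound `e` is evaluated anew in each round, so `heN` asks for its value in every state that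
differs from `s` only by what the loop writes. The invariant refers to states in which the counter
already holds its next value. A round takes `m` instructions, a test and an increment. -/
theorem Reach.for {r : ℕ} {e : Exp} {c : Cmd} {s : State} {N m : ℕ} (hB : 1 ≤ B)
    (I : ℕ → State → Prop) (hr : c.wr r = false) (he : e.hi = true) (hN : (N : ℤ) < 2 ^ B)
    (heN : ∀ s', Frame (.for r e c) s s' → e.eval s' = N)
    (h0 : I 0 (s.setReg r 0))
    (step : ∀ j < N, ∀ s', Good B s' → Frame (.for r e c) s s' → s'.reg r = j → I j s' →
      Reach B c s' m (fun s'' => I (j + 1) (s''.setReg r (j + 1 : ℕ)))) :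
    Reach B (.for r e c) s (2 + N * (m + 2)) (I N) := by
  have key : ∀ s', Frame (.set r (.lit 0)) s s' → s'.reg r = 0 ∧ I 0 s' →
      Reach B (.loop (.var r) e (.seq c (.set r (.add (.var r) (.lit 1))))) s'
        (1 + N * ((m + 1) + 1)) (I N) := by
    rintro s' hF ⟨h1, h2⟩
    have hFm : ∀ s₁, Frame (.seq c (.set r (.add (.var r) (.lit 1)))) s' s₁ →
        Frame (.for r e c) s s₁ := fun s₁ h =>
      Frame.trans (hF.mono
        (fun q hq => by simp only [Cmd.for, Cmd.wr, Bool.or_eq_false_iff] at hq; exact hq.1)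
        (fun q hq => rfl))
        (h.mono (fun q hq => by
          simp only [Cmd.for, Cmd.wr, Bool.or_eq_false_iff] at hq ⊢; exact hq.2)
        (fun q hq => by
          simp only [Cmd.for, Cmd.wm, Bool.or_eq_false_iff] at hq ⊢; exact hq.2))
    refine Reach.conseq (Reach.loop hB rfl he
      (fun μ s₁ => ∃ j : ℕ, j + μ = N ∧ s₁.reg r = j ∧ I j s₁ ∧ Frame (.for r e c) s s₁)
      ?_ N ⟨0, by simp, by simpa using h1, h2, hFm _ (Frame.refl _ _)⟩) le_rfl ?_
    · rintro μ s₁ hg hF₁ ⟨j, hj, hj1, hj2, hj3⟩ hlt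
      have h4 := heN s₁ hj3
      have hjN : j < N := by
        simp only [Exp.eval, hj1, h4] at hlt
        exact_mod_cast hlt
      refine ⟨μ - 1, by omega, ?_⟩
      refine Reach.seq (step j hjN s₁ hg hj3 hj1 hj2) ?_
      intro s₂ hg₂ hF₂ hI₂
      have h5 : s₂.reg r = j := (hF₂.reg r hr).trans hj1
      have h6 : (Exp.add (.var r) (.lit 1)).eval s₂ = ((j + 1 : ℕ) : ℤ) := by
        simp [Exp.eval, h5]
      refine Reach.conseq (Reach.set (Q := fun s₃ => s₃ = s₂.setReg r (j + 1 : ℕ)) hB rfl ?_ ?_)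
        le_rfl ?_
      · rw [h6, abs_of_nonneg (by positivity)]
        exact lt_of_le_of_lt (by exact_mod_cast hjN) hN
      · rw [h6]
      · rintro s₃ - hF₃ rfl
        refine ⟨j + 1, by omega, by simp, hI₂, ?_⟩
        refine Frame.trans hj3 ?_
        refine Frame.trans (hF₂.mono ?_ ?_) (hF₃.mono ?_ ?_)
        · intro q hq; simp only [Cmd.for, Cmd.wr, Bool.or_eq_false_iff] at hq; exact hq.2.1
        · intro q hq; simp only [Cmd.for, Cmd.wm, Bool.or_eq_false_iff] at hq; exact hq.2.1
        · intro q hq; simp only [Cmd.for, Cmd.wr, Bool.or_eq_false_iff] at hq; exact hq.1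
        · intro q hq; rfl
    · rintro s₁ - - ⟨⟨μ, j, hj, hj1, hj2, hj3⟩, hlt⟩
      have h4 := heN s₁ hj3
      simp only [Exp.eval, hj1, h4] at hlt
      have : j = N := by
        have : ¬ j < N := fun h => hlt (by exact_mod_cast h)
        omega
      exact this ▸ hj2
  refine Reach.conseq (Reach.seq (m₁ := 1) (Reach.set (Q := fun s' => s'.reg r = 0 ∧ I 0 s') hB rfl
    (by simp [Exp.eval]) ⟨by simp [Exp.eval], h0⟩) fun s' _ hF h => key s' hF h) ?_
    (fun _ _ _ h => h)
  ring_nf; exact le_rfl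

end RAM

/-! ### Squarefree coefficients of polynomials -/

section SquarefreeCoefficients

open MvPolynomial

variable {V : Type*} [DecidableEq V]

/-- The coefficient of the product of the variables in `A`. -/
noncomputable def sqCoeff (P : MvPolynomial V ℤ) (A : Finset V) : ℤ :=
  coeff (Finsupp.indicator A fun _ _ => 1) P

theorem indicator_one_apply (A : Finset V) (v : V) :
    (Finsupp.indicator A fun _ _ => (1 : ℕ)) v = if v ∈ A then 1 else 0 := by
  simp [Finsupp.indicator_apply]

theorem indicator_one_injective {A B : Finset V}
    (h : (Finsupp.indicator A fun _ _ => (1 : ℕ)) = Finsupp.indicator B fun _ _ => 1) :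
    A = B := by
  ext v
  have := DFunLike.congr_fun h v
  rw [indicator_one_apply, indicator_one_apply] at this
  by_cases h1 : v ∈ A <;> by_cases h2 : v ∈ B <;> simp_all

/-- A squarefree monomial factors only into squarefree monomials with disjoint supports, so its
antidiagonal is in bijection with the subsets of `A`. -/
theorem sqCoeff_mul (P Q : MvPolynomial V ℤ) (A : Finset V) :
    sqCoeff (P * Q) A = ∑ B ∈ A.powerset, sqCoeff P B * sqCoeff Q (A \ B) := by
  rw [sqCoeff, coeff_mul]
  symm
  refine Finset.sum_nbij' (i := fun B => (Finsupp.indicator B fun _ _ => 1,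
    Finsupp.indicator (A \ B) fun _ _ => 1)) (j := fun f => f.1.support) ?_ ?_ ?_ ?_ ?_
  · intro B hB
    rw [Finset.mem_powerset] at hB
    rw [Finset.HasAntidiagonal.mem_antidiagonal]
    ext v
    simp only [Finsupp.add_apply, indicator_one_apply, Finset.mem_sdiff]
    by_cases h1 : v ∈ A <;> by_cases h2 : v ∈ B <;> simp [h1, h2]
    exact h1 (hB h2)
  · intro f hf
    rw [Finset.HasAntidiagonal.mem_antidiagonal] at hf
    rw [Finset.mem_powerset]
    intro v hv
    have := DFunLike.congr_fun hf v
    rw [indicator_one_apply, Finsupp.add_apply] at this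
    rw [Finsupp.mem_support_iff] at hv
    by_contra h
    simp [h] at this
    exact hv this.1
  · intro B hB
    ext v
    simp [Finsupp.indicator_apply]
  · rintro ⟨f, g⟩ hf
    rw [Finset.HasAntidiagonal.mem_antidiagonal] at hf
    have key : ∀ v, f v + g v = if v ∈ A then 1 else 0 := fun v => by
      have := DFunLike.congr_fun hf v
      rwa [indicator_one_apply, Finsupp.add_apply] at this
    ext v
    · simp only [indicator_one_apply, Finsupp.mem_support_iff]
      have := key v
      split_ifs at this ⊢ <;> omega
    · simp only [indicator_one_apply, Finsupp.mem_support_iff, Finset.mem_sdiff]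
      have := key v
      split_ifs at this ⊢ <;> first | omega | (simp_all; done) | skip
      all_goals grind
  · intro B hB
    rfl

theorem sqCoeff_one (A : Finset V) : sqCoeff 1 A = if A = ∅ then 1 else 0 := by
  rw [sqCoeff, coeff_one]
  congr 1
  rw [eq_iff_iff]
  constructor
  · intro h
    apply indicator_one_injective
    rw [← h]
    ext v; simp
  · rintro rfl
    ext v; simp

theorem sqCoeff_add (P Q : MvPolynomial V ℤ) (A : Finset V) :
    sqCoeff (P + Q) A = sqCoeff P A + sqCoeff Q A := coeff_add _ _ _

theorem sqCoeff_sum {ι : Type*} (s : Finset ι) (P : ι → MvPolynomial V ℤ) (A : Finset V) :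
    sqCoeff (∑ i ∈ s, P i) A = ∑ i ∈ s, sqCoeff (P i) A := coeff_sum _ _ _

theorem sqCoeff_X_mul (u : V) (P : MvPolynomial V ℤ) (A : Finset V) :
    sqCoeff (X u * P) A = if u ∈ A then sqCoeff P (A.erase u) else 0 := by
  rw [sqCoeff, coeff_X_mul']
  by_cases h : u ∈ A
  · rw [if_pos (by simp [h]), if_pos h, sqCoeff]
    congr 1
    ext v
    simp only [Finsupp.tsub_apply, indicator_one_apply, Finsupp.single_apply, Finset.mem_erase]
    by_cases h1 : v = u
    · subst h1; simp [h]
    · simp [h1, Ne.symm h1]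
  · rw [if_neg (by simp [h]), if_neg h]

theorem sqCoeff_sum_X_mul (N : Finset V) (P : MvPolynomial V ℤ) (A : Finset V) :
    sqCoeff ((∑ u ∈ N, X u) * P) A = ∑ u ∈ N, if u ∈ A then sqCoeff P (A.erase u) else 0 := by
  rw [Finset.sum_mul, sqCoeff_sum]
  exact Finset.sum_congr rfl fun u _ => sqCoeff_X_mul u P A

/-- The variable `v` has exponent one in the monomial that is differentiated, so no numerical factor
arises. -/
theorem sqCoeff_pderiv {v : V} {A : Finset V} (hv : v ∉ A) (P : MvPolynomial V ℤ) :
    sqCoeff (pderiv v P) A = sqCoeff P (insert v A) := by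
  rw [sqCoeff, coeff_pderiv, sqCoeff, indicator_one_apply, if_neg hv]
  simp only [Nat.cast_zero, zero_add, mul_one]
  congr 1
  ext w
  simp only [Finsupp.add_apply, indicator_one_apply, Finsupp.single_apply, Finset.mem_insert]
  by_cases h : w = v
  · subst h; simp [hv]
  · simp [h, Ne.symm h]

/-- This permits replacing a factor by a polynomial that agrees with it only on the squarefree terms
within `A`. -/
theorem sqCoeff_mul_congr {P P' Q Q' : MvPolynomial V ℤ} {A : Finset V}
    (hP : ∀ B ⊆ A, sqCoeff P B = sqCoeff P' B) (hQ : ∀ B ⊆ A, sqCoeff Q B = sqCoeff Q' B) :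
    sqCoeff (P * Q) A = sqCoeff (P' * Q') A := by
  rw [sqCoeff_mul, sqCoeff_mul]
  refine Finset.sum_congr rfl fun B hB => ?_
  rw [hP B (Finset.mem_powerset.1 hB), hQ _ Finset.sdiff_subset]

/-- The polynomial with the given squarefree coefficients. -/
noncomputable def sqPoly [Fintype V] (f : Finset V → ℤ) : MvPolynomial V ℤ :=
  ∑ A : Finset V, monomial (Finsupp.indicator A fun _ _ => 1) (f A)

theorem sqCoeff_sqPoly [Fintype V] (f : Finset V → ℤ) (A : Finset V) :
    sqCoeff (sqPoly f) A = f A := by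
  rw [sqPoly, sqCoeff_sum, Finset.sum_eq_single A]
  · simp [sqCoeff]
  · intro B _ hB
    rw [sqCoeff, coeff_monomial, if_neg fun h => hB (indicator_one_injective h)]
  · simp

/-- The sum of the absolute values of the squarefree coefficients in the variables in `U`. -/
noncomputable def sqNorm (U : Finset V) (P : MvPolynomial V ℤ) : ℤ :=
  ∑ A ∈ U.powerset, |sqCoeff P A|

theorem abs_sqCoeff_le {U A : Finset V} (hA : A ⊆ U) (P : MvPolynomial V ℤ) :
    |sqCoeff P A| ≤ sqNorm U P :=
  Finset.single_le_sum (f := fun A => |sqCoeff P A|) (fun _ _ => abs_nonneg _)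
    (Finset.mem_powerset.2 hA)

/-- For a fixed factor `B`, the map `A ↦ A \ B` is injective on the sets that contain `B`, so each
coefficient of `Q` is counted at most once with each coefficient of `P`. -/
theorem sqNorm_mul_le (U : Finset V) (P Q : MvPolynomial V ℤ) :
    sqNorm U (P * Q) ≤ sqNorm U P * sqNorm U Q := by
  calc sqNorm U (P * Q)
      ≤ ∑ A ∈ U.powerset, ∑ B ∈ A.powerset, |sqCoeff P B| * |sqCoeff Q (A \ B)| := by
        refine Finset.sum_le_sum fun A _ => ?_
        rw [sqCoeff_mul]
        refine (Finset.abs_sum_le_sum_abs _ _).trans (Finset.sum_le_sum fun B _ => ?_)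
        rw [abs_mul]
    _ = ∑ B ∈ U.powerset, ∑ A ∈ U.powerset with B ⊆ A,
          |sqCoeff P B| * |sqCoeff Q (A \ B)| := by
        refine Finset.sum_comm' fun A B => ?_
        simp only [Finset.mem_powerset, Finset.mem_filter]
        constructor
        · rintro ⟨h1, h2⟩; exact ⟨⟨h1, h2⟩, h2.trans h1⟩
        · rintro ⟨⟨h1, h2⟩, -⟩; exact ⟨h1, h2⟩
    _ ≤ ∑ B ∈ U.powerset, |sqCoeff P B| * sqNorm U Q := by
        refine Finset.sum_le_sum fun B _ => ?_
        rw [← Finset.mul_sum]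
        refine mul_le_mul_of_nonneg_left ?_ (abs_nonneg _)
        rw [← Finset.sum_image (s := (U.powerset).filter fun A => B ⊆ A) (g := fun A => A \ B)
          (f := fun C => |sqCoeff Q C|)]
        · refine Finset.sum_le_sum_of_subset_of_nonneg ?_ fun _ _ _ => abs_nonneg _
          intro C hC
          simp only [Finset.mem_image, Finset.mem_filter, Finset.mem_powerset] at hC ⊢
          obtain ⟨A, ⟨h1, h2⟩, rfl⟩ := hC
          exact Finset.sdiff_subset.trans h1
        · intro A hA A' hA' h
          simp only [Finset.coe_filter, Finset.mem_powerset, Set.mem_ofPred_eq] at hA hA'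
          rw [← Finset.sdiff_union_of_subset hA.2, ← Finset.sdiff_union_of_subset hA'.2]
          simp only at h
          rw [h]
    _ = _ := by rw [← Finset.sum_mul]; rfl

theorem sqNorm_nonneg (U : Finset V) (P : MvPolynomial V ℤ) : 0 ≤ sqNorm U P :=
  Finset.sum_nonneg fun _ _ => abs_nonneg _

theorem sqNorm_mono {U U' : Finset V} (h : U ⊆ U') (P : MvPolynomial V ℤ) :
    sqNorm U P ≤ sqNorm U' P :=
  Finset.sum_le_sum_of_subset_of_nonneg (Finset.powerset_mono.2 h) fun _ _ _ => abs_nonneg _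

theorem sqNorm_add_le (U : Finset V) (P Q : MvPolynomial V ℤ) :
    sqNorm U (P + Q) ≤ sqNorm U P + sqNorm U Q := by
  rw [sqNorm, sqNorm, sqNorm, ← Finset.sum_add_distrib]
  refine Finset.sum_le_sum fun A _ => ?_
  rw [sqCoeff_add]
  exact abs_add_le _ _

theorem sqNorm_one (U : Finset V) : sqNorm U 1 = 1 := by
  rw [sqNorm, Finset.sum_eq_single ∅]
  · simp [sqCoeff_one]
  · intro B _ hB
    simp [sqCoeff_one, hB]
  · simp

theorem sqNorm_X_mul_le (U : Finset V) (u : V) (P : MvPolynomial V ℤ) :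
    sqNorm U (X u * P) ≤ sqNorm U P := by
  refine (sqNorm_mul_le U _ _).trans ?_
  refine mul_le_of_le_one_left (sqNorm_nonneg _ _) ?_
  rw [sqNorm]
  calc ∑ A ∈ U.powerset, |sqCoeff (X u) A| ≤ ∑ A ∈ U.powerset, if A = {u} then 1 else 0 := by
        refine Finset.sum_le_sum fun A _ => ?_
        have := sqCoeff_X_mul u 1 A
        rw [mul_one] at this
        rw [this, sqCoeff_one]
        split_ifs with h1 h2 h3 h3 h3 <;> simp_all
        exact h3 (by rw [← Finset.insert_erase h1, h2]; rfl)
    _ ≤ 1 := by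
        rw [Finset.sum_ite_eq']
        split_ifs <;> norm_num

theorem sqNorm_sum_X_mul_le (U N : Finset V) (P : MvPolynomial V ℤ) :
    sqNorm U ((∑ u ∈ N, X u) * P) ≤ N.card * sqNorm U P := by
  induction N using Finset.induction_on with
  | empty => simp [sqNorm, sqCoeff]
  | insert u N hu ih =>
    rw [Finset.sum_insert hu, add_mul, Finset.card_insert_of_notMem hu]
    refine (sqNorm_add_le _ _ _).trans ?_
    push_cast
    linarith [sqNorm_X_mul_le U u P]

/-- The derivative only selects coefficients of `P`, at the distinct sets `insert v A`. -/
theorem sqNorm_erase_pderiv_le (U : Finset V) {v : V} (hv : v ∈ U) (P : MvPolynomial V ℤ) :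
    sqNorm (U.erase v) (pderiv v P) ≤ sqNorm U P := by
  calc sqNorm (U.erase v) (pderiv v P)
      = ∑ A ∈ (U.erase v).powerset, |sqCoeff P (insert v A)| := by
        refine Finset.sum_congr rfl fun A hA => ?_
        rw [sqCoeff_pderiv]
        intro h
        exact absurd (Finset.mem_powerset.1 hA h) (by simp)
    _ = ∑ A ∈ (U.erase v).powerset.image (insert v), |sqCoeff P A| := by
        rw [Finset.sum_image]
        intro A hA A' hA' h
        have h1 : v ∉ A := fun h => absurd (Finset.mem_powerset.1 hA h) (by simp)
        have h2 : v ∉ A' := fun h => absurd (Finset.mem_powerset.1 hA' h) (by simp)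
        rw [← Finset.erase_insert h1, ← Finset.erase_insert h2, h]
    _ ≤ _ := by
        refine Finset.sum_le_sum_of_subset_of_nonneg ?_ fun _ _ _ => abs_nonneg _
        intro C hC
        simp only [Finset.mem_image, Finset.mem_powerset] at hC ⊢
        obtain ⟨A, h1, rfl⟩ := hC
        exact Finset.insert_subset hv (h1.trans (Finset.erase_subset _ _))

/-! ### Counting matchings -/

/-- The number of perfect matchings of the subgraph induced on `W`. -/
noncomputable def pmCount (G : SimpleGraph V) (W : Finset V) : ℕ :=
  {M : G.Subgraph | M.IsMatching ∧ M.verts = W}.ncard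

theorem pmCount_univ [Fintype V] (G : SimpleGraph V) :
    pmCount G Finset.univ = {M : G.Subgraph | M.IsPerfectMatching}.ncard := by
  rw [pmCount]
  congr 1
  ext M
  simp only [Set.mem_ofPred_eq, Finset.coe_univ, SimpleGraph.Subgraph.IsPerfectMatching]
  rw [SimpleGraph.Subgraph.isSpanning_iff]

theorem pmCount_empty (G : SimpleGraph V) : pmCount G ∅ = 1 := by
  rw [pmCount, Set.ncard_eq_one]
  refine ⟨⊥, ?_⟩
  ext M
  simp only [Set.mem_ofPred_eq, Finset.coe_empty, Set.mem_singleton_iff]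
  constructor
  · rintro ⟨-, h⟩
    ext u v
    · simp [h]
    · simp only [SimpleGraph.Subgraph.not_bot_adj, iff_false]
      intro h'
      have := M.edge_vert h'
      simp [h] at this
  · rintro rfl
    exact ⟨fun v hv => by simp at hv, rfl⟩

-- Deleting `u` and `v` removes just the edge between them; adding this edge to a matching of the
-- remaining vertices is the inverse.
open SimpleGraph in
theorem ncard_matching_adj {G : SimpleGraph V} {u v : V} (huv : G.Adj u v) {W : Finset V}
    (hu : u ∈ W) (hv : v ∈ W) :
    {M : G.Subgraph | (M.IsMatching ∧ M.verts = W) ∧ M.Adj v u}.ncard =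
      pmCount G ((W.erase v).erase u) := by
  have hne : u ≠ v := huv.ne
  refine Set.ncard_congr (fun M _ => M.deleteVerts {u, v}) ?_ ?_ ?_
  · rintro M ⟨⟨hM, hW⟩, hadj⟩
    refine ⟨fun w hw => ?_, ?_⟩
    · simp only [Subgraph.deleteVerts_verts, hW, Set.mem_sdiff, Finset.mem_coe,
        Set.mem_insert_iff, Set.mem_singleton_iff, not_or] at hw
      obtain ⟨w', h1, h2⟩ := hM (hW ▸ Finset.mem_coe.2 hw.1)
      refine ⟨w', ?_, ?_⟩
      · simp only [Subgraph.deleteVerts_adj, Set.mem_insert_iff, Set.mem_singleton_iff, not_or]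
        refine ⟨h1.fst_mem, hw.2, h1.snd_mem, ⟨?_, ?_⟩, h1⟩
        · rintro rfl
          exact hw.2.2 (hM.eq_of_adj_right h1 hadj)
        · rintro rfl
          exact hw.2.1 (hM.eq_of_adj_right h1 hadj.symm)
      · intro y hy
        rw [Subgraph.deleteVerts_adj] at hy
        exact h2 y hy.2.2.2.2
    · ext w
      simp only [Subgraph.deleteVerts_verts, hW, Set.mem_sdiff, Finset.mem_coe,
        Set.mem_insert_iff, Set.mem_singleton_iff, not_or, Finset.mem_erase]
      tauto
  · rintro M M' ⟨⟨hM, hW⟩, hadj⟩ ⟨⟨hM', hW'⟩, hadj'⟩ h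
    ext a b
    · rw [hW, hW']
    · have h1 : (M.deleteVerts {u, v}).Adj a b ↔ (M'.deleteVerts {u, v}).Adj a b := by
        exact h ▸ Iff.rfl
      simp only [Subgraph.deleteVerts_adj, Set.mem_insert_iff, Set.mem_singleton_iff] at h1
      -- At `u` and `v` both matchings consist of the same edge, so only edges that survive the
      -- deletion could distinguish them.
      have key : ∀ {N N' : G.Subgraph}, N.IsMatching → N.Adj v u → N'.Adj v u →
          ∀ {a b}, (a = u ∨ a = v) → N.Adj a b → N'.Adj a b := by
        rintro N N' hN hNa hNa' a b (rfl | rfl) hab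
        · rw [hN.eq_of_adj_left hab hNa.symm]; exact hNa'.symm
        · rw [hN.eq_of_adj_left hab hNa]; exact hNa'
      by_cases ha : a = u ∨ a = v
      · exact ⟨key hM hadj hadj' ha, key hM' hadj' hadj ha⟩
      by_cases hb : b = u ∨ b = v
      · exact ⟨fun h => (key hM hadj hadj' hb h.symm).symm,
          fun h => (key hM' hadj' hadj hb h.symm).symm⟩
      constructor
      · intro h
        exact (h1.1 ⟨h.fst_mem, ha, h.snd_mem, hb, h⟩).2.2.2.2
      · intro h
        exact (h1.2 ⟨h.fst_mem, ha, h.snd_mem, hb, h⟩).2.2.2.2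
  · rintro N ⟨hN, hW⟩
    have hd : Disjoint N.support (G.subgraphOfAdj huv.symm).support := by
      rw [Set.disjoint_left]
      intro x hx hx'
      have h1 := N.support_subset_verts hx
      have h2 := Subgraph.support_subset_verts _ hx'
      rw [hW] at h1
      simp only [subgraphOfAdj_verts, Set.mem_insert_iff, Set.mem_singleton_iff,
        Finset.coe_erase, Set.mem_sdiff] at h1 h2
      tauto
    have hvN : v ∉ N.verts := by rw [hW]; simp
    have huN : u ∉ N.verts := by rw [hW]; simp
    refine ⟨N ⊔ G.subgraphOfAdj huv.symm, ⟨⟨hN.sup (.subgraphOfAdj _) hd, ?_⟩, ?_⟩, ?_⟩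
    · ext w
      simp only [Subgraph.verts_sup, hW, subgraphOfAdj_verts, Set.mem_union, Finset.mem_coe,
        Finset.mem_erase, Set.mem_insert_iff, Set.mem_singleton_iff]
      by_cases h1 : w = u
      · subst h1; simp [hu]
      · by_cases h2 : w = v
        · subst h2; simp [hv]
        · simp [h1, h2]
    · simp [Subgraph.sup_adj]
    · ext a b
      · simp only [Subgraph.deleteVerts_verts, Subgraph.verts_sup, hW, subgraphOfAdj_verts,
          Set.mem_sdiff, Set.mem_union, Finset.mem_coe, Finset.mem_erase, Set.mem_insert_iff,
          Set.mem_singleton_iff]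
        tauto
      · simp only [Subgraph.deleteVerts_adj, Subgraph.verts_sup, Subgraph.sup_adj,
          Set.mem_insert_iff, Set.mem_singleton_iff, subgraphOfAdj_adj]
        constructor
        · rintro ⟨-, ha, -, hb, h | h⟩
          · exact h
          · rw [Sym2.eq_iff] at h
            rcases h with ⟨rfl, rfl⟩ | ⟨rfl, rfl⟩ <;> simp at ha
        · intro h
          refine ⟨Or.inl h.fst_mem, ?_, Or.inl h.snd_mem, ?_, Or.inl h⟩
          · rintro (rfl | rfl)
            · exact huN h.fst_mem
            · exact hvN h.fst_mem
          · rintro (rfl | rfl)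
            · exact huN h.snd_mem
            · exact hvN h.snd_mem

/-- The matchings are classified by the partner of `v`, which is unique. -/
theorem pmCount_insert [Fintype V] (G : SimpleGraph V) [DecidableRel G.Adj] {v : V} {W : Finset V} (hv : v ∉ W) :
    pmCount G (insert v W) = ∑ u ∈ W with G.Adj u v, pmCount G (W.erase u) := by
  classical
  have h1 : {M : G.Subgraph | M.IsMatching ∧ M.verts = (insert v W : Finset V)} =
      ⋃ u ∈ (W.filter fun u => G.Adj u v),
        {M : G.Subgraph | (M.IsMatching ∧ M.verts = (insert v W : Finset V)) ∧ M.Adj v u} := by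
    ext M
    simp only [Set.mem_ofPred_eq, Set.mem_iUnion, Finset.mem_filter, exists_prop]
    constructor
    · rintro ⟨hM, hW⟩
      obtain ⟨u, h, -⟩ := hM (show v ∈ M.verts by rw [hW]; simp)
      refine ⟨u, ⟨?_, h.adj_sub.symm⟩, ⟨hM, hW⟩, h⟩
      have := h.snd_mem
      rw [hW, Finset.mem_coe, Finset.mem_insert] at this
      exact this.resolve_left h.adj_sub.ne'
    · rintro ⟨u, -, h, -⟩; exact h
  rw [pmCount, h1, Set.ncard_eq_toFinset_card', ]
  rw [show (Set.toFinset (⋃ u ∈ (W.filter fun u => G.Adj u v),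
        {M : G.Subgraph | (M.IsMatching ∧ M.verts = (insert v W : Finset V)) ∧ M.Adj v u})) =
      (W.filter fun u => G.Adj u v).biUnion fun u => Set.toFinset
        {M : G.Subgraph | (M.IsMatching ∧ M.verts = (insert v W : Finset V)) ∧ M.Adj v u} by
    ext M
    simp only [Set.mem_toFinset, Set.mem_iUnion, Finset.mem_biUnion, exists_prop]]
  rw [Finset.card_biUnion]
  · refine Finset.sum_congr rfl fun u hu => ?_
    rw [Finset.mem_filter] at hu
    rw [← Set.ncard_eq_toFinset_card', ncard_matching_adj hu.2 (by simp [hu.1]) (by simp),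
      Finset.erase_insert hv]
  · intro a _ b _ hab
    refine Finset.disjoint_left.2 fun M hM hM' => ?_
    simp only [Set.mem_toFinset, Set.mem_ofPred_eq] at hM hM'
    exact hab (hM.1.1.eq_of_adj_left hM.2 hM'.2)

end SquarefreeCoefficients

/-! ### Elimination of a vertex, and products of set functions by ranked transforms -/

section SubsetConvolution

open MvPolynomial

variable {V : Type*} [DecidableEq V]

/-- The polynomial whose squarefree coefficients are the numbers of perfect matchings of the
induced subgraphs. -/
noncomputable def pmPoly [Fintype V] (G : SimpleGraph V) : MvPolynomial V ℤ :=
  sqPoly fun W => (pmCount G W : ℤ)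

/-- The effect of eliminating the vertex `v`, with the neighbors `N`, on a polynomial. -/
noncomputable def forget (v : V) (N : Finset V) (P : MvPolynomial V ℤ) : MvPolynomial V ℤ :=
  pderiv v P + (∑ u ∈ N, X u) * P

theorem sqCoeff_forget {v : V} {A : Finset V} (hv : v ∉ A) (N : Finset V)
    (P : MvPolynomial V ℤ) : sqCoeff (forget v N P) A =
      sqCoeff P (insert v A) + ∑ u ∈ N, if u ∈ A then sqCoeff P (A.erase u) else 0 := by
  rw [forget, sqCoeff_add, sqCoeff_pderiv hv, sqCoeff_sum_X_mul]

/-- The derivative contributes the norm at most once, and each neighbor at most once more. -/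
theorem sqNorm_forget_le {U : Finset V} {v : V} (hv : v ∈ U) (N : Finset V)
    (P : MvPolynomial V ℤ) :
    sqNorm (U.erase v) (forget v N P) ≤ (N.card + 1) * sqNorm U P := by
  refine (sqNorm_add_le _ _ _).trans ?_
  have h1 := sqNorm_erase_pderiv_le U hv P
  have h2 := sqNorm_sum_X_mul_le (U.erase v) N P
  have h3 := mul_le_mul_of_nonneg_left (sqNorm_mono (Finset.erase_subset v U) P)
    (Nat.cast_nonneg (α := ℤ) N.card)
  linarith

/-- The coefficient at `U` is that of the derivative by `v` at `U.erase v`. Of the three Leibniz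
terms, the one with the derivative of `R` vanishes, and the derivative of `pmPoly G` may be replaced
by `(∑ u ∈ N, X u) * pmPoly G`. The new factor is then moved from `pmPoly G` to `P`. -/
theorem sqCoeff_forget_mul [Fintype V] (G : SimpleGraph V) {U N : Finset V} {v : V} (hv : v ∈ U)
    (hN : ∀ u ∈ U, u ∈ N ↔ G.Adj u v) (P : MvPolynomial V ℤ) {R : MvPolynomial V ℤ}
    (hR : ∀ A ⊆ U, v ∈ A → sqCoeff R A = 0) :
    sqCoeff (P * R * pmPoly G) U = sqCoeff (forget v N P * R * pmPoly G) (U.erase v) := by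
  classical
  have h1 : v ∉ U.erase v := by simp
  conv_lhs => rw [← Finset.insert_erase hv]
  rw [← sqCoeff_pderiv h1, Derivation.leibniz, Derivation.leibniz]
  simp only [smul_eq_mul]
  rw [sqCoeff_add, mul_add, sqCoeff_add, forget, add_mul, add_mul, sqCoeff_add]
  -- This is `pmCount_insert`, read as an identity of coefficients at the sets within `U.erase v`.
  have h2 : sqCoeff (P * R * pderiv v (pmPoly G)) (U.erase v) =
      sqCoeff ((∑ u ∈ N, X u) * P * R * pmPoly G) (U.erase v) := by
    rw [show (∑ u ∈ N, X u) * P * R * pmPoly G = P * R * ((∑ u ∈ N, X u) * pmPoly G) by ring]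
    refine sqCoeff_mul_congr (fun _ _ => rfl) fun B hB => ?_
    have hvB : v ∉ B := fun h => h1 (hB h)
    rw [sqCoeff_pderiv hvB, sqCoeff_sum_X_mul, pmPoly, sqCoeff_sqPoly, pmCount_insert G hvB]
    simp only [sqCoeff_sqPoly, Nat.cast_sum]
    rw [← Finset.sum_filter]
    refine Finset.sum_congr ?_ fun _ _ => rfl
    ext u
    simp only [Finset.mem_filter]
    constructor
    · rintro ⟨h, h'⟩
      exact ⟨(hN u (Finset.mem_of_mem_erase (hB h))).2 h', h⟩
    · rintro ⟨h, h'⟩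
      exact ⟨h', (hN u (Finset.mem_of_mem_erase (hB h'))).1 h⟩
  have h3 : sqCoeff (pmPoly G * (P * pderiv v R)) (U.erase v) = 0 := by
    rw [sqCoeff_mul]
    refine Finset.sum_eq_zero fun B hB => ?_
    rw [sqCoeff_mul, Finset.sum_eq_zero, mul_zero]
    intro C hC
    have hs : (U.erase v \ B) \ C ⊆ U.erase v := Finset.sdiff_subset.trans Finset.sdiff_subset
    rw [sqCoeff_pderiv (fun h => h1 (hs h)), hR _ _ (Finset.mem_insert_self _ _), mul_zero]
    exact Finset.insert_subset hv (hs.trans (Finset.erase_subset _ _))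
  rw [h2, h3, zero_add, add_comm]
  congr 2
  ring

/-- One layer of the transformation that sums a set function over subsets. -/
def layer (σ : ℤ) (f : Finset V → ℤ) (v : V) (A : Finset V) : ℤ :=
  f A + σ * if v ∈ A then f (A.erase v) else 0

/-- The layer of `v` decides whether `v` is removed from the set, at the price of a factor `σ`.
After the layers of `l`, the sets reached are those that arise by removing elements of `l`. -/
theorem foldl_layer (σ : ℤ) (f : Finset V → ℤ) (l : List V) (hl : l.Nodup) :
    ∀ A, l.foldl (layer σ) f A =
      ∑ B ∈ A.powerset with A \ B ⊆ l.toFinset, σ ^ (A \ B).card * f B := by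
  induction l using List.reverseRecOn with
  | nil =>
    intro A
    rw [Finset.sum_eq_single A]
    · simp
    · intro B hB hne
      simp only [List.toFinset_nil, Finset.subset_empty, Finset.mem_filter, Finset.mem_powerset,
        Finset.sdiff_eq_empty_iff_subset] at hB
      exact absurd (hB.1.antisymm hB.2) hne
    · intro h
      simp at h
  | append_singleton l v ih =>
    intro A
    rw [List.nodup_append] at hl
    have hvl : v ∉ l := fun h => hl.2.2 v h v (by simp) rfl
    have ih := ih hl.1
    rw [List.foldl_append, List.foldl_cons, List.foldl_nil, layer, ih A]
    -- The two terms of the last layer are the sets that keep the part of `A` at `v` and those that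
    -- lose it.
    have hsplit := Finset.sum_filter_add_sum_filter_not
      {B ∈ A.powerset | A \ B ⊆ (l ++ [v]).toFinset} (fun B => v ∉ A \ B)
      (fun B => σ ^ (A \ B).card * f B)
    rw [← hsplit]
    congr 1
    · refine Finset.sum_congr ?_ fun _ _ => rfl
      ext B
      simp only [Finset.mem_filter, Finset.mem_powerset, List.toFinset_append]
      constructor
      · rintro ⟨h1, h2⟩
        exact ⟨⟨h1, h2.trans Finset.subset_union_left⟩, fun h => hvl (by simpa using h2 h)⟩
      · rintro ⟨⟨h1, h2⟩, h3⟩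
        refine ⟨h1, fun x hx => ?_⟩
        have := h2 hx
        simp only [List.toFinset_cons, List.toFinset_nil, Finset.mem_union, List.mem_toFinset,
          Finset.mem_insert, Finset.notMem_empty, or_false] at this ⊢
        rcases this with h | rfl
        · exact h
        · exact absurd hx h3
    · by_cases hv : v ∈ A
      · rw [if_pos hv, ih, Finset.mul_sum]
        refine Finset.sum_congr ?_ ?_
        · ext B
          simp only [Finset.mem_filter, Finset.mem_powerset, List.toFinset_append, List.toFinset_cons,
            List.toFinset_nil, Finset.mem_sdiff, not_not, Finset.subset_iff, Finset.mem_union,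
            List.mem_toFinset, Finset.mem_insert, Finset.notMem_empty, or_false, Finset.mem_erase]
          constructor
          · rintro ⟨h1, h2⟩
            refine ⟨⟨fun x hx => (h1 hx).2, fun x hx => ?_⟩, hv, fun h => (h1 h).1 rfl⟩
            by_cases hxv : x = v
            · exact Or.inr hxv
            · exact Or.inl (h2 ⟨⟨hxv, hx.1⟩, hx.2⟩)
          · rintro ⟨⟨h1, h2⟩, -, h3⟩
            refine ⟨fun x hx => ⟨?_, h1 hx⟩, fun x hx => ?_⟩
            · rintro rfl; exact h3 hx
            · exact (h2 ⟨hx.1.2, hx.2⟩).resolve_right hx.1.1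
        · intro B hB
          simp only [Finset.mem_filter, Finset.mem_sdiff, not_not] at hB
          have : A \ B = insert v (A.erase v \ B) := by
            ext x
            simp only [Finset.mem_sdiff, Finset.mem_insert, Finset.mem_erase]
            by_cases hxv : x = v
            · subst hxv; simp [hv, hB.2.2]
            · simp [hxv]
          rw [this, Finset.card_insert_of_notMem (by simp), pow_succ]
          ring
      · rw [if_neg hv, mul_zero, Finset.sum_eq_zero]
        intro B hB
        simp only [Finset.mem_filter, Finset.mem_sdiff, not_not] at hB
        exact absurd hB.2.1 hv

theorem foldl_layer_of_subset (σ : ℤ) (f : Finset V → ℤ) (l : List V) (hl : l.Nodup)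
    {A : Finset V} (hA : A ⊆ l.toFinset) :
    l.foldl (layer σ) f A = ∑ B ∈ A.powerset, σ ^ (A \ B).card * f B := by
  rw [foldl_layer σ f l hl, Finset.filter_true_of_mem]
  intro B _
  exact Finset.sdiff_subset.trans hA

/-- Each layer adds at most two old values, so it at most doubles the bound. -/
theorem abs_foldl_layer_le {σ : ℤ} (hσ : |σ| ≤ 1) {M : ℤ} (hM : 0 ≤ M) (l : List V) :
    ∀ {f : Finset V → ℤ} {A : Finset V}, (∀ B ⊆ A, |f B| ≤ M) →
      |l.foldl (layer σ) f A| ≤ 2 ^ l.length * M := by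
  induction l using List.reverseRecOn with
  | nil =>
    intro f A hf
    simpa using hf A subset_rfl
  | append_singleton l v ih =>
    intro f A hf
    rw [List.foldl_append, List.foldl_cons, List.foldl_nil, layer]
    have h1 := ih hf
    have h2 : |if v ∈ A then l.foldl (layer σ) f (A.erase v) else 0| ≤ 2 ^ l.length * M := by
      split_ifs
      · exact ih fun B hB => hf B (hB.trans (Finset.erase_subset _ _))
      · rw [abs_zero]; positivity
    refine (abs_add_le _ _).trans ?_
    rw [abs_mul, List.length_append, List.length_singleton, pow_succ]
    have h3 := mul_le_mul hσ h2 (abs_nonneg _) zero_le_one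
    linarith

/-- Complementation within `A` turns this into the alternating sum over the subsets of `A \ E`. -/
theorem sum_neg_one_pow_sdiff {A E : Finset V} (hE : E ⊆ A) :
    ∑ C ∈ A.powerset with E ⊆ C, (-1 : ℤ) ^ (A \ C).card = if E = A then 1 else 0 := by
  have h := Finset.sum_powerset_neg_one_pow_card (x := A \ E)
  have h' : A \ E = ∅ ↔ E = A := Finset.sdiff_eq_empty_iff_subset.trans
    ⟨fun h => hE.antisymm h, fun h => h.symm.subset⟩
  simp only [h'] at h
  rw [← h]
  refine Finset.sum_nbij' (fun C => A \ C) (fun D => A \ D) ?_ ?_ ?_ ?_ ?_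
  · intro C hC
    simp only [Finset.mem_filter, Finset.mem_powerset] at hC ⊢
    exact Finset.sdiff_subset_sdiff subset_rfl hC.2
  · intro D hD
    simp only [Finset.mem_filter, Finset.mem_powerset] at hD ⊢
    refine ⟨Finset.sdiff_subset, fun x hx => ?_⟩
    rw [Finset.mem_sdiff]
    exact ⟨hE hx, fun hd => (Finset.mem_sdiff.1 (hD hd)).2 hx⟩
  · intro C hC
    simp only [Finset.mem_filter, Finset.mem_powerset] at hC
    exact Finset.sdiff_sdiff_eq_self hC.1
  · intro D hD
    rw [Finset.mem_powerset] at hD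
    exact Finset.sdiff_sdiff_eq_self (hD.trans Finset.sdiff_subset)
  · intro _ _; rfl

/-- The restriction of a set function to the sets of size `r`. -/
def slice (r : ℕ) (f : Finset V → ℤ) (A : Finset V) : ℤ := if A.card = r then f A else 0

/-- The pointwise product of the transforms collects all pairs of subsets of `C` with total size
`r`, disjoint or not. -/
theorem sum_slice_mul (f g : Finset V → ℤ) (C : Finset V) (r : ℕ) :
    ∑ i ∈ Finset.range (r + 1), (∑ B ∈ C.powerset, slice i f B) *
      (∑ B ∈ C.powerset, slice (r - i) g B) =
    ∑ B ∈ C.powerset, ∑ B' ∈ C.powerset,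
      if B.card + B'.card = r then f B * g B' else 0 := by
  simp only [Finset.sum_mul_sum]
  rw [Finset.sum_comm]
  refine Finset.sum_congr rfl fun B _ => ?_
  rw [Finset.sum_comm]
  refine Finset.sum_congr rfl fun B' _ => ?_
  by_cases h : B.card + B'.card = r
  · rw [if_pos h, Finset.sum_eq_single B.card]
    · rw [slice, slice, if_pos rfl, if_pos (by omega)]
    · intro i _ hi
      rw [slice, if_neg (Ne.symm hi), zero_mul]
    · intro hi
      rw [Finset.mem_range] at hi
      omega
  · rw [if_neg h]
    refine Finset.sum_eq_zero fun i hi => ?_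
    rw [Finset.mem_range] at hi
    simp only [slice]
    split_ifs <;> first | (exfalso; omega) | simp

/-- Möbius inversion keeps the pairs with `B ∪ B' = A`. Since their sizes add up to that of `A`,
they are disjoint, whence `B' = A \ B`. -/
theorem ranked_convolution (f g : Finset V → ℤ) (A : Finset V) :
    ∑ C ∈ A.powerset, (-1 : ℤ) ^ (A \ C).card *
      ∑ i ∈ Finset.range (A.card + 1), (∑ B ∈ C.powerset, slice i f B) *
        (∑ B ∈ C.powerset, slice (A.card - i) g B) =
    ∑ B ∈ A.powerset, f B * g (A \ B) := by
  simp only [sum_slice_mul]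
  simp only [Finset.mul_sum]
  rw [Finset.sum_comm' (t' := A.powerset) (s' := fun B => {C ∈ A.powerset | B ⊆ C})]
  · refine Finset.sum_congr rfl fun B hB => ?_
    rw [Finset.mem_powerset] at hB
    rw [Finset.sum_comm' (t' := A.powerset) (s' := fun B' => {C ∈ A.powerset | B ∪ B' ⊆ C})]
    · rw [Finset.sum_eq_single (A \ B)]
      · rw [← Finset.sum_mul, sum_neg_one_pow_sdiff (by
          rw [Finset.union_sdiff_of_subset hB]), if_pos (Finset.union_sdiff_of_subset hB), one_mul,
          if_pos]
        rw [← Finset.card_sdiff_add_card_eq_card hB, add_comm]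
      · intro B' hB' hne
        rw [Finset.mem_powerset] at hB'
        rw [← Finset.sum_mul, sum_neg_one_pow_sdiff (Finset.union_subset hB hB')]
        split_ifs with h1 h2
        · exfalso
          have hd : Disjoint B B' := by
            rw [← Finset.card_union_eq_card_add_card, h1, h2]
          apply hne
          rw [← h1, Finset.union_sdiff_cancel_left hd]
        · simp
        · simp
        · simp
      · intro h
        simp at h
    · intro C B'
      simp only [Finset.mem_filter, Finset.mem_powerset, Finset.union_subset_iff]
      constructor
      · rintro ⟨⟨h1, h2⟩, h3⟩; exact ⟨⟨h1, h2, h3⟩, h3.trans h1⟩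
      · rintro ⟨⟨h1, h2, h3⟩, -⟩; exact ⟨⟨h1, h2⟩, h3⟩
  · intro C B
    simp only [Finset.mem_filter, Finset.mem_powerset]
    constructor
    · rintro ⟨h1, h2⟩; exact ⟨⟨h1, h2⟩, h2.trans h1⟩
    · rintro ⟨⟨h1, h2⟩, -⟩; exact ⟨h1, h2⟩

/-- The product of two polynomials by transforms of their slices. -/
theorem layer_convolution (f g : Finset V → ℤ) {l : List V} (hl : l.Nodup) {A : Finset V}
    (hA : A ⊆ l.toFinset) {r : ℕ} (hr : A.card = r) :
    l.foldl (layer (-1)) (fun C => ∑ i ∈ Finset.range (r + 1),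
      l.foldl (layer 1) (slice i f) C * l.foldl (layer 1) (slice (r - i) g) C) A =
    ∑ B ∈ A.powerset, f B * g (A \ B) := by
  subst hr
  rw [foldl_layer_of_subset _ _ _ hl hA, ← ranked_convolution]
  refine Finset.sum_congr rfl fun C hC => ?_
  rw [Finset.mem_powerset] at hC
  simp only [foldl_layer_of_subset _ _ _ hl (hC.trans hA), one_pow, one_mul]

end SubsetConvolution

namespace RAM

/-! ### Codes of vertex sets -/

/-- The number with the digit `1` at the elements of `A` in base four. -/
def code {n : ℕ} (A : Finset (Fin n)) : ℤ := ∑ v ∈ A, 4 ^ (v : ℕ)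

/-- The lowest digit is the remainder modulo four; the rest follows by induction. -/
theorem digits_injective : ∀ {n : ℕ} {d d' : Fin n → ℤ}, (∀ v, 0 ≤ d v ∧ d v < 4) →
    (∀ v, 0 ≤ d' v ∧ d' v < 4) →
    ∑ v, d v * 4 ^ (v : ℕ) = ∑ v, d' v * 4 ^ (v : ℕ) → d = d'
  | 0, _, _, _, _, _ => funext fun v => v.elim0
  | n + 1, d, d', hd, hd', h => by
    rw [Fin.sum_univ_succ, Fin.sum_univ_succ] at h
    have e : ∀ d : Fin (n + 1) → ℤ, ∑ v : Fin n, d v.succ * 4 ^ (v.succ : ℕ) =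
        4 * ∑ v : Fin n, d v.succ * 4 ^ (v : ℕ) := fun d => by
      rw [Finset.mul_sum]
      refine Finset.sum_congr rfl fun v _ => ?_
      rw [Fin.val_succ, pow_succ]; ring
    rw [e, e] at h
    simp only [Fin.val_zero, pow_zero, mul_one] at h
    have h1 := hd 0
    have h2 := hd' 0
    have h3 : d 0 = d' 0 := by omega
    have h4 : (fun v : Fin n => d v.succ) = fun v => d' v.succ :=
      digits_injective (fun v => hd _) (fun v => hd' _) (by omega)
    funext v
    refine Fin.cases h3 (fun v => ?_) v
    exact congrFun h4 v

variable {n : ℕ}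

theorem code_eq_sum (A : Finset (Fin n)) :
    code A = ∑ v, (if v ∈ A then 1 else 0) * 4 ^ (v : ℕ) := by
  simp [code]

theorem code_empty : code (∅ : Finset (Fin n)) = 0 := rfl

theorem code_insert {A : Finset (Fin n)} {v : Fin n} (h : v ∉ A) :
    code (insert v A) = code A + 4 ^ (v : ℕ) := by
  rw [code, Finset.sum_insert h, add_comm]; rfl

theorem code_erase {A : Finset (Fin n)} {v : Fin n} (h : v ∈ A) :
    code (A.erase v) = code A - 4 ^ (v : ℕ) := by
  conv_rhs => rw [← Finset.insert_erase h, code_insert (Finset.notMem_erase v A)]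
  ring

theorem code_nonneg (A : Finset (Fin n)) : 0 ≤ code A :=
  Finset.sum_nonneg fun _ _ => by positivity

theorem code_lt (A : Finset (Fin n)) : code A < 4 ^ n := by
  have h1 : code A ≤ ∑ v : Fin n, 4 ^ (v : ℕ) :=
    Finset.sum_le_sum_of_subset_of_nonneg (Finset.subset_univ _) fun _ _ _ => by positivity
  refine h1.trans_lt ?_
  rw [Fin.sum_univ_eq_sum_range (fun i => (4 : ℤ) ^ i)]
  clear h1
  induction n with
  | zero => simp
  | succ n ih =>
    rw [Finset.sum_range_succ, pow_succ]
    -- The bound no longer mentions the set, so any argument will do.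
    have := ih ∅
    have h4 : (0 : ℤ) < 4 ^ n := by positivity
    linarith

theorem code_injective : Function.Injective (code (n := n)) := by
  intro A A' h
  rw [code_eq_sum, code_eq_sum] at h
  have := digits_injective (fun v => by split_ifs <;> norm_num)
    (fun v => by split_ifs <;> norm_num) h
  ext v
  have := congrFun this v
  by_cases h1 : v ∈ A <;> by_cases h2 : v ∈ A' <;> simp_all

/-- Adding one to the digit of `A'` at `u` gives digits of at most two, so in base four there is no
carry and these are the digits of `A`. In base two this fails: `{1}` minus `2 ^ 0` would be the code
of `{0}`. -/
theorem mem_of_code_sub_eq {A A' : Finset (Fin n)} {u : Fin n}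
    (h : code A - 4 ^ (u : ℕ) = code A') : u ∈ A := by
  have h' : ∑ v, (if v ∈ A then 1 else 0) * 4 ^ (v : ℕ) =
      ∑ v, ((if v ∈ A' then 1 else 0) + if v = u then 1 else 0) * (4 : ℤ) ^ (v : ℕ) := by
    rw [← code_eq_sum]
    simp only [add_mul, Finset.sum_add_distrib]
    rw [← code_eq_sum, ← h]
    simp
  have := digits_injective (fun v => by split_ifs <;> norm_num)
    (fun v => by split_ifs <;> norm_num) h'
  have := congrFun this u
  by_contra hu
  simp only [hu, if_false, if_true] at this
  split_ifs at this <;> omega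

/-- The tables of all nodes share one array: the entry of node `x` for a set with code `q` is at `q
* t + x`. This shows that they do not collide. -/
theorem address_injective {t : ℕ} {q q' x x' : ℤ} (hx : 0 ≤ x ∧ x < t) (hx' : 0 ≤ x' ∧ x' < t)
    (h : q * t + x = q' * t + x') : q = q' ∧ x = x' := by
  have ht : (t : ℤ) ≠ 0 := by omega
  have h1 : (q * t + x) / t = q := by
    rw [add_comm, Int.add_mul_ediv_right _ _ ht, Int.ediv_eq_zero_of_lt hx.1 hx.2, zero_add]
  have h2 : (q' * t + x') / t = q' := by
    rw [add_comm, Int.add_mul_ediv_right _ _ ht, Int.ediv_eq_zero_of_lt hx'.1 hx'.2, zero_add]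
  have h3 : q = q' := by rw [← h1, ← h2, h]
  subst h3
  exact ⟨rfl, by linarith⟩

/-! ### Straight-line programs -/

theorem setMem_apply (s : State) (a b : ℕ) (j z l : ℤ) :
    (s.setMem a j z).mem b l = if b = a ∧ l = j then z else s.mem b l := by
  by_cases h : b = a
  · subst h; simp
  · simp [setMem_ne _ _ _ h, h]

variable {B : ℕ}

theorem Reach.seq_set {s : State} {Q : State → Prop} {r m : ℕ} {e : Exp} {d : Cmd} (hB : 1 ≤ B)
    (he : e.hi = true) (hz : |e.eval s| < 2 ^ B) (h : Reach B d (s.setReg r (e.eval s)) m Q) :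
    Reach B (.seq (.set r e) d) s (1 + m) Q :=
  Reach.seq (Reach.set (Q := fun s' => s' = s.setReg r (e.eval s)) hB he hz rfl)
    fun _ _ _ hs => hs ▸ h

theorem Reach.seq_store {s : State} {Q : State → Prop} {a m : ℕ} {e f : Exp} {d : Cmd}
    (hB : 1 ≤ B) (he : e.hi = true) (hf : f.hi = true) (hz : |f.eval s| < 2 ^ B)
    (h : Reach B d (s.setMem a (e.eval s) (f.eval s)) m Q) :
    Reach B (.seq (.store a e f) d) s (1 + m) Q :=
  Reach.seq (Reach.store (Q := fun s' => s' = s.setMem a (e.eval s) (f.eval s)) hB he hf hz rfl)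
    fun _ _ _ hs => hs ▸ h

/-- Conditions that make `2 ^ B` large enough for all numbers in the computation, if `M` bounds
the entries of the tables. -/
structure Big (n t : ℕ) (M : ℤ) (B : ℕ) : Prop where
  one_le : 1 ≤ B
  four_pow : 2 * (4 : ℤ) ^ n ≤ 2 ^ B
  sq : ((t : ℤ) + 1) ^ 2 < 2 ^ B
  one_le_M : 1 ≤ M
  table : ((n : ℤ) + 1) * (16 ^ n * M ^ 2) < 2 ^ B

theorem Big.two_pow_lt {t : ℕ} {M : ℤ} (h : Big n t M B) {w : ℕ} (hw : w ≤ n) :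
    (2 : ℤ) ^ w < 2 ^ B := by
  have h1 : (2 : ℤ) ^ w ≤ 2 ^ n := pow_le_pow_right₀ (by norm_num) hw
  have h2 : (2 : ℤ) ^ n ≤ 4 ^ n := pow_le_pow_left₀ (by norm_num) (by norm_num) n
  have h3 : (0 : ℤ) < 4 ^ n := by positivity
  linarith [h.four_pow]

theorem Big.cast_lt {t : ℕ} {M : ℤ} (h : Big n t M B) {w : ℕ} (hw : w ≤ n) :
    (w : ℤ) < 2 ^ B := by
  refine lt_trans ?_ (h.two_pow_lt hw)
  exact_mod_cast Nat.lt_two_pow_self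

theorem Big.four_pow_lt {t : ℕ} {M : ℤ} (h : Big n t M B) : (4 : ℤ) ^ n < 2 ^ B := by
  have h3 : (0 : ℤ) < 4 ^ n := by positivity
  linarith [h.four_pow]

theorem Big.abs_code_lt {t : ℕ} {M : ℤ} (h : Big n t M B) (A : Finset (Fin n)) :
    |code A| < 2 ^ B := by
  rw [abs_of_nonneg (code_nonneg A)]
  exact (code_lt A).trans h.four_pow_lt

theorem Big.one_lt {t : ℕ} {M : ℤ} (h : Big n t M B) : |(1 : ℤ)| < 2 ^ B := by
  have := h.two_pow_lt (Nat.zero_le _)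
  simpa using this

theorem Big.zero_lt {t : ℕ} {M : ℤ} (_ : Big n t M B) : |(0 : ℤ)| < 2 ^ B := by simp

/-! ### The data structures -/

open Classical in
/-- The part of the memory that is not changed after the preparations: the adjacency matrix of the
graph, the powers of four, and the bags. -/
structure Env (t : ℕ) (G : SimpleGraph (Fin n)) (bl : ℕ → List (Fin n)) (s : State) : Prop where
  reg_n : s.reg 0 = n
  reg_t : s.reg 2 = t
  adj : ∀ u v : Fin n, s.mem 6 ((u : ℕ) * n + (v : ℕ)) = if G.Adj u v then 1 else 0
  pw : ∀ v : Fin n, s.mem 11 (v : ℕ) = 4 ^ (v : ℕ)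
  loc : ∀ (y : ℕ) (v : Fin n), s.mem 12 (y * n + (v : ℕ)) = if v ∈ bl y then 1 else 0
  size : ∀ y < t, s.mem 21 y = (bl y).length
  bag : ∀ y < t, ∀ (j : ℕ) (h : j < (bl y).length),
    s.mem 22 ((y : ℤ) * n + j) = (((bl y)[j] : Fin n) : ℕ)

/-- The program does not change the prepared part of the memory. -/
def Cmd.keeps (c : Cmd) : Bool :=
  !(c.wr 0 || c.wr 2 || c.wm 6 || c.wm 11 || c.wm 12 || c.wm 21 || c.wm 22)

/-- What a concrete program writes is decided by computation, so `rfl` proves `hc` wherever this is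
used. -/
theorem Env.frame {t : ℕ} {G : SimpleGraph (Fin n)} {bl : ℕ → List (Fin n)} {s s' : State}
    {c : Cmd} (h : Env t G bl s) (hF : Frame c s s') (hc : c.keeps = true) : Env t G bl s' := by
  simp only [Cmd.keeps, Bool.not_eq_true', Bool.or_eq_false_iff] at hc
  obtain ⟨⟨⟨⟨⟨⟨h0, h2⟩, h6⟩, h11⟩, h12⟩, h21⟩, h22⟩ := hc
  constructor
  · rw [hF.reg 0 h0]; exact h.reg_n
  · rw [hF.reg 2 h2]; exact h.reg_t
  · rw [hF.mem 6 h6]; exact h.adj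
  · rw [hF.mem 11 h11]; exact h.pw
  · rw [hF.mem 12 h12]; exact h.loc
  · rw [hF.mem 21 h21]; exact h.size
  · rw [hF.mem 22 h22]; exact h.bag

/-- The marked cells of array 23 are codes of vertex sets. -/
def ValOK (n : ℕ) (s : State) : Prop :=
  ∀ z, s.mem 23 z = 0 ∨ s.mem 23 z = 1 ∧ ∃ A : Finset (Fin n), z = code A

/-- The vertices in `l` and the codes of their sets are listed in the memory. -/
structure Subsets (l : List (Fin n)) (s : State) : Prop where
  nodup : l.Nodup
  cnt : s.reg 12 = l.length
  size : s.reg 13 = 2 ^ l.length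
  lst : ∀ (i : ℕ) (h : i < l.length), s.mem 13 i = ((l[i] : Fin n) : ℕ)
  sub : ∀ S : ℕ, S < 2 ^ l.length →
    ∃ A ⊆ l.toFinset, s.mem 14 S = code A ∧ s.mem 15 S = A.card
  surj : ∀ A ⊆ l.toFinset, ∃ S : ℕ, S < 2 ^ l.length ∧ s.mem 14 S = code A
  val : ∀ A ⊆ l.toFinset, s.mem 23 (code A) = 1

theorem Subsets.length_le {l : List (Fin n)} {s : State} (h : Subsets l s) : l.length ≤ n := by
  simpa using h.nodup.length_le_card

/-- This is the membership test of the algorithm. If `u ∈ A`, the address is the code of a listed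
set and is marked. Otherwise it is not a code at all, so it is unmarked even if array 23 holds marks
of other bags. -/
theorem Subsets.val_sub {l : List (Fin n)} {s : State} (h : Subsets l s) (hv : ValOK n s)
    {A : Finset (Fin n)} (hA : A ⊆ l.toFinset) (u : Fin n) :
    s.mem 23 (code A - 4 ^ (u : ℕ)) = if u ∈ A then 1 else 0 := by
  split_ifs with hu
  · rw [← code_erase hu]
    exact h.val _ ((Finset.erase_subset _ _).trans hA)
  · rcases hv (code A - 4 ^ (u : ℕ)) with h0 | ⟨-, A', h1⟩
    · exact h0
    · exact absurd (mem_of_code_sub_eq h1) hu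

theorem Subsets.frame {l : List (Fin n)} {s s' : State} {c : Cmd} (h : Subsets l s)
    (hF : Frame c s s') (hc : (c.wr 12 || c.wr 13 || c.wm 13 || c.wm 14 || c.wm 15 || c.wm 23)
      = false) : Subsets l s' := by
  simp only [Bool.or_eq_false_iff] at hc
  obtain ⟨⟨⟨⟨⟨h1, h2⟩, h3⟩, h4⟩, h5⟩, h6⟩ := hc
  have := h.sub
  constructor
  · exact h.nodup
  · rw [hF.reg 12 h1]; exact h.cnt
  · rw [hF.reg 13 h2]; exact h.size
  · rw [hF.mem 13 h3]; exact h.lst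
  · rw [hF.mem 14 h4, hF.mem 15 h5]; exact h.sub
  · rw [hF.mem 14 h4]; exact h.surj
  · rw [hF.mem 23 h6]; exact h.val

theorem ValOK.frame {s s' : State} {c : Cmd} (h : ValOK n s)
    (hF : Frame c s s') (hc : c.wm 23 = false) : ValOK n s' := by
  rw [ValOK, hF.mem 23 hc]; exact h

end RAM

/-! ### Enumeration of the subsets of a bag -/

namespace RAM

open Exp Cmd

/-- Adds the vertex in register 11 to the elements of the listed sets. -/
def extendSets : Cmd :=
  .for 14 (var 13)
    (seq (set 31 (add (get 14 (var 14)) (get 11 (var 11))))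
    (seq (store 14 (add (var 13) (var 14)) (var 31))
    (seq (store 15 (add (var 13) (var 14)) (add (get 15 (var 14)) (lit 1)))
    (store 23 (var 31) (lit 1)))))

/-- Lists the vertices in the bag of the node in register 9 that are not eliminated, and the sets of
these vertices. -/
def listSets : Cmd :=
  seq (set 12 (lit 0))
  (seq (set 13 (lit 1))
  (seq (store 14 (lit 0) (lit 0))
  (seq (store 15 (lit 0) (lit 0))
  (seq (store 23 (lit 0) (lit 1))
  (.for 10 (get 21 (var 9))
    (seq (set 11 (get 22 (add (mul (var 9) (var 0)) (var 10))))
    (ite (get 10 (var 11)) (lit 1)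
      (seq (store 13 (var 12) (var 11))
      (seq (set 12 (add (var 12) (lit 1)))
      (seq extendSets
      (set 13 (add (var 13) (var 13))))))
      skip)))))))

variable {n t B : ℕ} {M : ℤ} {G : SimpleGraph (Fin n)} {bl : ℕ → List (Fin n)}

/-- The sets with `v` are appended behind the `2 ^ l.length` sets without it, in the same order, so
the list is never overwritten while it is read. -/
theorem extendSets_spec (hBig : Big n t M B) {s : State} (hE : Env t G bl s)
    {l : List (Fin n)} {v : Fin n} (hlen : l.length < n)
    (hvl : v ∉ l) (h13 : s.reg 13 = 2 ^ l.length) (h11 : s.reg 11 = (v : ℕ))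
    (hsub : ∀ S : ℕ, S < 2 ^ l.length →
      ∃ A ⊆ l.toFinset, s.mem 14 S = code A ∧ s.mem 15 S = A.card) (hval : ValOK n s) :
    Reach B extendSets s (2 + 2 ^ l.length * 6) fun s' =>
      (∀ S : ℕ, S < 2 ^ l.length → s'.mem 14 S = s.mem 14 S ∧ s'.mem 15 S = s.mem 15 S ∧
        s'.mem 14 (2 ^ l.length + S) = s.mem 14 S + 4 ^ (v : ℕ) ∧
        s'.mem 15 (2 ^ l.length + S) = s.mem 15 S + 1 ∧
        s'.mem 23 (s.mem 14 S + 4 ^ (v : ℕ)) = 1) ∧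
      (∀ z, s.mem 23 z = 1 → s'.mem 23 z = 1) ∧ ValOK n s' := by
  have hB := hBig.one_le
  refine Reach.conseq (Reach.for (m := 4) hB (fun j s' =>
    (∀ S : ℕ, S < 2 ^ l.length → s'.mem 14 S = s.mem 14 S ∧ s'.mem 15 S = s.mem 15 S) ∧
    (∀ S : ℕ, S < j → s'.mem 14 (2 ^ l.length + S) = s.mem 14 S + 4 ^ (v : ℕ) ∧
        s'.mem 15 (2 ^ l.length + S) = s.mem 15 S + 1 ∧
        s'.mem 23 (s.mem 14 S + 4 ^ (v : ℕ)) = 1) ∧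
      (∀ z, s.mem 23 z = 1 → s'.mem 23 z = 1) ∧ ValOK n s')
    rfl rfl (N := 2 ^ l.length) ?_ ?_ ?_ ?_) le_rfl ?_
  · have := hBig.two_pow_lt hlen.le
    exact_mod_cast this
  · intro s' hF
    rw [Exp.eval, hF.reg 13 rfl, h13]; push_cast; rfl
  · exact ⟨fun S _ => ⟨rfl, rfl⟩, fun S hS => absurd hS (Nat.not_lt_zero _), fun _ h => h, hval⟩
  · rintro j hj s' hg hF hj' ⟨h1, h2, h3, h4⟩
    obtain ⟨A, hA, hA1, hA2⟩ := hsub j hj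
    have hvA : v ∉ A := fun h => hvl (by simpa using hA h)
    have e14 : s'.mem 14 j = code A := (h1 j hj).1.trans hA1
    have e15 : s'.mem 15 j = A.card := (h1 j hj).2.trans hA2
    have e11 : s'.reg 11 = (v : ℕ) := (hF.reg 11 rfl).trans h11
    have e13 : s'.reg 13 = 2 ^ l.length := (hF.reg 13 rfl).trans h13
    have epw : s'.mem 11 (v : ℕ) = 4 ^ (v : ℕ) := (hE.frame hF rfl).pw v
    have ex : (add (get 14 (var 14)) (get 11 (var 11))).eval s' = code (insert v A) := by
      simp only [Exp.eval, hj', e14, e11, epw, code_insert hvA]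
    have hcard : A.card + 1 ≤ n := by
      have := Finset.card_le_univ (insert v A)
      rwa [Finset.card_insert_of_notMem hvA, Fintype.card_fin] at this
    refine Reach.seq_set (m := 3) hB rfl (ex ▸ hBig.abs_code_lt _) ?_
    rw [ex]
    refine Reach.seq_store (m := 2) hB rfl rfl ?_ ?_
    · simpa [Exp.eval, setReg_reg] using hBig.abs_code_lt _
    refine Reach.seq_store (m := 1) hB rfl rfl ?_ ?_
    · simp only [Exp.eval, setReg_reg, setMem_reg, setReg_mem, setMem_apply]
      norm_num [hj', e15]
      rw [abs_of_nonneg (by positivity)]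
      exact_mod_cast hBig.cast_lt hcard
    refine Reach.store hB rfl rfl (by simpa [Exp.eval] using hBig.one_lt) ?_
    have hne : ∀ S : ℕ, S < 2 ^ l.length → (S : ℤ) ≠ 2 ^ l.length + j := by
      intro S hS h
      have : (S : ℤ) < 2 ^ l.length := by exact_mod_cast hS
      omega
    simp only [Exp.eval, setReg_reg, setMem_reg, setReg_mem, setMem_apply, hj', e13]
    norm_num [hj', e13, e15]
    refine ⟨?_, ?_, ?_, ?_⟩
    · intro S hS
      rw [if_neg (hne S hS), if_neg (hne S hS)]
      exact h1 S hS
    · intro S hS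
      rcases Nat.lt_or_eq_of_le hS with hS | rfl
      · rw [if_neg (by omega), if_neg (by omega)]
        obtain ⟨a1, a2, a3⟩ := h2 S hS
        exact ⟨a1, a2, fun _ => a3⟩
      · rw [if_pos rfl, if_pos rfl, hA1, hA2]
        exact ⟨code_insert hvA, rfl, fun h => absurd (code_insert hvA).symm h⟩
    · intro z hz _
      exact h3 z hz
    · intro z
      by_cases hz : z = code (insert v A)
      · exact Or.inr ⟨by simp [hz], insert v A, hz⟩
      · simpa [setMem_apply, hz] using h4 z
  · rintro s' - - ⟨h1, h2, h3⟩
    exact ⟨fun S hS => ⟨(h1 S hS).1, (h1 S hS).2, h2 S hS⟩, h3⟩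

theorem listSets_step (hBig : Big n t M B) {s : State} (hE : Env t G bl s)
    {l : List (Fin n)} {v : Fin n} (hs : Subsets l s) (hval : ValOK n s) (hvl : v ∉ l)
    (h11 : s.reg 11 = (v : ℕ)) :
    Reach B (seq (store 13 (var 12) (var 11))
      (seq (set 12 (add (var 12) (lit 1)))
      (seq extendSets
      (set 13 (add (var 13) (var 13)))))) s (5 + 2 ^ l.length * 6) fun s' =>
      Subsets (l ++ [v]) s' ∧ ValOK n s' := by
  have hB := hBig.one_le
  have hnd : (l ++ [v]).Nodup := by
    rw [List.nodup_append]
    refine ⟨hs.nodup, by simp, ?_⟩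
    rintro a ha b hb rfl
    rw [List.mem_singleton] at hb
    exact hvl (hb ▸ ha)
  have hlen : l.length < n := by
    have := hnd.length_le_card
    simp at this; omega
  have hvn : (v : ℕ) ≤ n := v.2.le
  refine Reach.conseq (m := 1 + (1 + ((2 + 2 ^ l.length * 6) + 1))) ?_ (by omega)
    (fun _ _ _ h => h)
  refine Reach.seq_store hB rfl rfl ?_ ?_
  · simp only [Exp.eval, h11]
    rw [abs_of_nonneg (by positivity)]
    exact hBig.cast_lt hvn
  refine Reach.seq_set hB rfl ?_ ?_
  · simp only [Exp.eval, setMem_reg, hs.cnt]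
    rw [abs_of_nonneg (by positivity)]
    have := hBig.cast_lt (w := l.length + 1) hlen
    push_cast at this
    exact this
  simp only [Exp.eval, setMem_reg, hs.cnt, h11]
  set s₁ := (s.setMem 13 (l.length : ℤ) (v : ℕ)).setReg 12 ((l.length : ℤ) + 1) with hs₁
  have m14 : s₁.mem 14 = s.mem 14 := by ext z; simp [hs₁, setMem_apply]
  have m15 : s₁.mem 15 = s.mem 15 := by ext z; simp [hs₁, setMem_apply]
  have m23 : s₁.mem 23 = s.mem 23 := by ext z; simp [hs₁, setMem_apply]
  have hE₁ : Env t G bl s₁ := by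
    have hF : Frame (seq (store 13 (var 12) (var 11)) (set 12 (add (var 12) (lit 1)))) s s₁ := by
      constructor
      · intro r hr
        simp only [Cmd.wr, Bool.or_eq_false_iff, beq_eq_false_iff_ne] at hr
        rw [hs₁, setReg_ne _ _ (Ne.symm hr.2), setMem_reg]
      · intro a ha
        simp only [Cmd.wm, Bool.or_eq_false_iff, beq_eq_false_iff_ne] at ha
        rw [hs₁, setReg_mem, setMem_ne _ _ _ (Ne.symm ha.1)]
    exact hE.frame hF rfl
  refine Reach.seq (extendSets_spec hBig hE₁ hlen hvl (v := v)
    (by simp [hs₁, setReg_reg, hs.size]) (by simp [hs₁, setReg_reg, h11])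
    (by rw [m14, m15]; exact hs.sub) (by rw [ValOK, m23]; exact hval)) ?_
  rintro s₂ hg₂ hF₂ ⟨h1, h2, h3⟩
  rw [m14, m15] at h1
  rw [m23] at h2
  have r13 : s₂.reg 13 = 2 ^ l.length := by
    rw [hF₂.reg 13 rfl, hs₁, setReg_ne _ _ (by norm_num), setMem_reg, hs.size]
  have e13 : (add (var 13) (var 13)).eval s₂ = 2 ^ (l.length + 1) := by
    simp only [Exp.eval, r13]; ring
  have hpow : (2 : ℕ) ^ (l ++ [v]).length = 2 ^ l.length + 2 ^ l.length := by
    rw [List.length_append, List.length_singleton, pow_succ]; ring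
  have htf : (l ++ [v]).toFinset = insert v l.toFinset := by
    ext; simp
  refine Reach.set hB rfl ?_ ?_
  · rw [e13, abs_of_nonneg (by positivity)]
    exact hBig.two_pow_lt hlen
  · rw [e13]
    refine ⟨⟨hnd, ?_, ?_, ?_, ?_, ?_, ?_⟩, ?_⟩
    · rw [setReg_ne _ _ (by norm_num), hF₂.reg 12 rfl, hs₁, setReg_self]
      simp
    · rw [setReg_self]; simp
    · intro i hi
      rw [setReg_mem, hF₂.mem 13 rfl, hs₁, setReg_mem, setMem_same]
      rw [List.length_append, List.length_singleton] at hi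
      by_cases hil : i = l.length
      · subst hil; simp
      · have hi' : i < l.length := by omega
        rw [if_neg (by exact_mod_cast hil), hs.lst i hi', List.getElem_append_left hi']
    · intro S hS
      rw [setReg_mem, htf]
      by_cases hS' : S < 2 ^ l.length
      · obtain ⟨A, hA, a1, a2⟩ := hs.sub S hS'
        obtain ⟨b1, b2, -⟩ := h1 S hS'
        exact ⟨A, hA.trans (Finset.subset_insert _ _), by rw [b1, a1], by rw [b2, a2]⟩
      · obtain ⟨S', rfl⟩ := Nat.exists_eq_add_of_le (Nat.not_lt.1 hS')
        have hS'' : S' < 2 ^ l.length := by omega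
        obtain ⟨A, hA, a1, a2⟩ := hs.sub S' hS''
        obtain ⟨-, -, b1, b2, -⟩ := h1 S' hS''
        have hvA : v ∉ A := fun h => hvl (by simpa using hA h)
        refine ⟨insert v A, Finset.insert_subset_insert _ hA, ?_, ?_⟩
        · push_cast; rw [b1, a1, code_insert hvA]
        · push_cast; rw [b2, a2, Finset.card_insert_of_notMem hvA]; push_cast; rfl
    · intro A hA
      rw [htf] at hA
      rw [setReg_mem]
      by_cases hv : v ∈ A
      · have hA' : A.erase v ⊆ l.toFinset := Finset.subset_insert_iff.1 hA
        obtain ⟨S, hS, hS'⟩ := hs.surj _ hA'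
        refine ⟨2 ^ l.length + S, by omega, ?_⟩
        push_cast
        rw [(h1 S hS).2.2.1, hS', ← code_insert (Finset.notMem_erase v A), Finset.insert_erase hv]
      · obtain ⟨S, hS, hS'⟩ := hs.surj A ((Finset.subset_insert_iff_of_notMem hv).1 hA)
        exact ⟨S, by omega, by rw [(h1 S hS).1, hS']⟩
    · intro A hA
      rw [htf] at hA
      rw [setReg_mem]
      by_cases hv : v ∈ A
      · have hA' : A.erase v ⊆ l.toFinset := Finset.subset_insert_iff.1 hA
        obtain ⟨S, hS, hS'⟩ := hs.surj _ hA'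
        have := (h1 S hS).2.2.2.2
        rwa [hS', ← code_insert (Finset.notMem_erase v A), Finset.insert_erase hv] at this
      · exact h2 _ (hs.val A ((Finset.subset_insert_iff_of_notMem hv).1 hA))
    · exact h3

/-- A bound on the number of instructions in `listSets`. -/
def listSetsTime (w : ℕ) : ℕ := 7 + w * (9 + 2 ^ w * 6)

/-- Clearing array 23 is unnecessary: marks from earlier calls are codes too, and `ValOK` asks for
no more. The running time is thus independent of what was listed before. -/
theorem listSets_spec (hBig : Big n t M B) {s : State} (hE : Env t G bl s) {y : ℕ} (hy : y < t)
    (h9 : s.reg 9 = y) {Z : Finset (Fin n)}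
    (hZ : ∀ v ∈ bl y, s.mem 10 (v : ℕ) = if v ∈ Z then 1 else 0) (hval : ValOK n s)
    (hnd : (bl y).Nodup) {w : ℕ} (hw : (bl y).length ≤ w) :
    Reach B listSets s (listSetsTime w) fun s' =>
      Subsets ((bl y).filter (· ∉ Z)) s' ∧ ValOK n s' := by
  have hB := hBig.one_le
  have hwn : (bl y).length ≤ n := by simpa using hnd.length_le_card
  refine Reach.conseq (m := 1 + (1 + (1 + (1 + (1 + (2 + (bl y).length * ((7 + 2 ^ w * 6) + 2))))))) ?_
    ?_ (fun _ _ _ h => h)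
  swap
  · rw [listSetsTime]
    have := Nat.mul_le_mul_right (9 + 2 ^ w * 6) hw
    linarith
  refine Reach.seq_set hB rfl hBig.zero_lt ?_
  refine Reach.seq_set hB rfl hBig.one_lt ?_
  refine Reach.seq_store hB rfl rfl hBig.zero_lt ?_
  refine Reach.seq_store hB rfl rfl hBig.zero_lt ?_
  refine Reach.seq_store hB rfl rfl hBig.one_lt ?_
  simp only [Exp.eval]
  set s₁ := ((((s.setReg 12 0).setReg 13 1).setMem 14 0 0).setMem 15 0 0).setMem 23 0 1 with hs₁
  have hE₁ : Env t G bl s₁ := by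
    have hF : Frame listSets s s₁ := by
      constructor
      · intro r hr
        simp only [listSets, Cmd.wr, Bool.or_eq_false_iff, beq_eq_false_iff_ne] at hr
        simp only [hs₁, setReg_reg, setMem_reg]
        rw [if_neg (Ne.symm hr.2.1), if_neg (Ne.symm hr.1)]
      · intro a ha
        simp only [listSets, Cmd.wm, Bool.or_eq_false_iff, beq_eq_false_iff_ne] at ha
        rw [hs₁, setMem_ne _ _ _ (Ne.symm ha.2.2.2.2.1), setMem_ne _ _ _ (Ne.symm ha.2.2.2.1),
          setMem_ne _ _ _ (Ne.symm ha.2.2.1)]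
        rfl
    exact hE.frame hF rfl
  have r9 : s₁.reg 9 = y := by simp [hs₁, setReg_reg, h9]
  have m10 : s₁.mem 10 = s.mem 10 := by ext z; simp [hs₁, setMem_apply]
  refine Reach.conseq (Reach.for (m := 7 + 2 ^ w * 6) hB (fun j s' =>
    Subsets (((bl y).take j).filter (· ∉ Z)) s' ∧ ValOK n s') rfl rfl (N := (bl y).length) ?_ ?_
    ?_ ?_) le_rfl ?_
  · exact hBig.cast_lt hwn
  · intro s' hF
    rw [Exp.eval, Exp.eval, hF.reg 9 rfl, r9, (hE₁.frame hF rfl).size y hy]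
  · refine ⟨⟨by simp, ?_, ?_, ?_, ?_, ?_, ?_⟩, ?_⟩
    · simp [hs₁, setReg_reg]
    · simp [hs₁, setReg_reg]
    · intro i hi; simp at hi
    · intro S hS
      simp only [List.take_zero, List.filter_nil, List.length_nil, pow_zero, Nat.lt_one_iff] at hS
      subst hS
      exact ⟨∅, by simp, by simp [hs₁, setMem_apply, code_empty], by simp [hs₁, setMem_apply]⟩
    · intro A hA
      simp only [List.take_zero, List.filter_nil, List.toFinset_nil, Finset.subset_empty] at hA
      subst hA
      exact ⟨0, by simp, by simp [hs₁, setMem_apply, code_empty]⟩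
    · intro A hA
      simp only [List.take_zero, List.filter_nil, List.toFinset_nil, Finset.subset_empty] at hA
      subst hA
      simp [hs₁, code_empty]
    · intro z
      by_cases hz : z = 0
      · exact Or.inr ⟨by simp [hs₁, hz], ∅, by rw [hz, code_empty]⟩
      · simpa [hs₁, setMem_apply, hz] using hval z
  · rintro j hj s₂ hg₂ hF₂ h10 ⟨hsub, hv₂⟩
    have hE₂ := hE₁.frame hF₂ rfl
    set v := (bl y)[j] with hv
    have e11 : (get 22 (add (mul (var 9) (var 0)) (var 10))).eval s₂ = ((v : ℕ) : ℤ) := by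
      simp only [Exp.eval, hF₂.reg 9 rfl, r9, hE₂.reg_n, h10]
      exact hE₂.bag y hy j hj
    have hvn : |((v : ℕ) : ℤ)| < 2 ^ B := by
      rw [abs_of_nonneg (by positivity)]
      exact hBig.cast_lt v.2.le
    refine Reach.conseq (m := 1 + ((5 + 2 ^ w * 6) + 1)) ?_ (by omega) (fun _ _ _ h => h)
    refine Reach.seq_set hB rfl (by rw [e11]; exact hvn) ?_
    rw [e11]
    set s₃ := s₂.setReg 11 ((v : ℕ) : ℤ) with hs₃
    have hsub₃ : Subsets (((bl y).take j).filter (· ∉ Z)) s₃ := by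
      constructor
      · exact hsub.nodup
      · rw [hs₃, setReg_ne _ _ (by norm_num)]; exact hsub.cnt
      · rw [hs₃, setReg_ne _ _ (by norm_num)]; exact hsub.size
      · exact hsub.lst
      · exact hsub.sub
      · exact hsub.surj
      · exact hsub.val
    have hE₃ : Env t G bl s₃ := by
      refine ⟨?_, ?_, hE₂.adj, hE₂.pw, hE₂.loc, hE₂.size, hE₂.bag⟩
      · rw [hs₃, setReg_ne _ _ (by norm_num)]; exact hE₂.reg_n
      · rw [hs₃, setReg_ne _ _ (by norm_num)]; exact hE₂.reg_t
    have m10' : s₃.mem 10 (v : ℕ) = if v ∈ Z then 1 else 0 := by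
      rw [hs₃, setReg_mem, hF₂.mem 10 rfl, m10]
      exact hZ v (List.getElem_mem _)
    have htake : (bl y).take (j + 1) = (bl y).take j ++ [v] := by
      rw [List.take_add_one, List.getElem?_eq_getElem hj]; rfl
    have hfin : ∀ s' : State, ∀ L : List (Fin n), Subsets L s' → Subsets L (s'.setReg 10 (j + 1 : ℕ)) := by
      intro s' L h
      refine ⟨h.nodup, ?_, ?_, h.lst, h.sub, h.surj, h.val⟩
      · rw [setReg_ne _ _ (by norm_num)]; exact h.cnt
      · rw [setReg_ne _ _ (by norm_num)]; exact h.size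
    refine Reach.ite' hB rfl rfl ?_ ?_
    · intro hc
      have hvZ : v ∉ Z := by
        intro h
        simp only [Exp.eval, hs₃, setReg_self] at hc
        simp only [hs₃] at m10'
        rw [m10', if_pos h] at hc
        exact absurd hc (lt_irrefl _)
      have hvl : v ∉ ((bl y).take j).filter (· ∉ Z) := by
        intro h
        have h2 := (List.mem_filter.1 h).1
        have h3 : ((bl y).take (j + 1)).Nodup := hnd.sublist (List.take_sublist _ _)
        rw [htake, List.nodup_append] at h3
        exact h3.2.2 v h2 v (by simp) rfl
      have hlen : (((bl y).take j).filter (· ∉ Z)).length ≤ w := by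
        refine (List.length_filter_le _ _).trans ?_
        rw [List.length_take]; omega
      refine Reach.conseq (listSets_step hBig hE₃ hsub₃ hv₂ hvl (by rw [hs₃, setReg_self])) ?_ ?_
      · have := Nat.pow_le_pow_right (show 1 ≤ 2 by norm_num) hlen
        omega
      · rintro s₄ - - ⟨h1, h2⟩
        refine ⟨hfin _ _ ?_, h2⟩
        rw [htake, List.filter_append]
        simpa [hvZ] using h1
    · intro hc
      have hvZ : v ∈ Z := by
        by_contra h
        apply hc
        simp only [Exp.eval, hs₃, setReg_self]
        simp only [hs₃] at m10'
        rw [m10', if_neg h]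
        norm_num
      refine Reach.conseq (Reach.skip (Q := fun s' => s' = s₃) hB rfl) (by omega) ?_
      rintro s' - - rfl
      refine ⟨hfin _ _ ?_, hv₂⟩
      rw [htake, List.filter_append]
      simpa [hvZ] using hsub₃
  · rintro s' - - h
    rwa [List.take_length] at h

end RAM

/-! ### Elimination of vertices from a table -/

namespace RAM

open Exp Cmd

/-- The new table entry, for the set with the number in register 15, when the vertex in
register 8 is eliminated from the bag of the node in register 3. -/
def forgetEntry : Cmd :=
  seq (set 16 (get 14 (var 15)))
  (seq (set 17 (get 9 (add (mul (add (var 16) (get 11 (var 8))) (var 2)) (var 3))))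
  (seq (.for 18 (var 12)
    (seq (set 19 (get 13 (var 18)))
    (set 17 (add (var 17) (mul (get 6 (add (mul (var 19) (var 0)) (var 8)))
      (mul (get 23 (sub (var 16) (get 11 (var 19))))
        (get 9 (add (mul (sub (var 16) (get 11 (var 19))) (var 2)) (var 3)))))))))
  (store 24 (var 15) (var 17))))

/-- Eliminates the vertex in register 8 from the bag of the node in register 3. -/
def forgetVertex : Cmd :=
  seq (store 10 (var 8) (lit 1))
  (seq (set 9 (var 3))
  (seq listSets
  (seq (.for 15 (var 13) forgetEntry)
  (.for 20 (var 13)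
    (store 9 (add (mul (get 14 (var 20)) (var 2)) (var 3)) (get 24 (var 20)))))))

/-- Eliminates all vertices in the bag of the node in register 3 that are not in the bag of the
node in register 4. -/
def forgetAll : Cmd :=
  .for 7 (get 21 (var 3))
    (seq (set 8 (get 22 (add (mul (var 3) (var 0)) (var 7))))
    (ite (get 12 (add (mul (var 4) (var 0)) (var 8))) (lit 1) forgetVertex skip))

variable {n t B : ℕ} {M : ℤ} {G : SimpleGraph (Fin n)} {bl : ℕ → List (Fin n)}

/-- This leaves room for one old entry and a term of size at most `M` for each of at most `n`
neighbors. -/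
theorem Big.mul_lt (h : Big n t M B) {a : ℤ} (ha : |a| ≤ (n + 1) * M) : |a| < 2 ^ B := by
  refine ha.trans_lt (lt_of_le_of_lt ?_ h.table)
  refine mul_le_mul_of_nonneg_left ?_ (by positivity)
  have h1 := h.one_le_M
  have h2 : (1 : ℤ) ≤ 16 ^ n := one_le_pow₀ (by norm_num)
  nlinarith

/-- The contribution of a neighbor in the elimination of a vertex. -/
noncomputable def forgetTerm (G : SimpleGraph (Fin n)) (v : Fin n) (f : Finset (Fin n) → ℤ)
    (A : Finset (Fin n)) (u : Fin n) : ℤ :=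
  open Classical in (if G.Adj u v then 1 else 0) * if u ∈ A then f (A.erase u) else 0

theorem abs_forgetTerm_le {v : Fin n} {f : Finset (Fin n) → ℤ} {A : Finset (Fin n)}
    (u : Fin n) (hM : 0 ≤ M) (hf : ∀ A' ⊆ A, |f A'| ≤ M) : |forgetTerm G v f A u| ≤ M := by
  rw [forgetTerm]
  split_ifs
  · simpa using hf _ (Finset.erase_subset _ _)
  all_goals simpa

theorem abs_sum_map_le {α : Type*} {f : α → ℤ} (l : List α) (h : ∀ u ∈ l, |f u| ≤ M) :
    |(l.map f).sum| ≤ l.length * M := by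
  induction l with
  | nil => simp
  | cons a l ih =>
    rw [List.map_cons, List.sum_cons, List.length_cons]
    have h1 := h a (by simp)
    have h2 := ih fun u hu => h u (by simp [hu])
    push_cast
    linarith [abs_add_le (f a) (l.map f).sum]

/-- The sum runs over all listed vertices; the adjacency matrix and the membership test occur as
factors instead of branches. Partial sums satisfy the same bound as the whole, so register 17 never
overflows. -/
theorem forgetEntry_spec (hBig : Big n t M B) {s : State} (hE : Env t G bl s)
    {l : List (Fin n)} (hs : Subsets l s) (hval : ValOK n s) {x : ℕ} (h3 : s.reg 3 = x)
    {v : Fin n} (h8 : s.reg 8 = (v : ℕ)) (hvl : v ∉ l) {S : ℤ} (h15 : s.reg 15 = S)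
    {A : Finset (Fin n)} (hA : A ⊆ l.toFinset) (h14 : s.mem 14 S = code A)
    {f : Finset (Fin n) → ℤ}
    (hf : ∀ A' ⊆ insert v l.toFinset, s.mem 9 (code A' * t + x) = f A' ∧ |f A'| ≤ M) :
    Reach B forgetEntry s (5 + 4 * l.length) fun s' =>
      s'.mem 24 S = f (insert v A) + ∑ u ∈ l.toFinset, forgetTerm G v f A u ∧
      ∀ z, z ≠ S → s'.mem 24 z = s.mem 24 z := by
  have hB := hBig.one_le
  have hM : 0 ≤ M := le_trans zero_le_one hBig.one_le_M
  have hvA : v ∉ A := fun h => hvl (by simpa using hA h)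
  have hfA := hf (insert v A) (Finset.insert_subset_insert _ hA)
  have hfS : ∀ A' ⊆ A, |f A'| ≤ M := fun A' h =>
    (hf A' (h.trans (hA.trans (Finset.subset_insert _ _)))).2
  refine Reach.conseq (m := 1 + (1 + ((2 + l.length * (2 + 2)) + 1))) ?_ (by omega)
    (fun _ _ _ h => h)
  refine Reach.seq_set hB rfl ?_ ?_
  · simpa only [Exp.eval, h15, h14] using hBig.abs_code_lt _
  simp only [Exp.eval, h15, h14]
  have e17 : (get 9 (add (mul (add (var 16) (get 11 (var 8))) (var 2)) (var 3))).eval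
      (s.setReg 16 (code A)) = f (insert v A) := by
    simp only [Exp.eval, setReg_reg, setReg_mem]
    norm_num
    rw [h8, hE.pw, hE.reg_t, h3, ← code_insert hvA, hfA.1]
  have hM1 : M ≤ (n + 1) * M := by nlinarith [Nat.cast_nonneg (α := ℤ) n]
  refine Reach.seq_set hB rfl ?_ ?_
  · rw [e17]
    exact hBig.mul_lt (hfA.2.trans hM1)
  rw [e17]
  set s₁ := (s.setReg 16 (code A)).setReg 17 (f (insert v A)) with hs₁
  have hF₁ : Frame forgetEntry s s₁ := by
    constructor
    · intro r hr
      simp only [forgetEntry, Cmd.wr, Bool.or_eq_false_iff, beq_eq_false_iff_ne] at hr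
      rw [hs₁, setReg_ne _ _ (Ne.symm hr.2.1), setReg_ne _ _ (Ne.symm hr.1)]
    · intro a _
      rfl
  have hE₁ := hE.frame hF₁ rfl
  have hsub₁ := hs.frame hF₁ rfl
  have hval₁ := hval.frame hF₁ rfl
  have r16 : s₁.reg 16 = code A := by rw [hs₁, setReg_ne _ _ (by norm_num), setReg_self]
  refine Reach.seq (Reach.for (m := 2) hB (fun j s' =>
    s'.reg 17 = f (insert v A) + ((l.take j).map (forgetTerm G v f A)).sum)
    rfl rfl (N := l.length) ?_ ?_ ?_ ?_) ?_
  · exact hBig.cast_lt hs.length_le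
  · intro s' hF
    rw [Exp.eval, hF.reg 12 rfl, hsub₁.cnt]
  · rw [setReg_ne _ _ (by norm_num), hs₁, setReg_self]
    simp
  · intro j hj s' hg hF h18 h17
    have hE' := hE₁.frame hF rfl
    have hsub' := hsub₁.frame hF rfl
    have hval' := hval₁.frame hF rfl
    set u := l[j] with hu
    have hul : u ∈ l := List.getElem_mem _
    have r19 : (get 13 (var 18)).eval s' = ((u : ℕ) : ℤ) := by
      simp only [Exp.eval, h18, hsub'.lst j hj, hu]
    refine Reach.conseq (m := 1 + 1) ?_ le_rfl (fun _ _ _ h => h)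
    refine Reach.seq_set hB rfl ?_ ?_
    · rw [r19, abs_of_nonneg (by positivity)]
      exact hBig.cast_lt u.2.le
    rw [r19]
    have e : (add (var 17) (mul (get 6 (add (mul (var 19) (var 0)) (var 8)))
        (mul (get 23 (sub (var 16) (get 11 (var 19))))
        (get 9 (add (mul (sub (var 16) (get 11 (var 19))) (var 2)) (var 3)))))).eval
        (s'.setReg 19 ((u : ℕ) : ℤ)) =
        f (insert v A) + ((l.take (j + 1)).map (forgetTerm G v f A)).sum := by
      rw [List.take_add_one, List.getElem?_eq_getElem hj]
      simp only [Option.toList_some, List.map_append, List.map_cons, List.map_nil,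
        List.sum_append, List.sum_cons, List.sum_nil, add_zero]
      rw [← add_assoc, ← h17]
      simp only [Exp.eval, setReg_reg, setReg_mem]
      norm_num
      rw [hE'.pw, hF.reg 8 rfl, hF.reg 16 rfl, r16, hF₁.reg 8 rfl, h8, hE'.reg_n, hE'.adj,
        hsub'.val_sub hval' hA, forgetTerm, ← hu]
      -- For `u ∉ A` the cell read here is meaningless, but its content is multiplied by zero.
      have : u ∈ A → s'.mem 9 ((code A - 4 ^ (u : ℕ)) * s'.reg 2 + s'.reg 3) =
          f (A.erase u) := by
        intro hmem
        rw [← code_erase hmem, hF.mem 9 rfl, hF₁.mem 9 rfl, hE'.reg_t, hF.reg 3 rfl,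
          hF₁.reg 3 rfl, h3]
        exact (hf _ ((Finset.erase_subset _ _).trans
          (hA.trans (Finset.subset_insert _ _)))).1
      by_cases hmem : u ∈ A
      · rw [this hmem]; simp [hmem]
      · simp [hmem]
    refine Reach.set hB rfl ?_ ?_
    · rw [e]
      refine hBig.mul_lt ?_
      have h1 := abs_sum_map_le (M := M) (f := forgetTerm G v f A) (l.take (j + 1))
        fun u _ => abs_forgetTerm_le u hM hfS
      have h2 : ((l.take (j + 1)).length : ℤ) ≤ n := by
        have := hs.length_le
        rw [List.length_take]
        exact_mod_cast (min_le_right _ _).trans this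
      have h3 := mul_le_mul_of_nonneg_right h2 hM
      refine (abs_add_le _ _).trans ?_
      linarith [hfA.2]
    · rw [e, setReg_ne _ _ (by norm_num), setReg_self]
  · intro s₂ hg₂ hF₂ h17
    have r15 : s₂.reg 15 = S := by rw [hF₂.reg 15 rfl, hF₁.reg 15 rfl, h15]
    have m24 : s₂.mem 24 = s.mem 24 := by rw [hF₂.mem 24 rfl, hs₁]; rfl
    refine Reach.store hB rfl rfl (hg₂.reg 17) ?_
    simp only [Exp.eval, r15, h17, List.take_length]
    refine ⟨?_, fun z hz => ?_⟩
    · rw [setMem_same, if_pos rfl, List.sum_toFinset _ hs.nodup]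
    · rw [setMem_same, if_neg hz, m24]

/-- A bound on the number of instructions in `forgetVertex`. -/
def forgetVertexTime (w : ℕ) : ℕ :=
  2 + listSetsTime w + (2 + 2 ^ w * (7 + 4 * w)) + (2 + 2 ^ w * 3)

/-- New entries are computed from old entries for smaller sets, so they are collected in array 24
before any cell of the table is overwritten. -/
theorem forgetVertex_spec (hBig : Big n t M B) {s : State} (hE : Env t G bl s) {x : ℕ}
    (hx : x < t) (h3 : s.reg 3 = x) {v : Fin n} (h8 : s.reg 8 = (v : ℕ)) {Z : Finset (Fin n)}
    (hZ : ∀ u : Fin n, s.mem 10 (u : ℕ) = if u ∈ Z then 1 else 0) (hval : ValOK n s)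
    (hnd : (bl x).Nodup) (hv : v ∈ bl x) (hvZ : v ∉ Z) {w : ℕ} (hw : (bl x).length ≤ w)
    {f : Finset (Fin n) → ℤ} (hf : ∀ A ⊆ Zᶜ, s.mem 9 (code A * t + x) = f A ∧ |f A| ≤ M) :
    Reach B forgetVertex s (forgetVertexTime w) fun s' =>
      (∀ u : Fin n, s'.mem 10 (u : ℕ) = if u ∈ insert v Z then 1 else 0) ∧ ValOK n s' ∧
      (∀ A ⊆ (bl x).toFinset \ insert v Z, s'.mem 9 (code A * t + x) =
        f (insert v A) + ∑ u ∈ (bl x).toFinset \ insert v Z, forgetTerm G v f A u) ∧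
      ∀ z, (∀ A ⊆ (bl x).toFinset \ insert v Z, z ≠ code A * t + x) →
        s'.mem 9 z = s.mem 9 z := by
  have hB := hBig.one_le
  set l := (bl x).filter (· ∉ insert v Z) with hl
  have hltf : (bl x).toFinset \ insert v Z = l.toFinset := by
    ext u; simp [hl]
  have hvl : v ∉ l := by simp [hl]
  have hlZ : insert v l.toFinset ⊆ Zᶜ := by
    intro u hu
    rw [Finset.mem_insert] at hu
    rcases hu with rfl | hu
    · simpa using hvZ
    · simp only [hl, List.mem_toFinset, List.mem_filter, decide_eq_true_eq,
        Finset.mem_insert, not_or] at hu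
      simpa using hu.2.2
  have hlw : l.length ≤ w := (List.length_filter_le _ _).trans hw
  rw [hltf]
  refine Reach.conseq (m := 1 + (1 + (listSetsTime w + ((2 + 2 ^ l.length * ((5 + 4 * w) + 2)) +
    (2 + 2 ^ l.length * (1 + 2)))))) ?_ ?_ (fun _ _ _ h => h)
  swap
  · have := Nat.pow_le_pow_right (show 1 ≤ 2 by norm_num) hlw
    have := Nat.mul_le_mul_right (7 + 4 * w) this
    rw [forgetVertexTime]
    linarith
  refine Reach.seq_store hB rfl rfl (by simpa [Exp.eval] using hBig.one_lt) ?_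
  refine Reach.with_good fun hg => ?_
  refine Reach.seq_set hB rfl (hg.reg 3) ?_
  simp only [Exp.eval, setMem_reg, h8, h3]
  set s₁ := (s.setMem 10 ((v : ℕ) : ℤ) 1).setReg 9 (x : ℤ) with hs₁
  have hF₁ : Frame forgetVertex s s₁ := by
    constructor
    · intro r hr
      simp only [forgetVertex, Cmd.wr, Bool.or_eq_false_iff, beq_eq_false_iff_ne] at hr
      rw [hs₁, setReg_ne _ _ (Ne.symm hr.2.1), setMem_reg]
    · intro a ha
      simp only [forgetVertex, Cmd.wm, Bool.or_eq_false_iff, beq_eq_false_iff_ne] at ha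
      rw [hs₁, setReg_mem, setMem_ne _ _ _ (Ne.symm ha.1)]
  have hE₁ := hE.frame hF₁ rfl
  have hval₁ : ValOK n s₁ := by
    intro z
    simpa [hs₁, setMem_apply] using hval z
  have m10 : ∀ u : Fin n, s₁.mem 10 (u : ℕ) = if u ∈ insert v Z then 1 else 0 := by
    intro u
    rw [hs₁, setReg_mem, setMem_same, hZ u]
    simp only [Finset.mem_insert, Fin.ext_iff]
    by_cases h : (u : ℕ) = v <;> simp [h]
  have m9 : s₁.mem 9 = s.mem 9 := by rw [hs₁, setReg_mem, setMem_ne _ _ _ (by norm_num)]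
  refine Reach.seq (listSets_spec hBig hE₁ hx (by rw [hs₁, setReg_self]) (fun u _ => m10 u)
    hval₁ hnd hw) ?_
  rintro s₂ hg₂ hF₂ ⟨hsub₂, hval₂⟩
  have hE₂ := hE₁.frame hF₂ rfl
  have hN : ((2 ^ l.length : ℕ) : ℤ) < 2 ^ B := by
    have := hBig.two_pow_lt hsub₂.length_le
    exact_mod_cast this
  set F : Finset (Fin n) → ℤ := fun A =>
    f (insert v A) + ∑ u ∈ l.toFinset, forgetTerm G v f A u with hFdef
  refine Reach.seq (Reach.for (m := 5 + 4 * w) hB (fun j s' => ∀ S : ℕ, S < j →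
      ∀ A ⊆ l.toFinset, s'.mem 14 S = code A → s'.mem 24 S = F A)
      rfl rfl (N := 2 ^ l.length) hN ?_ ?_ ?_) ?_
  · intro s' hF
    rw [Exp.eval, hF.reg 13 rfl, hsub₂.size]; push_cast; rfl
  · intro S hS
    exact absurd hS (Nat.not_lt_zero _)
  · intro j hj s' hg hF h15 hI
    have hsub' := hsub₂.frame hF rfl
    obtain ⟨A, hA, hA1, -⟩ := hsub'.sub j hj
    refine Reach.conseq (forgetEntry_spec hBig (hE₂.frame hF rfl) hsub'
      (hval₂.frame hF rfl) (x := x) ?_ (v := v) ?_ hvl h15 hA hA1 (f := f) ?_)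
      (Nat.add_le_add_left (Nat.mul_le_mul_left 4 hlw) 5) ?_
    · rw [hF.reg 3 rfl, hF₂.reg 3 rfl, hF₁.reg 3 rfl, h3]
    · rw [hF.reg 8 rfl, hF₂.reg 8 rfl, hF₁.reg 8 rfl, h8]
    · intro A' hA'
      rw [hF.mem 9 rfl, hF₂.mem 9 rfl, m9]
      exact hf A' (hA'.trans hlZ)
    · rintro s'' - hF'' ⟨h1, h2⟩ S hS A' hA' hA1'
      rw [setReg_mem] at hA1' ⊢
      rw [hF''.mem 14 rfl] at hA1'
      rcases Nat.lt_or_eq_of_le (Nat.le_of_lt_succ hS) with hS | rfl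
      · rw [h2 _ (by omega)]
        exact hI S hS A' hA' hA1'
      · rw [hA1] at hA1'
        rw [← code_injective hA1', h1]
  · intro s₃ hg₃ hF₃ h24
    have hsub₃ := hsub₂.frame hF₃ rfl
    refine Reach.conseq (Reach.for (m := 1) hB (fun j s' => (∀ S : ℕ, S < j →
      ∀ A ⊆ l.toFinset, s₃.mem 14 S = code A → s'.mem 9 (code A * t + x) = F A) ∧
      ∀ z, (∀ A ⊆ l.toFinset, z ≠ code A * t + x) → s'.mem 9 z = s.mem 9 z)
      rfl rfl (N := 2 ^ l.length) hN ?_ ?_ ?_) le_rfl ?_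
    · intro s' hF
      rw [Exp.eval, hF.reg 13 rfl, hsub₃.size]; push_cast; rfl
    · refine ⟨fun S hS => absurd hS (Nat.not_lt_zero _), fun z _ => ?_⟩
      rw [setReg_mem, hF₃.mem 9 rfl, hF₂.mem 9 rfl, m9]
    · rintro j hj s' hg hF h20 ⟨hI1, hI2⟩
      obtain ⟨A, hA, hA1, -⟩ := hsub₃.sub j hj
      have e1 : (add (mul (get 14 (var 20)) (var 2)) (var 3)).eval s' = code A * t + x := by
        simp only [Exp.eval, h20]
        rw [hF.mem 14 rfl, hA1, ((hE₂.frame hF₃ rfl).frame hF rfl).reg_t, hF.reg 3 rfl,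
          hF₃.reg 3 rfl, hF₂.reg 3 rfl, hF₁.reg 3 rfl, h3]
      have e2 : (get 24 (var 20)).eval s' = F A := by
        simp only [Exp.eval, h20]
        rw [hF.mem 24 rfl, h24 j hj A hA hA1]
      refine Reach.store hB rfl rfl (hg.mem 24 (by norm_num) _) ?_
      rw [e1, e2]
      refine ⟨fun S hS A' hA' hA1' => ?_, fun z hz => ?_⟩
      · rw [setReg_mem, setMem_same]
        rcases Nat.lt_or_eq_of_le (Nat.le_of_lt_succ hS) with hS | rfl
        · split_ifs with h
          · have h' := (address_injective (t := t) (x := x) (x' := x) ⟨by omega, by omega⟩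
              ⟨by omega, by omega⟩ h).1
            rw [code_injective h']
          · exact hI1 S hS A' hA' hA1'
        · rw [hA1] at hA1'
          rw [code_injective hA1', if_pos rfl]
      · rw [setReg_mem, setMem_same, if_neg (hz A hA)]
        exact hI2 z hz
    · rintro s₄ - hF₄ ⟨h1, h2⟩
      refine ⟨?_, ?_, ?_, h2⟩
      · rw [hF₄.mem 10 rfl, hF₃.mem 10 rfl, hF₂.mem 10 rfl]
        exact m10
      · exact (hval₂.frame hF₃ rfl).frame hF₄ rfl
      · intro A hA
        obtain ⟨S, hS, hS'⟩ := hsub₃.surj A hA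
        exact h1 S hS A hA hS'

end RAM

/-! ### Elimination as an operation on polynomials -/

namespace RAM

open Exp Cmd

variable {n t B k : ℕ} {M : ℤ} {G : SimpleGraph (Fin n)} {bl : ℕ → List (Fin n)}

/-- The state of the computation after the elimination of the vertices in `Z`, with a view to the
table of the node `x`: it holds the coefficients of `P`, and the number of perfect matchings
is a coefficient of the product of `P`, the polynomial `R` of all other nodes, and the polynomial
of the matchings of the remaining graph. -/
structure TableInv (k t : ℕ) (G : SimpleGraph (Fin n)) (bl : ℕ → List (Fin n)) (x : ℕ)
    (R : MvPolynomial (Fin n) ℤ) (s : State)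
    (Z : Finset (Fin n)) (P : MvPolynomial (Fin n) ℤ) (b : ℕ) : Prop where
  gone : ∀ u : Fin n, s.mem 10 (u : ℕ) = if u ∈ Z then 1 else 0
  val : ValOK n s
  main : sqCoeff (P * R * pmPoly G) Zᶜ = pmCount G Finset.univ
  tab : ∀ A ⊆ Zᶜ, s.mem 9 (code A * t + x) = sqCoeff P A
  supp : ∀ A ⊆ Zᶜ, ¬ A ⊆ (bl x).toFinset → sqCoeff P A = 0
  norm : sqNorm Zᶜ P ≤ (k + 1) ^ b
  le_card : b ≤ Z.card

theorem TableInv.congr {x : ℕ} {R P : MvPolynomial (Fin n) ℤ} {s s' : State}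
    {Z : Finset (Fin n)} {b : ℕ} (h : TableInv k t G bl x R s Z P b)
    (h9 : s'.mem 9 = s.mem 9) (h10 : s'.mem 10 = s.mem 10) (h23 : s'.mem 23 = s.mem 23) :
    TableInv k t G bl x R s' Z P b :=
  ⟨h10 ▸ h.gone, by rw [ValOK, h23]; exact h.val, h.main, h9 ▸ h.tab, h.supp, h.norm, h.le_card⟩

theorem TableInv.bound {x : ℕ} {R P : MvPolynomial (Fin n) ℤ} {s : State}
    {Z : Finset (Fin n)} {b : ℕ} (h : TableInv k t G bl x R s Z P b) {A : Finset (Fin n)}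
    (hA : A ⊆ Zᶜ) : |sqCoeff P A| ≤ (k + 1) ^ n := by
  refine (abs_sqCoeff_le hA P).trans (h.norm.trans ?_)
  refine pow_le_pow_right₀ (by linarith [Nat.cast_nonneg (α := ℤ) k]) (h.le_card.trans ?_)
  simpa using Finset.card_le_univ Z

/-- The program replaces the polynomial by `forget v N P`. The hypotheses `hR` and `hN` say that `v`
is private to the node: no other polynomial involves it, and its remaining neighbors are in the bag.
-/
theorem forgetVertex_tableInv (hBig : Big n t ((k + 1) ^ n) B) {s : State} (hE : Env t G bl s)
    {x : ℕ} (hx : x < t) (h3 : s.reg 3 = x) {v : Fin n} (h8 : s.reg 8 = (v : ℕ))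
    {R P : MvPolynomial (Fin n) ℤ} {Z : Finset (Fin n)} {b : ℕ}
    (hI : TableInv k t G bl x R s Z P b)
    (hnd : (bl x).Nodup) (hv : v ∈ bl x) (hvZ : v ∉ Z) (hw : (bl x).length ≤ k + 1)
    (hR : ∀ A ⊆ Zᶜ, v ∈ A → sqCoeff R A = 0)
    (hN : ∀ u ∉ Z, G.Adj u v → u ∈ bl x) :
    Reach B forgetVertex s (forgetVertexTime (k + 1)) fun s' =>
      (∃ P', TableInv k t G bl x R s' (insert v Z) P' (b + 1)) ∧
      ∀ z, (∀ A ⊆ (bl x).toFinset, z ≠ code A * t + x) → s'.mem 9 z = s.mem 9 z := by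
  classical
  refine Reach.conseq (forgetVertex_spec hBig hE hx h3 h8 hI.gone hI.val hnd hv hvZ hw
    (f := sqCoeff P) fun A hA => ⟨hI.tab A hA, hI.bound hA⟩) le_rfl ?_
  rintro s' - - ⟨h1, h2, h4, h5⟩
  refine ⟨?_, fun z hz => h5 z fun A hA => hz A (hA.trans Finset.sdiff_subset)⟩
  set N : Finset (Fin n) := {u ∈ (bl x).toFinset \ insert v Z | G.Adj u v} with hNdef
  have hvU : v ∈ Zᶜ := by simpa using hvZ
  have hcompl : (insert v Z)ᶜ = Zᶜ.erase v := Finset.compl_insert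
  have hvA : ∀ {A}, A ⊆ (insert v Z)ᶜ → v ∉ A := fun hA h => by
    have := hA h
    simp at this
  have hAZ : ∀ {A}, A ⊆ (insert v Z)ᶜ → A ⊆ Zᶜ := fun hA =>
    hA.trans (Finset.compl_subset_compl.2 (Finset.subset_insert _ _))
  refine ⟨forget v N P, h1, h2, ?_, ?_, ?_, ?_, ?_⟩
  · rw [hcompl, ← sqCoeff_forget_mul G hvU ?_ P hR]
    · exact hI.main
    · intro u hu
      rw [Finset.mem_compl] at hu
      simp only [hNdef, Finset.mem_filter, Finset.mem_sdiff, List.mem_toFinset,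
        Finset.mem_insert, not_or, and_iff_right_iff_imp]
      intro h
      exact ⟨hN u hu h, h.ne, hu⟩
  · intro A hA
    rw [sqCoeff_forget (hvA hA)]
    by_cases hAx : A ⊆ (bl x).toFinset
    · rw [h4 A]
      · congr 1
        rw [hNdef, Finset.sum_filter]
        refine Finset.sum_congr rfl fun u _ => ?_
        rw [forgetTerm]
        split_ifs <;> simp
      · intro u hu
        exact Finset.mem_sdiff.2 ⟨hAx hu, Finset.mem_compl.1 (hA hu)⟩
    -- Cells of sets that leave the bag are not rewritten. This is correct because the old
    -- coefficient and the new one both vanish: `N` lies in the bag, so removing one of its elements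
    -- cannot bring `A` inside.
    · rw [h5, hI.tab A (hAZ hA), hI.supp A (hAZ hA) hAx, hI.supp, zero_add]
      · refine (Finset.sum_eq_zero fun u hu => ?_).symm
        split_ifs with huA
        · refine hI.supp _ ((Finset.erase_subset _ _).trans (hAZ hA)) fun h => hAx ?_
          rw [hNdef, Finset.mem_filter, Finset.mem_sdiff] at hu
          rw [← Finset.insert_erase huA]
          exact Finset.insert_subset hu.1.1 h
        · rfl
      · exact Finset.insert_subset hvU (hAZ hA)
      · exact fun h => hAx ((Finset.subset_insert _ _).trans h)
      · intro A' hA' h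
        have := (address_injective (t := t) (x := x) (x' := x) ⟨by omega, by omega⟩
              ⟨by omega, by omega⟩ h).1
        rw [code_injective this] at hAx
        exact hAx (hA'.trans Finset.sdiff_subset)
  · intro A hA hAx
    rw [sqCoeff_forget (hvA hA), hI.supp, zero_add]
    · refine Finset.sum_eq_zero fun u hu => ?_
      split_ifs with huA
      · refine hI.supp _ ((Finset.erase_subset _ _).trans (hAZ hA)) fun h => hAx ?_
        rw [hNdef, Finset.mem_filter, Finset.mem_sdiff] at hu
        rw [← Finset.insert_erase huA]
        exact Finset.insert_subset hu.1.1 h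
      · rfl
    · exact Finset.insert_subset hvU (hAZ hA)
    · exact fun h => hAx ((Finset.subset_insert _ _).trans h)
  · rw [hcompl]
    refine (sqNorm_forget_le hvU N P).trans ?_
    -- The bag has at most `k + 1` vertices, and `v` is not its own neighbor. So an elimination
    -- costs a factor of `k + 1` in the norm.
    have hNk : N.card ≤ k := by
      have h6 : N ⊆ (bl x).toFinset.erase v := by
        intro u hu
        rw [hNdef, Finset.mem_filter, Finset.mem_sdiff, Finset.mem_insert, not_or] at hu
        exact Finset.mem_erase.2 ⟨hu.1.2.1, hu.1.1⟩
      have h7 := Finset.card_le_card h6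
      rw [Finset.card_erase_of_mem (by simpa using hv), List.toFinset_card_of_nodup hnd] at h7
      omega
    rw [pow_succ, mul_comm]
    have : (N.card : ℤ) ≤ k := by exact_mod_cast hNk
    exact mul_le_mul hI.norm (by linarith) (by positivity) (by positivity)
  · rw [Finset.card_insert_of_notMem hvZ]
    exact Nat.succ_le_succ hI.le_card

/-- A bound on the number of instructions in `forgetAll`. -/
def forgetAllTime (w : ℕ) : ℕ := 2 + w * (4 + forgetVertexTime w)

/-- The exponent of the norm grows by `e`, exactly the number of newly eliminated vertices; this is
how the exponents of all nodes together stay below the number of eliminated vertices. -/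
theorem forgetAll_spec (hBig : Big n t ((k + 1) ^ n) B) {s : State} (hE : Env t G bl s)
    {x p : ℕ} (hx : x < t) (h3 : s.reg 3 = x) (h4 : s.reg 4 = p)
    {R P : MvPolynomial (Fin n) ℤ} {Z : Finset (Fin n)} {b : ℕ}
    (hI : TableInv k t G bl x R s Z P b)
    (hnd : (bl x).Nodup) (hZx : ∀ v ∈ bl x, v ∉ Z) (hw : (bl x).length ≤ k + 1)
    (hR : ∀ v ∈ bl x, v ∉ bl p → ∀ A ⊆ Zᶜ, v ∈ A → sqCoeff R A = 0)
    (hN : ∀ v ∈ bl x, v ∉ bl p → ∀ u ∉ Z, G.Adj u v → u ∈ bl x) :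
    Reach B forgetAll s (forgetAllTime (k + 1)) fun s' =>
      (∃ P' e, TableInv k t G bl x R s' (Z ∪ ((bl x).filter (· ∉ bl p)).toFinset) P' (b + e) ∧
        (Z ∪ ((bl x).filter (· ∉ bl p)).toFinset).card = Z.card + e) ∧
      ∀ z, (∀ A ⊆ (bl x).toFinset, z ≠ code A * t + x) → s'.mem 9 z = s.mem 9 z := by
  have hB := hBig.one_le
  refine Reach.conseq (Reach.for (m := 1 + (forgetVertexTime (k + 1) + 1)) hB (fun j s' =>
      (∃ P' e, TableInv k t G bl x R s'
        (Z ∪ (((bl x).take j).filter (· ∉ bl p)).toFinset) P' (b + e) ∧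
        (Z ∪ (((bl x).take j).filter (· ∉ bl p)).toFinset).card = Z.card + e) ∧
      ∀ z, (∀ A ⊆ (bl x).toFinset, z ≠ code A * t + x) → s'.mem 9 z = s.mem 9 z)
    rfl rfl (N := (bl x).length) ?_ ?_ ?_ ?_) ?_ ?_
  · exact hBig.cast_lt (by simpa using hnd.length_le_card)
  · intro s' hF
    rw [Exp.eval, Exp.eval, hF.reg 3 rfl, h3, (hE.frame hF rfl).size x hx]
  · have h : TableInv k t G bl x R (s.setReg 7 0) Z P b := hI.congr rfl rfl rfl
    exact ⟨⟨P, 0, by simpa using h, by simp⟩, fun _ _ => rfl⟩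
  · rintro j hj s₂ hg₂ hF₂ h7 ⟨⟨P', e, hI', hcard⟩, hother⟩
    have hE₂ := hE.frame hF₂ rfl
    set v := (bl x)[j] with hv
    have hvx : v ∈ bl x := List.getElem_mem _
    set Z' := Z ∪ (((bl x).take j).filter (· ∉ bl p)).toFinset with hZ'
    have htake : (bl x).take (j + 1) = (bl x).take j ++ [v] := by
      rw [List.take_add_one, List.getElem?_eq_getElem hj]; rfl
    have hvZ' : v ∉ Z' := by
      rw [hZ', Finset.mem_union, List.mem_toFinset, List.mem_filter]
      rintro (h | ⟨h, -⟩)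
      · exact hZx v hvx h
      · have h3 : ((bl x).take (j + 1)).Nodup := hnd.sublist (List.take_sublist _ _)
        rw [htake, List.nodup_append] at h3
        exact h3.2.2 v h v (by simp) rfl
    have hZZ' : Z ⊆ Z' := Finset.subset_union_left
    have e8 : (get 22 (add (mul (var 3) (var 0)) (var 7))).eval s₂ = ((v : ℕ) : ℤ) := by
      simp only [Exp.eval, hF₂.reg 3 rfl, h3, hE₂.reg_n, h7]
      exact hE₂.bag x hx j hj
    refine Reach.seq_set hB rfl ?_ ?_
    · rw [e8, abs_of_nonneg (by positivity)]
      exact hBig.cast_lt v.2.le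
    rw [e8]
    set s₃ := s₂.setReg 8 ((v : ℕ) : ℤ) with hs₃
    have hF₃ : Frame forgetAll s₂ s₃ := by
      refine ⟨fun r hr => ?_, fun _ _ => rfl⟩
      simp only [forgetAll, Cmd.for, Cmd.wr, Bool.or_eq_false_iff, beq_eq_false_iff_ne] at hr
      rw [hs₃, setReg_ne _ _ (Ne.symm hr.2.1.1)]
    have hE₃ := hE₂.frame hF₃ rfl
    have hI₃ : TableInv k t G bl x R s₃ Z' P' (b + e) := hI'.congr rfl rfl rfl
    have hloc : (get 12 (add (mul (var 4) (var 0)) (var 8))).eval s₃ =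
        if v ∈ bl p then 1 else 0 := by
      rw [← hE₃.loc p v]
      simp only [Exp.eval, hE₃.reg_n]
      rw [hF₃.reg 4 rfl, hF₂.reg 4 rfl, h4, hs₃, setReg_self]
    refine Reach.ite' hB rfl rfl ?_ ?_
    · intro hc
      have hvp : v ∉ bl p := by
        intro h
        rw [hloc, if_pos h] at hc
        exact absurd hc (lt_irrefl _)
      have hZ'' : insert v Z' = Z ∪ (((bl x).take (j + 1)).filter (· ∉ bl p)).toFinset := by
        rw [htake, List.filter_append, List.toFinset_append, ← Finset.union_assoc]
        simp [hvp, hZ']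
      refine Reach.conseq (forgetVertex_tableInv hBig hE₃ hx
        (by rw [hF₃.reg 3 rfl, hF₂.reg 3 rfl, h3]) (by rw [hs₃, setReg_self]) hI₃ hnd hvx hvZ' hw
        (fun A hA => hR v hvx hvp A (hA.trans (Finset.compl_subset_compl.2 hZZ')))
        (fun u hu => hN v hvx hvp u fun h => hu (hZZ' h))) le_rfl ?_
      rintro s₄ - - ⟨⟨P₄, hP₄⟩, hoth⟩
      rw [hZ''] at hP₄
      refine ⟨⟨P₄, e + 1, ?_, ?_⟩, fun z hz => ?_⟩
      · rw [← add_assoc]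
        exact hP₄.congr rfl rfl rfl
      · rw [← hZ'', Finset.card_insert_of_notMem hvZ', hcard, add_assoc]
      · rw [setReg_mem, hoth z hz]
        exact hother z hz
    · intro hc
      have hvp : v ∈ bl p := by
        by_contra h
        apply hc
        rw [hloc, if_neg h]
        norm_num [Exp.eval]
      have hZ'' : Z' = Z ∪ (((bl x).take (j + 1)).filter (· ∉ bl p)).toFinset := by
        rw [htake, List.filter_append]
        simp [hvp, hZ']
      refine Reach.conseq (Reach.skip (Q := fun s' => s' = s₃) hB rfl) ?_ ?_
      · rw [forgetVertexTime]; omega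
      rintro s' - - rfl
      exact ⟨⟨P', e, hZ'' ▸ hI₃.congr rfl rfl rfl, hZ'' ▸ hcard⟩, hother⟩
  · rw [forgetAllTime]
    have := Nat.mul_le_mul_right (4 + forgetVertexTime (k + 1)) hw
    linarith
  · rintro s' - - h
    rwa [List.take_length] at h

end RAM

/-! ### Summation over subsets -/

namespace RAM

open Exp Cmd

/-- One layer of the transformation of the set function in array 16, for the vertex whose power
of four is in register 22. -/
def transformLayer (σ : ℤ) : Cmd :=
  seq (.for 23 (var 13)
      (seq (set 24 (get 14 (var 23)))
      (store 19 (var 23) (add (get 16 (var 24)) (mul (lit σ)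
        (mul (get 23 (sub (var 24) (var 22))) (get 16 (sub (var 24) (var 22)))))))))
    (.for 25 (var 13) (store 16 (get 14 (var 25)) (get 19 (var 25))))

/-- Sums the set function in array 16 over subsets, with the sign `σ`. -/
def transform (σ : ℤ) : Cmd :=
  .for 21 (var 12) (seq (set 22 (get 11 (get 13 (var 21)))) (transformLayer σ))

variable {n t B k : ℕ} {M : ℤ} {G : SimpleGraph (Fin n)} {bl : ℕ → List (Fin n)}

theorem Subsets.size_lt (hBig : Big n t M B) {l : List (Fin n)} {s : State} (hs : Subsets l s) :
    ((2 ^ l.length : ℕ) : ℤ) < 2 ^ B := by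
  have := hBig.two_pow_lt hs.length_le
  exact_mod_cast this

theorem Subsets.size_eval {l : List (Fin n)} {s s' : State} (hs : Subsets l s) {c : Cmd}
    (hF : Frame c s s') (hc : c.wr 13 = false) : (var 13).eval s' = (2 ^ l.length : ℕ) := by
  rw [Exp.eval, hF.reg 13 hc, hs.size]; push_cast; rfl

/-- The membership test serves as a factor, so no branching is needed. The new values are kept in
array 19 until all old ones have been read. -/
theorem transformLayer_spec (hBig : Big n t M B) {σ : ℤ} (hσ : |σ| ≤ 1) {s : State}
    {l : List (Fin n)} (hs : Subsets l s) (hval : ValOK n s) {v : Fin n}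
    (h22 : s.reg 22 = 4 ^ (v : ℕ)) {f : Finset (Fin n) → ℤ} {K : ℤ}
    (hf : ∀ A ⊆ l.toFinset, s.mem 16 (code A) = f A ∧ |f A| ≤ K) (hK : 2 * K < 2 ^ B) :
    Reach B (transformLayer σ) s (4 + 2 ^ l.length * 7) fun s' =>
      ∀ A ⊆ l.toFinset, s'.mem 16 (code A) = layer σ f v A := by
  have hB := hBig.one_le
  refine Reach.conseq (m := (2 + 2 ^ l.length * (2 + 2)) + (2 + 2 ^ l.length * (1 + 2))) ?_
    (by omega) (fun _ _ _ h => h)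
  refine Reach.seq (Reach.for hB (fun j s' => ∀ S : ℕ, S < j →
      ∀ A ⊆ l.toFinset, s'.mem 14 S = code A → s'.mem 19 S = layer σ f v A)
      rfl rfl (N := 2 ^ l.length) (hs.size_lt hBig) (fun s' hF => hs.size_eval hF rfl) ?_ ?_) ?_
  · intro S hS
    exact absurd hS (Nat.not_lt_zero _)
  · intro j hj s' hg hF h23 hI
    have hs' := hs.frame hF rfl
    obtain ⟨A, hA, hA1, -⟩ := hs'.sub j hj
    refine Reach.conseq (m := 1 + 1) ?_ le_rfl (fun _ _ _ h => h)
    refine Reach.seq_set hB rfl ?_ ?_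
    · simpa only [Exp.eval, h23, hA1] using hBig.abs_code_lt _
    simp only [Exp.eval, h23, hA1]
    have e : (add (get 16 (var 24)) (mul (lit σ)
        (mul (get 23 (sub (var 24) (var 22))) (get 16 (sub (var 24) (var 22)))))).eval
        (s'.setReg 24 (code A)) = layer σ f v A := by
      simp only [Exp.eval, setReg_reg, setReg_mem]
      norm_num
      rw [hF.reg 22 rfl, h22, hs'.val_sub (hval.frame hF rfl) hA, hF.mem 16 rfl, (hf A hA).1, layer]
      split_ifs with hv
      · rw [← code_erase hv, (hf _ ((Finset.erase_subset _ _).trans hA)).1, one_mul]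
      · ring
    refine Reach.store hB rfl rfl ?_ ?_
    · rw [e, layer]
      refine lt_of_le_of_lt ((abs_add_le _ _).trans ?_) hK
      have h0 : 0 ≤ K := (abs_nonneg _).trans (hf A hA).2
      have h1 : |if v ∈ A then f (A.erase v) else 0| ≤ K := by
        split_ifs
        · exact (hf _ ((Finset.erase_subset _ _).trans hA)).2
        · simpa using h0
      rw [abs_mul]
      have h2 := mul_le_mul hσ h1 (abs_nonneg _) zero_le_one
      linarith [(hf A hA).2]
    · rw [e]
      have e23 : (var 23).eval (s'.setReg 24 (code A)) = j := by
        simp [Exp.eval, setReg_reg, h23]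
      rw [e23]
      intro S hS A' hA' hA1'
      simp only [setReg_mem, setMem_apply] at hA1' ⊢
      norm_num at hA1' ⊢
      rcases Nat.lt_or_eq_of_le (Nat.le_of_lt_succ hS) with hS | rfl
      · rw [if_neg (by omega)]
        exact hI S hS A' hA' hA1'
      · rw [if_pos rfl, code_injective (hA1.symm.trans hA1')]
  · intro s₂ hg₂ hF₂ h19
    have hs₂ := hs.frame hF₂ rfl
    refine Reach.conseq (Reach.for (m := 1) hB (fun j s' => ∀ S : ℕ, S < j →
      ∀ A ⊆ l.toFinset, s₂.mem 14 S = code A → s'.mem 16 (code A) = layer σ f v A)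
      rfl rfl (N := 2 ^ l.length) (hs.size_lt hBig) (fun s' hF => hs₂.size_eval hF rfl) ?_ ?_)
      le_rfl ?_
    · intro S hS
      exact absurd hS (Nat.not_lt_zero _)
    · intro j hj s' hg hF h25 hI
      obtain ⟨A, hA, hA1, -⟩ := hs₂.sub j hj
      have e1 : (get 14 (var 25)).eval s' = code A := by
        simp only [Exp.eval, h25, hF.mem 14 rfl, hA1]
      have e2 : (get 19 (var 25)).eval s' = layer σ f v A := by
        simp only [Exp.eval, h25, hF.mem 19 rfl, h19 j hj A hA hA1]
      refine Reach.store hB rfl rfl (hg.mem 19 (by norm_num) _) ?_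
      rw [e1, e2]
      intro S hS A' hA' hA1'
      rw [setReg_mem, setMem_same]
      split_ifs with h
      · rw [code_injective h]
      · rcases Nat.lt_or_eq_of_le (Nat.le_of_lt_succ hS) with hS | rfl
        · exact hI S hS A' hA' hA1'
        · exact absurd (hA1'.symm.trans hA1) h
    · rintro s' - - hI A hA
      obtain ⟨S, hS, hS'⟩ := hs₂.surj A hA
      exact hI S hS A hA hS'

theorem transform_spec (hBig : Big n t M B) {σ : ℤ} (hσ : |σ| ≤ 1) {s : State}
    (hE : Env t G bl s) {l : List (Fin n)} (hs : Subsets l s) (hval : ValOK n s)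
    {f : Finset (Fin n) → ℤ} {K : ℤ} (hK0 : 0 ≤ K)
    (hf : ∀ A ⊆ l.toFinset, s.mem 16 (code A) = f A ∧ |f A| ≤ K) (hK : 2 ^ n * K < 2 ^ B) :
    Reach B (transform σ) s (2 + l.length * (7 + 2 ^ l.length * 7)) fun s' =>
      ∀ A ⊆ l.toFinset, s'.mem 16 (code A) = l.foldl (layer σ) f A := by
  have hB := hBig.one_le
  refine Reach.conseq (Reach.for (m := 1 + (4 + 2 ^ l.length * 7)) hB (fun j s' =>
      ∀ A ⊆ l.toFinset, s'.mem 16 (code A) = (l.take j).foldl (layer σ) f A)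
      rfl rfl (N := l.length) (hBig.cast_lt hs.length_le) ?_ ?_ ?_) (by
        rw [show 1 + (4 + 2 ^ l.length * 7) + 2 = 7 + 2 ^ l.length * 7 by ring]) ?_
  · intro s' hF
    rw [Exp.eval, hF.reg 12 rfl, hs.cnt]
  · intro A hA
    exact (hf A hA).1
  · intro j hj s' hg hF h21 hI
    have hs' := hs.frame hF rfl
    set v := l[j] with hv
    have e22 : (get 11 (get 13 (var 21))).eval s' = 4 ^ (v : ℕ) := by
      simp only [Exp.eval, h21]
      rw [hs'.lst j hj, (hE.frame hF rfl).pw]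
    refine Reach.seq_set hB rfl ?_ ?_
    · exact hg.mem 11 (by norm_num) _
    rw [e22]
    set s₁ := s'.setReg 22 (4 ^ (v : ℕ)) with hs₁
    have hF₁ : Frame (transform σ) s' s₁ := by
      refine ⟨fun r hr => ?_, fun _ _ => rfl⟩
      simp only [transform, Cmd.for, Cmd.wr, Bool.or_eq_false_iff, beq_eq_false_iff_ne] at hr
      rw [hs₁, setReg_ne _ _ (Ne.symm hr.2.1.1)]
    refine Reach.conseq (transformLayer_spec hBig hσ (hs'.frame hF₁ rfl)
      ((hval.frame hF rfl).frame hF₁ rfl) (v := v) (by rw [hs₁, setReg_self])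
      -- The bound has doubled in each of the `j` layers so far; `j < n` leaves room for one more.
      (f := (l.take j).foldl (layer σ) f) (K := 2 ^ j * K) ?_ ?_) le_rfl ?_
    · intro A hA
      refine ⟨hI A hA, ?_⟩
      have := abs_foldl_layer_le hσ hK0 (l.take j) (f := f) (A := A)
        fun A' hA' => (hf A' (hA'.trans hA)).2
      rwa [List.length_take, min_eq_left hj.le] at this
    · refine lt_of_le_of_lt ?_ hK
      rw [← mul_assoc, ← pow_succ']
      refine mul_le_mul_of_nonneg_right ?_ hK0
      exact pow_le_pow_right₀ (by norm_num) (by have := hs.length_le; omega)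
    · rintro s'' - - h A hA
      rw [setReg_mem, h A hA, List.take_add_one, List.getElem?_eq_getElem hj, Option.toList_some,
        List.foldl_append, List.foldl_cons, List.foldl_nil]
  · rintro s' - - h
    rwa [List.take_length] at h

end RAM

/-! ### Multiplication of two tables -/

namespace RAM

open Exp Cmd

/-- Does `c` if the values of `e` and `f` are equal. -/
def Cmd.ifEq (e f : Exp) (c : Cmd) : Cmd := ite e f skip (ite f e skip c)

theorem Reach.ifEq {B : ℕ} {e f : Exp} {c : Cmd} {s : State} {m : ℕ} {Q : State → Prop}
    (hB : 1 ≤ B) (he : e.hi = true) (hf : f.hi = true) (hm : 1 ≤ m)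
    (h₁ : e.eval s = f.eval s → Reach B c s m Q) (h₂ : e.eval s ≠ f.eval s → Q s) :
    Reach B (.ifEq e f c) s (m + 2) Q := by
  refine Reach.ite' (m := m + 1) hB he hf (fun h => ?_) (fun h => Reach.ite' hB hf he ?_ ?_)
  · exact Reach.conseq (Reach.skip hB (h₂ h.ne)) (by omega) fun _ _ _ h => h
  · intro h'
    exact Reach.conseq (Reach.skip hB (h₂ h'.ne')) hm fun _ _ _ h => h
  · intro h'
    exact h₁ (by omega)

/-- Transforms the slice with the number in register 26 of the table of the node in register `q`
into the array `c`. -/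
def sliceTransform (q c : ℕ) : Cmd :=
  seq (.for 27 (var 13)
    (seq (set 28 (get 14 (var 27)))
    (seq (store 16 (var 28) (lit 0))
    (.ifEq (get 15 (var 27)) (var 26)
      (store 16 (var 28) (get 9 (add (mul (var 28) (var 2)) (var q))))))))
  (seq (transform 1)
  (.for 29 (var 13)
    (store c (add (mul (var 29) (add (var 0) (lit 1))) (var 26)) (get 16 (get 14 (var 29))))))

/-- Computes the product of the slices in register 30 into array 16. -/
def productSlice : Cmd :=
  .for 32 (var 13)
    (seq (set 33 (lit 0))
    (seq (.for 34 (add (var 30) (lit 1))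
      (set 33 (add (var 33) (mul
        (get 17 (add (mul (var 32) (add (var 0) (lit 1))) (var 34)))
        (get 18 (add (mul (var 32) (add (var 0) (lit 1))) (sub (var 30) (var 34))))))))
    (store 16 (get 14 (var 32)) (var 33))))

/-- Copies the slice with the number in register 30 from array 16 into the table of the node in
register 4. -/
def copySlice : Cmd :=
  .for 35 (var 13)
    (.ifEq (get 15 (var 35)) (var 30)
      (store 9 (add (mul (get 14 (var 35)) (var 2)) (var 4)) (get 16 (get 14 (var 35)))))

/-- Multiplies the table of the node in register 4 with the table of the node in register 3. -/
def join : Cmd :=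
  seq (set 9 (var 4))
  (seq listSets
  (seq (.for 26 (add (var 12) (lit 1)) (seq (sliceTransform 3 17) (sliceTransform 4 18)))
  (.for 30 (add (var 12) (lit 1)) (seq productSlice (seq (transform (-1)) copySlice)))))

variable {n t B k : ℕ} {M : ℤ} {G : SimpleGraph (Fin n)} {bl : ℕ → List (Fin n)}

theorem Big.layer_lt (h : Big n t M B) : 2 ^ n * M < 2 ^ B := by
  refine lt_of_le_of_lt ?_ h.table
  have h1 := h.one_le_M
  have h2 : (2 : ℤ) ^ n ≤ 16 ^ n := pow_le_pow_left₀ (by norm_num) (by norm_num) n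
  have h3 : (0 : ℤ) ≤ 16 ^ n * M ^ 2 := by positivity
  have h4 : (2 : ℤ) ^ n * M ≤ 16 ^ n * M ^ 2 :=
    mul_le_mul h2 (by nlinarith) (by linarith) (by positivity)
  nlinarith [Nat.cast_nonneg (α := ℤ) n]

/-- Sizes range from `0` to `n`, so the transforms of the slices are stored in rows of length `n +
1`. -/
theorem ranked_address_injective {S r S' r' : ℕ} (hr : r ≤ n) (hr' : r' ≤ n)
    (h : (S : ℤ) * (n + 1) + r = S' * (n + 1) + r') : S = S' ∧ r = r' := by
  have := address_injective (t := n + 1) (q := S) (q' := S') (x := r) (x' := r')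
    ⟨by omega, by push_cast; omega⟩ ⟨by omega, by push_cast; omega⟩ (by push_cast; exact h)
  omega

/-- The array `c` holds the transform of the slice `r` of `f`. -/
def HasSlice (n : ℕ) (c : ℕ) (l : List (Fin n)) (f : Finset (Fin n) → ℤ) (r : ℕ) (s : State) :
    Prop :=
  ∀ S : ℕ, S < 2 ^ l.length → ∀ A ⊆ l.toFinset, s.mem 14 S = code A →
    s.mem c ((S : ℤ) * (n + 1) + r) = l.foldl (layer 1) (slice r f) A

theorem HasSlice.congr {c r : ℕ} {l : List (Fin n)} {f : Finset (Fin n) → ℤ} {s s' : State}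
    (h : HasSlice n c l f r s) (h14 : s'.mem 14 = s.mem 14) (hc : s'.mem c = s.mem c) :
    HasSlice n c l f r s' := by
  rw [HasSlice, h14, hc]; exact h

/-- The slice is written into array 16 for every listed set, with explicit zeros for the other
sizes, because the array still holds the previous slice. The second conclusion lets the slices
accumulate in array `c`. -/
theorem sliceTransform_spec (hBig : Big n t M B) {s : State}
    (hE : Env t G bl s) {l : List (Fin n)} (hs : Subsets l s) (hval : ValOK n s)
    {q c y r : ℕ} (hq : q = 3 ∨ q = 4) (hc : c = 17 ∨ c = 18) (hqy : s.reg q = y)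
    (h26 : s.reg 26 = r) (hr : r ≤ n) {f : Finset (Fin n) → ℤ}
    (hf : ∀ A ⊆ l.toFinset, s.mem 9 (code A * t + y) = f A ∧ |f A| ≤ M) :
    Reach B (sliceTransform q c) s (6 + 2 ^ l.length * 10 + (2 + l.length * (7 + 2 ^ l.length * 7)))
      fun s' => HasSlice n c l f r s' ∧
        ∀ r' ≤ n, r' ≠ r → ∀ g, HasSlice n c l g r' s → HasSlice n c l g r' s' := by
  have hB := hBig.one_le
  have hM : 0 ≤ M := le_trans zero_le_one hBig.one_le_M
  have hM' : M < 2 ^ B := by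
    have := hBig.mul_lt (a := M) (by rw [abs_of_nonneg hM]; nlinarith [Nat.cast_nonneg (α := ℤ) n])
    exact (le_abs_self M).trans_lt this
  refine Reach.conseq (m := (2 + 2 ^ l.length * ((1 + (1 + (1 + 2))) + 2)) +
    ((2 + l.length * (7 + 2 ^ l.length * 7)) + (2 + 2 ^ l.length * (1 + 2)))) ?_ (by omega)
    (fun _ _ _ h => h)
  refine Reach.seq (Reach.for hB (fun j s' => ∀ S : ℕ, S < j →
      ∀ A ⊆ l.toFinset, s.mem 14 S = code A → s'.mem 16 (code A) = slice r f A)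
      rfl rfl (N := 2 ^ l.length) (hs.size_lt hBig) (fun s' hF => hs.size_eval hF rfl) ?_ ?_) ?_
  · intro S hS
    exact absurd hS (Nat.not_lt_zero _)
  · intro j hj s' hg hF h27 hI
    obtain ⟨A, hA, hA1, hA2⟩ := hs.sub j hj
    have hAs : s'.mem 14 j = code A := by rw [hF.mem 14 rfl, hA1]
    refine Reach.seq_set hB rfl ?_ ?_
    · simpa only [Exp.eval, h27, hAs] using hBig.abs_code_lt _
    simp only [Exp.eval, h27, hAs]
    refine Reach.seq_store (m := 1 + 2) hB rfl rfl hBig.zero_lt ?_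
    simp only [Exp.eval, setReg_self]
    set s₁ := (s'.setReg 28 (code A)).setMem 16 (code A) 0 with hs₁
    have r27 : s₁.reg 27 = j := by simp [hs₁, setReg_reg, h27]
    have r28 : s₁.reg 28 = code A := by simp [hs₁]
    have r26 : s₁.reg 26 = r := by
      simp only [hs₁, setMem_reg, setReg_reg]
      norm_num
      rw [hF.reg 26 rfl, h26]
    have e15 : (get 15 (var 27)).eval s₁ = A.card := by
      simp only [Exp.eval, r27]
      rw [hs₁, setMem_ne _ _ _ (by norm_num), setReg_mem, hF.mem 15 rfl, hA2]
    have m16 : ∀ z, z ≠ code A → s₁.mem 16 z = s'.mem 16 z := by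
      intro z hz
      rw [hs₁, setMem_same, if_neg hz, setReg_mem]
    refine Reach.ifEq hB rfl rfl le_rfl ?_ ?_
    · intro heq
      rw [e15, Exp.eval, r26] at heq
      have e9 : (get 9 (add (mul (var 28) (var 2)) (var q))).eval s₁ = f A := by
        simp only [Exp.eval, r28]
        have : s₁.reg q = y := by
          rw [hs₁, setMem_reg, setReg_ne _ _ (by rcases hq with rfl | rfl <;> norm_num)]
          rcases hq with rfl | rfl
          · rw [hF.reg 3 rfl, hqy]
          · rw [hF.reg 4 rfl, hqy]
        rw [this, show s₁.reg 2 = t by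
          simp only [hs₁, setMem_reg, setReg_reg]
          norm_num
          rw [hF.reg 2 rfl, hE.reg_t], ← (hf A hA).1]
        rw [hs₁, setMem_ne _ _ _ (by norm_num), setReg_mem, hF.mem 9 rfl]
      refine Reach.store hB rfl (by rfl) ?_ ?_
      · rw [e9]
        exact (hf A hA).2.trans_lt hM'
      rw [e9, Exp.eval, r28]
      intro S hS A' hA' hA1'
      rw [setReg_mem, setMem_same]
      split_ifs with h
      · rw [code_injective h, slice, if_pos (by exact_mod_cast heq)]
      · rcases Nat.lt_or_eq_of_le (Nat.le_of_lt_succ hS) with hS | rfl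
        · rw [m16 _ h]
          exact hI S hS A' hA' hA1'
        · exact absurd (hA1'.symm.trans hA1) h
    · intro hne
      rw [e15, Exp.eval, r26] at hne
      intro S hS A' hA' hA1'
      rw [setReg_mem]
      by_cases h : code A' = code A
      · rw [h, hs₁, setMem_same, if_pos rfl, code_injective h, slice,
          if_neg (by exact_mod_cast hne)]
      · rcases Nat.lt_or_eq_of_le (Nat.le_of_lt_succ hS) with hS | rfl
        · rw [m16 _ h]
          exact hI S hS A' hA' hA1'
        · exact absurd (hA1'.symm.trans hA1) h
  · intro s₂ hg₂ hF₂ h16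
    have hs₂ := hs.frame hF₂ rfl
    have hval₂ := hval.frame hF₂ rfl
    refine Reach.seq (transform_spec hBig (σ := 1) (by norm_num) (hE.frame hF₂ rfl) hs₂ hval₂ hM
      (f := slice r f) ?_ hBig.layer_lt) ?_
    · intro A hA
      refine ⟨?_, ?_⟩
      · obtain ⟨S, hS, hS'⟩ := hs.surj A hA
        exact h16 S hS A hA hS'
      · rw [slice]
        split_ifs
        · exact (hf A hA).2
        · simpa using hM
    · intro s₃ hg₃ hF₃ h16'
      have hs₃ := hs₂.frame hF₃ rfl
      have hcw : (.for 29 (var 13) (store c (add (mul (var 29) (add (var 0) (lit 1))) (var 26))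
        (get 16 (get 14 (var 29)))) : Cmd).wm 14 = false ∧
        (.for 29 (var 13) (store c (add (mul (var 29) (add (var 0) (lit 1))) (var 26))
        (get 16 (get 14 (var 29)))) : Cmd).wm 16 = false := by
        rcases hc with rfl | rfl <;> exact ⟨rfl, rfl⟩
      have m3c : s₃.mem c = s.mem c := by
        rcases hc with rfl | rfl
        · rw [hF₃.mem 17 rfl, hF₂.mem 17 rfl]
        · rw [hF₃.mem 18 rfl, hF₂.mem 18 rfl]
      have m3 : s₃.mem 14 = s.mem 14 := by rw [hF₃.mem 14 rfl, hF₂.mem 14 rfl]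
      refine Reach.conseq (Reach.for (m := 1) hB (fun j s' => (∀ S : ℕ, S < j →
        ∀ A ⊆ l.toFinset, s.mem 14 S = code A →
          s'.mem c ((S : ℤ) * (n + 1) + r) = l.foldl (layer 1) (slice r f) A) ∧
        ∀ (S r' : ℕ), r' ≤ n → r' ≠ r →
          s'.mem c ((S : ℤ) * (n + 1) + r') = s.mem c ((S : ℤ) * (n + 1) + r'))
        rfl rfl (N := 2 ^ l.length) (hs.size_lt hBig)
        (fun s' hF => hs₃.size_eval hF rfl) ?_ ?_) le_rfl ?_
      · refine ⟨fun S hS => absurd hS (Nat.not_lt_zero _), fun S r' _ _ => ?_⟩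
        rw [setReg_mem, m3c]
      · rintro j hj s' hg hF h29 ⟨hI1, hI2⟩
        obtain ⟨A, hA, hA1, -⟩ := hs₃.sub j hj
        have e1 : (add (mul (var 29) (add (var 0) (lit 1))) (var 26)).eval s' =
            (j : ℤ) * (n + 1) + r := by
          simp only [Exp.eval, h29]
          rw [hF.reg 0 rfl, hF₃.reg 0 rfl, hF₂.reg 0 rfl, hE.reg_n, hF.reg 26 rfl,
            hF₃.reg 26 rfl, hF₂.reg 26 rfl, h26]
        have e2 : (get 16 (get 14 (var 29))).eval s' = l.foldl (layer 1) (slice r f) A := by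
          simp only [Exp.eval, h29]
          rw [hF.mem 14 hcw.1, hA1, hF.mem 16 hcw.2, h16' A hA]
        refine Reach.store hB rfl rfl (hg.mem 16 (by norm_num) _) ?_
        rw [e1, e2]
        refine ⟨fun S hS A' hA' hA1' => ?_, fun S r' hr' hne => ?_⟩
        · rw [setReg_mem, setMem_same]
          rcases Nat.lt_or_eq_of_le (Nat.le_of_lt_succ hS) with hS | rfl
          · rw [if_neg]
            · exact hI1 S hS A' hA' hA1'
            · intro h
              have := (ranked_address_injective hr hr h).1
              omega
          · rw [m3, hA1'] at hA1
            rw [if_pos rfl, code_injective hA1]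
        · rw [setReg_mem, setMem_same, if_neg]
          · exact hI2 S r' hr' hne
          · intro h
            exact hne (ranked_address_injective hr' hr h).2
      · rintro s₄ - hF₄ ⟨h1, h2⟩
        have m4 : s₄.mem 14 = s.mem 14 := by rw [hF₄.mem 14 hcw.1, m3]
        refine ⟨?_, ?_⟩
        · rw [HasSlice, m4]
          exact h1
        · intro r' hr' hne g hg S hS A hA hA1
          rw [h2 S r' hr' hne]
          rw [m4] at hA1
          exact hg S hS A hA hA1

/-- A transform of a slice is at most `2 ^ n * M`, and a sum has at most `n + 1` products. The bound
is proved for partial sums because they pass through register 33. -/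
theorem productSlice_spec (hBig : Big n t M B) {s : State}
    (hE : Env t G bl s) {l : List (Fin n)} (hs : Subsets l s) {r : ℕ}
    (h30 : s.reg 30 = r) (hr : r ≤ l.length) {f g : Finset (Fin n) → ℤ}
    (hf : ∀ A ⊆ l.toFinset, |f A| ≤ M) (hg : ∀ A ⊆ l.toFinset, |g A| ≤ M)
    (h17 : ∀ i ≤ r, HasSlice n 17 l f i s) (h18 : ∀ i ≤ r, HasSlice n 18 l g i s) :
    Reach B productSlice s (2 + 2 ^ l.length * (6 + (l.length + 1) * 3)) fun s' =>
      ∀ A ⊆ l.toFinset,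
        s'.mem 16 (code A) = (∑ i ∈ Finset.range (r + 1), l.foldl (layer 1) (slice i f) A *
          l.foldl (layer 1) (slice (r - i) g) A) ∧
        |∑ i ∈ Finset.range (r + 1), l.foldl (layer 1) (slice i f) A *
          l.foldl (layer 1) (slice (r - i) g) A| ≤ (n + 1) * (2 ^ n * M) ^ 2 := by
  have hB := hBig.one_le
  have hM : 0 ≤ M := le_trans zero_le_one hBig.one_le_M
  have hrn : r ≤ n := hr.trans hs.length_le
  have hsl : ∀ {h : Finset (Fin n) → ℤ}, (∀ A ⊆ l.toFinset, |h A| ≤ M) → ∀ i, ∀ A ⊆ l.toFinset,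
      |l.foldl (layer 1) (slice i h) A| ≤ 2 ^ n * M := by
    intro h hh i A hA
    refine (abs_foldl_layer_le (σ := 1) (by norm_num) hM l fun A' hA' => ?_).trans ?_
    · rw [slice]
      split_ifs
      · exact hh _ (hA'.trans hA)
      · simpa using hM
    · exact mul_le_mul_of_nonneg_right (pow_le_pow_right₀ (by norm_num) hs.length_le) hM
  have hpart : ∀ j ≤ r + 1, ∀ A ⊆ l.toFinset,
      |∑ i ∈ Finset.range j, l.foldl (layer 1) (slice i f) A *
          l.foldl (layer 1) (slice (r - i) g) A| ≤ (n + 1) * (2 ^ n * M) ^ 2 := by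
    intro j hj A hA
    refine (Finset.abs_sum_le_sum_abs _ _).trans
      ((Finset.sum_le_card_nsmul _ _ ((2 ^ n * M) ^ 2) fun i _ => ?_).trans ?_)
    · rw [abs_mul, sq]
      exact mul_le_mul (hsl hf i A hA) (hsl hg _ A hA) (abs_nonneg _) (by positivity)
    · rw [Finset.card_range, nsmul_eq_mul]
      refine mul_le_mul_of_nonneg_right ?_ (sq_nonneg _)
      have : j ≤ n + 1 := by omega
      exact_mod_cast this
  have hlt : ((n : ℤ) + 1) * (2 ^ n * M) ^ 2 < 2 ^ B := by
    refine lt_of_le_of_lt ?_ hBig.table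
    refine mul_le_mul_of_nonneg_left ?_ (by positivity)
    rw [mul_pow, ← pow_mul, mul_comm n 2, pow_mul]
    refine mul_le_mul_of_nonneg_right ?_ (sq_nonneg _)
    exact pow_le_pow_left₀ (by norm_num) (by norm_num) n
  refine Reach.conseq (Reach.for (m := 1 + ((2 + (r + 1) * (1 + 2)) + 1)) hB
      (fun j s' => ∀ S : ℕ, S < j →
      ∀ A ⊆ l.toFinset, s.mem 14 S = code A → s'.mem 16 (code A) =
        ∑ i ∈ Finset.range (r + 1), l.foldl (layer 1) (slice i f) A *
          l.foldl (layer 1) (slice (r - i) g) A)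
      rfl rfl (N := 2 ^ l.length) (hs.size_lt hBig) (fun s' hF => hs.size_eval hF rfl) ?_ ?_) ?_ ?_
  · intro S hS
    exact absurd hS (Nat.not_lt_zero _)
  · intro j hj s' hgood hF h32 hI
    obtain ⟨A, hA, hA1, -⟩ := hs.sub j hj
    have hE' := hE.frame hF rfl
    refine Reach.seq_set hB rfl hBig.zero_lt ?_
    simp only [Exp.eval]
    set s₁ := s'.setReg 33 0 with hs₁
    have r30 : s₁.reg 30 = r := by
      rw [hs₁, setReg_ne _ _ (by norm_num), hF.reg 30 rfl, h30]
    have r32 : s₁.reg 32 = j := by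
      rw [hs₁, setReg_ne _ _ (by norm_num), h32]
    have r0 : s₁.reg 0 = n := by
      rw [hs₁, setReg_ne _ _ (by norm_num), hE'.reg_n]
    refine Reach.seq (Reach.for (m := 1) hB (fun i s'' => s''.reg 33 =
      ∑ i ∈ Finset.range i, l.foldl (layer 1) (slice i f) A *
          l.foldl (layer 1) (slice (r - i) g) A) rfl rfl (N := r + 1) ?_ ?_ ?_ ?_) ?_
    · have := hBig.two_pow_lt (le_refl n)
      refine lt_of_le_of_lt ?_ this
      have : n < 2 ^ n := Nat.lt_two_pow_self
      exact_mod_cast (by omega : r + 1 ≤ 2 ^ n)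
    · intro s'' hF''
      simp only [Exp.eval]
      rw [hF''.reg 30 rfl, r30]
      push_cast; rfl
    · rw [setReg_ne _ _ (by norm_num), hs₁, setReg_self, Finset.sum_range_zero]
    · intro i hi s'' hg'' hF'' h34 h33
      have e : (add (var 33) (mul
        (get 17 (add (mul (var 32) (add (var 0) (lit 1))) (var 34)))
        (get 18 (add (mul (var 32) (add (var 0) (lit 1))) (sub (var 30) (var 34)))))).eval s'' =
        ∑ i ∈ Finset.range (i + 1), l.foldl (layer 1) (slice i f) A *
          l.foldl (layer 1) (slice (r - i) g) A := by
        have hir : i ≤ r := by omega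
        simp only [Exp.eval, h34, h33]
        rw [hF''.reg 32 rfl, r32, hF''.reg 0 rfl, r0, hF''.reg 30 rfl, r30, hF''.mem 17 rfl,
          hF''.mem 18 rfl, hs₁, setReg_mem, hF.mem 17 rfl, hF.mem 18 rfl, Finset.sum_range_succ,
          h17 i hir j hj A hA hA1, ← Nat.cast_sub hir,
          h18 (r - i) (Nat.sub_le _ _) j hj A hA hA1]
      refine Reach.set hB rfl ?_ ?_
      · rw [e]
        exact (hpart (i + 1) hi A hA).trans_lt hlt
      · rw [e, setReg_ne _ _ (by norm_num), setReg_self]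
    · intro s₂ hg₂ hF₂ h33
      have e14 : (get 14 (var 32)).eval s₂ = code A := by
        simp only [Exp.eval]
        rw [hF₂.reg 32 rfl, r32, hF₂.mem 14 rfl, hs₁, setReg_mem, hF.mem 14 rfl, hA1]
      refine Reach.store hB rfl rfl (hg₂.reg 33) ?_
      rw [e14, Exp.eval, h33]
      intro S hS A' hA' hA1'
      rw [setReg_mem, setMem_same]
      split_ifs with h
      · rw [code_injective h]
      · rcases Nat.lt_or_eq_of_le (Nat.le_of_lt_succ hS) with hS | rfl
        · rw [hF₂.mem 16 rfl, hs₁, setReg_mem]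
          exact hI S hS A' hA' hA1'
        · exact absurd (hA1'.symm.trans hA1) h
  · have : 1 + ((2 + (r + 1) * (1 + 2)) + 1) + 2 ≤ 6 + (l.length + 1) * 3 := by omega
    have := Nat.mul_le_mul_left (2 ^ l.length) this
    omega
  · rintro s' - - hI A hA
    refine ⟨?_, hpart _ le_rfl A hA⟩
    obtain ⟨S, hS, hS'⟩ := hs.surj A hA
    exact hI S hS A hA hS'

/-- Only the sets of size `r` are written: for sets of other sizes, array 16 does not hold the
coefficient of the product. -/
theorem copySlice_spec (hBig : Big n t M B) {s : State}
    (hE : Env t G bl s) {l : List (Fin n)} (hs : Subsets l s) {p r : ℕ}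
    (h4 : s.reg 4 = p) (hp : p < t) (h30 : s.reg 30 = r) {h : Finset (Fin n) → ℤ}
    (hh : ∀ A ⊆ l.toFinset, s.mem 16 (code A) = h A) :
    Reach B copySlice s (2 + 2 ^ l.length * 5) fun s' =>
      (∀ A ⊆ l.toFinset, A.card = r → s'.mem 9 (code A * t + p) = h A) ∧
      ∀ z, (∀ A ⊆ l.toFinset, A.card = r → z ≠ code A * t + p) → s'.mem 9 z = s.mem 9 z := by
  have hB := hBig.one_le
  refine Reach.conseq (Reach.for (m := 1 + 2) hB (fun j s' => (∀ S : ℕ, S < j →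
      ∀ A ⊆ l.toFinset, s.mem 14 S = code A → A.card = r → s'.mem 9 (code A * t + p) = h A) ∧
      ∀ z, (∀ A ⊆ l.toFinset, A.card = r → z ≠ code A * t + p) → s'.mem 9 z = s.mem 9 z)
      rfl rfl (N := 2 ^ l.length) (hs.size_lt hBig) (fun s' hF => hs.size_eval hF rfl) ?_ ?_)
      le_rfl ?_
  · exact ⟨fun S hS => absurd hS (Nat.not_lt_zero _), fun _ _ => rfl⟩
  · rintro j hj s' hg hF h35 ⟨hI1, hI2⟩
    obtain ⟨A, hA, hA1, hA2⟩ := hs.sub j hj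
    have e15 : (get 15 (var 35)).eval s' = A.card := by
      simp only [Exp.eval, h35]
      rw [hF.mem 15 rfl, hA2]
    have e14 : (get 14 (var 35)).eval s' = code A := by
      simp only [Exp.eval, h35]
      rw [hF.mem 14 rfl, hA1]
    have e30 : (var 30).eval s' = r := by rw [Exp.eval, hF.reg 30 rfl, h30]
    refine Reach.ifEq hB rfl rfl le_rfl ?_ ?_
    · intro heq
      rw [e15, e30] at heq
      have e1 : (add (mul (get 14 (var 35)) (var 2)) (var 4)).eval s' = code A * t + p := by
        change (get 14 (var 35)).eval s' * s'.reg 2 + s'.reg 4 = _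
        rw [e14, hF.reg 2 rfl, hE.reg_t, hF.reg 4 rfl, h4]
      have e2 : (get 16 (get 14 (var 35))).eval s' = h A := by
        rw [Exp.eval, e14, hF.mem 16 rfl, hh A hA]
      refine Reach.store hB rfl rfl (hg.mem 16 (by norm_num) _) ?_
      rw [e1, e2]
      refine ⟨fun S hS A' hA' hA1' hr' => ?_, fun z hz => ?_⟩
      · rw [setReg_mem, setMem_same]
        split_ifs with hcode
        · have h' := (address_injective (t := t) (x := p) (x' := p) ⟨by omega, by omega⟩
              ⟨by omega, by omega⟩ hcode).1
          rw [code_injective h']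
        · rcases Nat.lt_or_eq_of_le (Nat.le_of_lt_succ hS) with hS | rfl
          · exact hI1 S hS A' hA' hA1' hr'
          · exact absurd (by rw [← hA1, ← hA1']) hcode
      · rw [setReg_mem, setMem_same, if_neg (hz A hA (by exact_mod_cast heq))]
        exact hI2 z hz
    · intro hne
      rw [e15, e30] at hne
      refine ⟨fun S hS A' hA' hA1' hr' => ?_, hI2⟩
      rcases Nat.lt_or_eq_of_le (Nat.le_of_lt_succ hS) with hS | rfl
      · exact hI1 S hS A' hA' hA1' hr'
      · rw [hA1] at hA1'
        rw [code_injective hA1'] at hne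
        exact absurd (by exact_mod_cast hr') hne
  · rintro s' - - ⟨h1, h2⟩
    refine ⟨fun A hA hr' => ?_, h2⟩
    obtain ⟨S, hS, hS'⟩ := hs.surj A hA
    exact h1 S hS A hA hS' hr'

end RAM

namespace RAM

open Exp Cmd

variable {n t B k : ℕ} {M : ℤ} {G : SimpleGraph (Fin n)} {bl : ℕ → List (Fin n)}

/-- A bound on the number of instructions in `transform`. -/
def transformTime (w : ℕ) : ℕ := 2 + w * (7 + 2 ^ w * 7)

/-- A bound on the number of instructions in `join`. -/
def joinTime (w : ℕ) : ℕ :=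
  1 + (listSetsTime w +
    ((2 + (w + 1) * (((6 + 2 ^ w * 10 + transformTime w) +
      (6 + 2 ^ w * 10 + transformTime w)) + 2)) +
    (2 + (w + 1) * (((2 + 2 ^ w * (6 + (w + 1) * 3)) +
      (transformTime w + (2 + 2 ^ w * 5))) + 2))))

theorem listSetsTime_mono {v w : ℕ} (h : v ≤ w) : listSetsTime v ≤ listSetsTime w := by
  unfold listSetsTime
  gcongr; norm_num

theorem joinTime_mono {v w : ℕ} (h : v ≤ w) : joinTime v ≤ joinTime w := by
  have := listSetsTime_mono h
  unfold joinTime transformTime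
  gcongr <;> norm_num

/-- The table of `p` may be overwritten size by size, since all slices of both factors have been
transformed into arrays 17 and 18 before. -/
theorem join_spec (hBig : Big n t M B) {s : State} (hE : Env t G bl s) {x p : ℕ}
    (hp : p < t) (h3 : s.reg 3 = x) (h4 : s.reg 4 = p) {Z : Finset (Fin n)}
    (hZ : ∀ u : Fin n, s.mem 10 (u : ℕ) = if u ∈ Z then 1 else 0) (hval : ValOK n s)
    (hnd : (bl p).Nodup) (hZp : ∀ v ∈ bl p, v ∉ Z) {w : ℕ} (hw : (bl p).length ≤ w)
    {f g : Finset (Fin n) → ℤ}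
    (hf : ∀ A ⊆ (bl p).toFinset, s.mem 9 (code A * t + x) = f A ∧ |f A| ≤ M)
    (hg : ∀ A ⊆ (bl p).toFinset, s.mem 9 (code A * t + p) = g A ∧ |g A| ≤ M) :
    Reach B join s (joinTime w) fun s' => ValOK n s' ∧
      (∀ A ⊆ (bl p).toFinset,
        s'.mem 9 (code A * t + p) = ∑ C ∈ A.powerset, f C * g (A \ C)) ∧
      ∀ z, (∀ A ⊆ (bl p).toFinset, z ≠ code A * t + p) → s'.mem 9 z = s.mem 9 z := by
  have hB := hBig.one_le
  refine Reach.conseq ?_ (joinTime_mono hw) (fun _ _ _ h => h)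
  set l := bl p with hl
  have hln : l.length ≤ n := by simpa using hnd.length_le_card
  refine Reach.with_good fun hgood => ?_
  refine Reach.seq_set hB rfl (hgood.reg 4) ?_
  simp only [Exp.eval, h4]
  set s₁ := s.setReg 9 (p : ℤ) with hs₁
  have hF₁ : Frame join s s₁ := by
    refine ⟨fun r hr => ?_, fun _ _ => rfl⟩
    simp only [join, Cmd.wr, Bool.or_eq_false_iff, beq_eq_false_iff_ne] at hr
    rw [hs₁, setReg_ne _ _ (Ne.symm hr.1)]
  have hE₁ := hE.frame hF₁ rfl
  refine Reach.seq (listSets_spec hBig hE₁ hp (by rw [hs₁, setReg_self]) (Z := Z)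
    (fun u _ => hZ u) hval hnd le_rfl) ?_
  rintro s₂ hg₂ hF₂ ⟨hs₂, hval₂⟩
  rw [List.filter_eq_self.2 (by simpa using hZp), ← hl] at hs₂
  have hE₂ := hE₁.frame hF₂ rfl
  have hN : ((l.length + 1 : ℕ) : ℤ) < 2 ^ B := by
    refine lt_of_le_of_lt ?_ (hBig.two_pow_lt (le_refl n))
    have : n < 2 ^ n := Nat.lt_two_pow_self
    exact_mod_cast (by omega : l.length + 1 ≤ 2 ^ n)
  have m9 : s₂.mem 9 = s.mem 9 := by rw [hF₂.mem 9 rfl, hs₁, setReg_mem]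
  have r3 : s₂.reg 3 = x := by rw [hF₂.reg 3 rfl, hF₁.reg 3 rfl, h3]
  have r4 : s₂.reg 4 = p := by rw [hF₂.reg 4 rfl, hF₁.reg 4 rfl, h4]
  refine Reach.seq (Reach.for hB (fun j s' => ∀ i < j, HasSlice n 17 l f i s' ∧
    HasSlice n 18 l g i s') rfl rfl (N := l.length + 1) hN ?_ ?_ ?_) ?_
  · intro s' hF
    simp only [Exp.eval]
    rw [hF.reg 12 rfl, hs₂.cnt]; push_cast; rfl
  · intro i hi
    exact absurd hi (Nat.not_lt_zero _)
  · intro j hj s' hg' hF h26 hI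
    have hjn : j ≤ n := by omega
    refine Reach.seq (sliceTransform_spec hBig (hE₂.frame hF rfl) (hs₂.frame hF rfl)
      (hval₂.frame hF rfl) (Or.inl rfl) (Or.inl rfl) (y := x) (by rw [hF.reg 3 rfl, r3]) h26 hjn
      (f := f) (by rw [hF.mem 9 rfl, m9]; exact hf)) ?_
    rintro s₃ hg₃ hF₃ ⟨h1, h2⟩
    refine Reach.conseq (sliceTransform_spec hBig ((hE₂.frame hF rfl).frame hF₃ rfl)
      ((hs₂.frame hF rfl).frame hF₃ rfl) ((hval₂.frame hF rfl).frame hF₃ rfl)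
      (Or.inr rfl) (Or.inr rfl) (y := p) (by rw [hF₃.reg 4 rfl, hF.reg 4 rfl, r4])
      (by rw [hF₃.reg 26 rfl, h26]) hjn
      (f := g) (by rw [hF₃.mem 9 rfl, hF.mem 9 rfl, m9]; exact hg)) le_rfl ?_
    rintro s₄ - hF₄ ⟨h5, h6⟩ i hi
    rcases Nat.lt_or_eq_of_le (Nat.le_of_lt_succ hi) with hi | rfl
    · have h7 := (h2 i (by omega) (by omega) f (hI i hi).1).congr
        (hF₄.mem 14 rfl) (hF₄.mem 17 rfl)
      have h8 := h6 i (by omega) (by omega) g ((hI i hi).2.congr (hF₃.mem 14 rfl) (hF₃.mem 18 rfl))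
      exact ⟨h7, h8⟩
    · exact ⟨h1.congr (hF₄.mem 14 rfl) (hF₄.mem 17 rfl), h5⟩
  · intro s₃ hg₃ hF₃ hsl
    have hE₃ := hE₂.frame hF₃ rfl
    have hs₃ := hs₂.frame hF₃ rfl
    have hval₃ := hval₂.frame hF₃ rfl
    refine Reach.conseq (Reach.for hB (fun j s' =>
      (∀ A ⊆ l.toFinset, A.card < j →
        s'.mem 9 (code A * t + p) = ∑ C ∈ A.powerset, f C * g (A \ C)) ∧
      ∀ z, (∀ A ⊆ l.toFinset, z ≠ code A * t + p) → s'.mem 9 z = s.mem 9 z)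
      rfl rfl (N := l.length + 1) hN ?_ ?_ ?_) le_rfl ?_
    · intro s' hF
      simp only [Exp.eval]
      rw [hF.reg 12 rfl, hs₃.cnt]; push_cast; rfl
    · refine ⟨fun A _ hA => absurd hA (Nat.not_lt_zero _), fun z _ => ?_⟩
      rw [setReg_mem, hF₃.mem 9 rfl, m9]
    · rintro j hj s' hg' hF h30 ⟨hI1, hI2⟩
      have hE' := hE₃.frame hF rfl
      have hs' := hs₃.frame hF rfl
      have hval' := hval₃.frame hF rfl
      refine Reach.seq (productSlice_spec hBig hE' hs' h30 (by omega)
        (fun A hA => (hf A hA).2) (fun A hA => (hg A hA).2)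
        (fun i hi => (hsl i (by omega)).1.congr (hF.mem 14 rfl) (hF.mem 17 rfl))
        (fun i hi => (hsl i (by omega)).2.congr (hF.mem 14 rfl) (hF.mem 18 rfl))) ?_
      intro s₄ hg₄ hF₄ h16
      refine Reach.seq (transform_spec hBig (σ := -1) (by norm_num) (hE'.frame hF₄ rfl)
        (hs'.frame hF₄ rfl) (hval'.frame hF₄ rfl) (K := (n + 1) * (2 ^ n * M) ^ 2)
        (by positivity) h16 ?_) ?_
      -- Two forward transforms and the inverse one each cost a factor `2 ^ n`, so `8 ^ n` arises,
      -- which is within the `16 ^ n` of `Big.table`.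
      · refine lt_of_le_of_lt (le_of_eq_of_le (b := ((n : ℤ) + 1) * (8 ^ n * M ^ 2)) ?_ ?_)
          hBig.table
        · have h8 : (8 : ℤ) ^ n = 2 ^ n * (2 ^ n * 2 ^ n) := by
            rw [← mul_pow, ← mul_pow]; norm_num
          rw [h8]; ring
        · gcongr; norm_num
      · intro s₅ hg₅ hF₅ h16'
        refine Reach.conseq (copySlice_spec hBig ((hE'.frame hF₄ rfl).frame hF₅ rfl)
          ((hs'.frame hF₄ rfl).frame hF₅ rfl) (p := p) ?_ hp (r := j) ?_ h16') le_rfl ?_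
        · rw [hF₅.reg 4 rfl, hF₄.reg 4 rfl, hF.reg 4 rfl, hF₃.reg 4 rfl, r4]
        · rw [hF₅.reg 30 rfl, hF₄.reg 30 rfl, h30]
        · rintro s₆ - - ⟨h1, h2⟩
          refine ⟨fun A hA hAj => ?_, fun z hz => ?_⟩
          · rw [setReg_mem]
            rcases Nat.lt_or_eq_of_le (Nat.le_of_lt_succ hAj) with hAj | hAj
            · rw [h2, hF₅.mem 9 rfl, hF₄.mem 9 rfl, hI1 A hA hAj]
              intro A' hA' hc h
              have h' := (address_injective (t := t) (x := p) (x' := p) ⟨by omega, by omega⟩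
                ⟨by omega, by omega⟩ h).1
              rw [code_injective h'] at hAj
              omega
            · rw [h1 A hA hAj]
              exact layer_convolution f g hnd hA hAj
          · rw [setReg_mem, h2 z fun A hA _ => hz A hA, hF₅.mem 9 rfl, hF₄.mem 9 rfl]
            exact hI2 z hz
    · rintro s₄ - hF₄ ⟨h1, h2⟩
      refine ⟨hval₃.frame hF₄ rfl, fun A hA => h1 A hA ?_, h2⟩
      have := Finset.card_le_card hA
      rw [List.toFinset_card_of_nodup hnd] at this
      omega

end RAM

/-! ### Merging a leaf into its neighbor -/

namespace RAM

open Exp Cmd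

variable {n t B k : ℕ} {M : ℤ} {G : SimpleGraph (Fin n)} {bl : ℕ → List (Fin n)}

/-- The node `x` is merged into the node `p`. -/
def merge : Cmd := seq forgetAll join

/-- The state of the computation when the nodes in `D` remain, and the vertices in `Z` are
eliminated: the tables of the nodes hold the coefficients of the polynomials `P y`. -/
structure DPInv (k t : ℕ) (G : SimpleGraph (Fin n)) (bl : ℕ → List (Fin n)) (s : State)
    (D : Finset ℕ) (Z : Finset (Fin n)) (P : ℕ → MvPolynomial (Fin n) ℤ) (b : ℕ → ℕ) :
    Prop where
  gone : ∀ u : Fin n, s.mem 10 (u : ℕ) = if u ∈ Z then 1 else 0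
  val : ValOK n s
  main : sqCoeff ((∏ y ∈ D, P y) * pmPoly G) Zᶜ = pmCount G Finset.univ
  tab : ∀ y ∈ D, ∀ A ⊆ Zᶜ, s.mem 9 (code A * t + y) = sqCoeff (P y) A
  supp : ∀ y ∈ D, ∀ A ⊆ Zᶜ, ¬ A ⊆ (bl y).toFinset → sqCoeff (P y) A = 0
  norm : ∀ y ∈ D, sqNorm Zᶜ (P y) ≤ (k + 1) ^ b y
  le_card : ∑ y ∈ D, b y ≤ Z.card
  mem_gone : ∀ v, v ∈ Z ↔ ∀ y ∈ D, v ∉ bl y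
  edge : ∀ u v, u ∉ Z → v ∉ Z → G.Adj u v → ∃ y ∈ D, u ∈ bl y ∧ v ∈ bl y

/-- Whenever `A` is distributed over the factors, one of them receives `v`. -/
theorem sqCoeff_prod_eq_zero {U : Finset (Fin n)} {E : Finset ℕ}
    {P : ℕ → MvPolynomial (Fin n) ℤ} {v : Fin n}
    (h : ∀ y ∈ E, ∀ A ⊆ U, v ∈ A → sqCoeff (P y) A = 0) :
    ∀ A ⊆ U, v ∈ A → sqCoeff (∏ y ∈ E, P y) A = 0 := by
  induction E using Finset.induction_on with
  | empty =>
    intro A _ hv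
    rw [Finset.prod_empty, sqCoeff_one, if_neg]
    rintro rfl
    simp at hv
  | insert y E hy ih =>
    intro A hA hv
    rw [Finset.prod_insert hy, sqCoeff_mul]
    refine Finset.sum_eq_zero fun C hC => ?_
    rw [Finset.mem_powerset] at hC
    by_cases hvC : v ∈ C
    · rw [h y (by simp) C (hC.trans hA) hvC, zero_mul]
    · rw [ih (fun z hz => h z (by simp [hz])) (A \ C) (Finset.sdiff_subset.trans hA)
        (Finset.mem_sdiff.2 ⟨hv, hvC⟩), mul_zero]

theorem DPInv.tableInv {s : State} {D : Finset ℕ} {Z : Finset (Fin n)}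
    {P : ℕ → MvPolynomial (Fin n) ℤ} {b : ℕ → ℕ} (h : DPInv k t G bl s D Z P b) {x : ℕ}
    (hx : x ∈ D) : TableInv k t G bl x (∏ y ∈ D.erase x, P y) s Z (P x) (b x) :=
  ⟨h.gone, h.val, by rw [Finset.mul_prod_erase D P hx]; exact h.main, h.tab x hx, h.supp x hx,
    h.norm x hx, (Finset.single_le_sum (fun _ _ => Nat.zero_le _) hx).trans h.le_card⟩

/-- By `hrip`, an eliminated vertex is in no other bag of `D`. So the other polynomials do not
involve it, and each remaining edge at it is covered by the bag of `x`. -/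
theorem DPInv.forgetAll {s : State} {D : Finset ℕ} {Z : Finset (Fin n)}
    {P : ℕ → MvPolynomial (Fin n) ℤ} {b : ℕ → ℕ} (h : DPInv k t G bl s D Z P b)
    (hBig : Big n t ((k + 1) ^ n) B) (hE : Env t G bl s)
    {x p : ℕ} (hx : x < t) (h3 : s.reg 3 = x) (h4 : s.reg 4 = p) (hxD : x ∈ D)
    (hnd : (bl x).Nodup) (hw : (bl x).length ≤ k + 1)
    (hrip : ∀ v ∈ bl x, v ∉ bl p → ∀ y ∈ D, y ≠ x → v ∉ bl y) :
    Reach B forgetAll s (forgetAllTime (k + 1)) fun s' =>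
      (∃ P' e, TableInv k t G bl x (∏ y ∈ D.erase x, P y) s'
        (Z ∪ ((bl x).filter (· ∉ bl p)).toFinset) P' (b x + e) ∧
        (Z ∪ ((bl x).filter (· ∉ bl p)).toFinset).card = Z.card + e) ∧
      ∀ z, (∀ A ⊆ (bl x).toFinset, z ≠ code A * t + x) → s'.mem 9 z = s.mem 9 z := by
  refine forgetAll_spec hBig hE hx h3 h4 (h.tableInv hxD) hnd ?_ hw ?_ ?_
  · intro v hv hvZ
    exact (h.mem_gone v).1 hvZ x hxD hv
  · intro v hv hvp
    refine sqCoeff_prod_eq_zero fun y hy A hA hvA => ?_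
    rw [Finset.mem_erase] at hy
    refine h.supp y hy.2 A hA fun hAy => ?_
    exact hrip v hv hvp y hy.2 hy.1 (by simpa using hAy hvA)
  · intro v hv hvp u hu huv
    have hvZ : v ∉ Z := fun hvZ => (h.mem_gone v).1 hvZ x hxD hv
    obtain ⟨y, hy, h1, h2⟩ := h.edge u v hu hvZ huv
    by_cases hyx : y = x
    · exact hyx ▸ h1
    · exact absurd h2 (hrip v hv hvp y hy hyx)

/-- A bound on the number of instructions in `merge`. -/
def mergeTime (w : ℕ) : ℕ := forgetAllTime w + joinTime w

/-- After the elimination, the polynomials of `x` and `p` are multiplied. The norm is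
submultiplicative, so their exponents add up, and their total still does not exceed the number of
eliminated vertices. -/
theorem DPInv.merge {s : State} {D : Finset ℕ} {Z : Finset (Fin n)}
    {P : ℕ → MvPolynomial (Fin n) ℤ} {b : ℕ → ℕ} (h : DPInv k t G bl s D Z P b)
    (hBig : Big n t ((k + 1) ^ n) B) (hE : Env t G bl s) (hDt : ∀ y ∈ D, y < t)
    {x p : ℕ} (h3 : s.reg 3 = x) (h4 : s.reg 4 = p) (hxD : x ∈ D) (hpD : p ∈ D) (hxp : x ≠ p)
    (hnd : ∀ y, (bl y).Nodup) (hw : ∀ y, (bl y).length ≤ k + 1)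
    (hrip : ∀ v ∈ bl x, v ∉ bl p → ∀ y ∈ D, y ≠ x → v ∉ bl y) :
    Reach B merge s (mergeTime (k + 1)) fun s' =>
      ∃ Z' P' b', DPInv k t G bl s' (D.erase x) Z' P' b' := by
  refine Reach.seq (h.forgetAll hBig hE (hDt x hxD) h3 h4 hxD (hnd x) (hw x) hrip) ?_
  rintro s₁ hg₁ hF₁ ⟨⟨P', e, hI, hcard⟩, hoth⟩
  set Z' := Z ∪ ((bl x).filter (· ∉ bl p)).toFinset with hZ'
  have hmemZ' : ∀ v, v ∈ Z' ↔ v ∈ Z ∨ (v ∈ bl x ∧ v ∉ bl p) := by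
    intro v; simp [hZ']
  have hsub : ∀ {A}, A ⊆ Z'ᶜ → A ⊆ Zᶜ := fun hA =>
    hA.trans (Finset.compl_subset_compl.2 Finset.subset_union_left)
  have hpD' : p ∈ D.erase x := Finset.mem_erase.2 ⟨hxp.symm, hpD⟩
  have hZp : ∀ v ∈ bl p, v ∉ Z' := by
    intro v hv hvZ
    rcases (hmemZ' v).1 hvZ with h' | h'
    · exact (h.mem_gone v).1 h' p hpD hv
    · exact h'.2 hv
  have hpZ : (bl p).toFinset ⊆ Z'ᶜ := by
    intro v hv
    exact Finset.mem_compl.2 (hZp v (by simpa using hv))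
  have haddr : ∀ {y y' : ℕ}, y ∈ D → y' ∈ D → ∀ {A A' : Finset (Fin n)},
      code A * t + y = code A' * t + y' → A = A' ∧ y = y' := by
    intro y y' hy hy' A A' heq
    have h1 := hDt y hy
    have h2 := hDt y' hy'
    have := address_injective (t := t) (x := y) (x' := y') ⟨by omega, by omega⟩
      ⟨by omega, by omega⟩ heq
    exact ⟨code_injective this.1, by omega⟩
  have htab : ∀ y ∈ D.erase x, ∀ A ⊆ Z'ᶜ, s₁.mem 9 (code A * t + y) = sqCoeff (P y) A := by
    intro y hy A hA
    rw [Finset.mem_erase] at hy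
    rw [hoth, h.tab y hy.2 A (hsub hA)]
    intro A' _ heq
    exact hy.1 (haddr hy.2 hxD heq).2
  have hbp : b x + e + b p ≤ Z'.card := by
    have h1 := h.le_card
    rw [← Finset.add_sum_erase D b hxD, ← Finset.add_sum_erase _ b hpD'] at h1
    omega
  have hbound : ∀ A ⊆ Z'ᶜ, |sqCoeff (P p) A| ≤ (k + 1) ^ n := by
    intro A hA
    refine (abs_sqCoeff_le (hsub hA) (P p)).trans ((h.norm p hpD).trans ?_)
    refine pow_le_pow_right₀ (by linarith [Nat.cast_nonneg (α := ℤ) k]) ?_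
    have := Finset.card_le_univ Z'
    rw [Fintype.card_fin] at this
    omega
  refine Reach.conseq (join_spec hBig (hE.frame hF₁ rfl) (hDt p hpD)
    (by rw [hF₁.reg 3 rfl, h3]) (by rw [hF₁.reg 4 rfl, h4]) hI.gone hI.val (hnd p) hZp (hw p)
    (fun A hA => ⟨hI.tab A (hA.trans hpZ), hI.bound (hA.trans hpZ)⟩)
    (fun A hA => ⟨htab p hpD' A (hA.trans hpZ), hbound A (hA.trans hpZ)⟩)) le_rfl ?_
  rintro s₂ - hF₂ ⟨hval₂, h9, hoth₂⟩
  -- A vertex of the bag of `x` that is not eliminated belongs to the bag of `p`, so the product is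
  -- supported in that bag.
  have hsupp : ∀ A ⊆ Z'ᶜ, ¬ A ⊆ (bl p).toFinset → sqCoeff (P' * P p) A = 0 := by
    intro A hA hAp
    rw [sqCoeff_mul]
    refine Finset.sum_eq_zero fun C hC => ?_
    rw [Finset.mem_powerset] at hC
    by_cases h1 : C ⊆ (bl x).toFinset
    · by_cases h2 : A \ C ⊆ (bl p).toFinset
      · exfalso
        apply hAp
        intro v hv
        by_cases hvC : v ∈ C
        · by_contra hvp
          have := hA hv
          rw [Finset.mem_compl, hmemZ'] at this
          exact this (Or.inr ⟨by simpa using h1 hvC, by simpa using hvp⟩)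
        · exact h2 (Finset.mem_sdiff.2 ⟨hv, hvC⟩)
      · rw [h.supp p hpD _ (Finset.sdiff_subset.trans (hsub hA)) h2, mul_zero]
    · rw [hI.supp C (hC.trans hA) h1, zero_mul]
  refine ⟨Z', Function.update P p (P' * P p), Function.update b p (b x + e + b p), ?_⟩
  constructor
  · rw [hF₂.mem 10 rfl]; exact hI.gone
  · exact hval₂
  · rw [← hI.main]
    congr 2
    rw [← Finset.mul_prod_erase _ _ hpD', ← Finset.mul_prod_erase _ P hpD',
      Function.update_self, ← mul_assoc]
    congr 1
    refine Finset.prod_congr rfl fun y hy => ?_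
    rw [Function.update_of_ne (Finset.ne_of_mem_erase hy)]
  · intro y hy A hA
    by_cases hyp : y = p
    · subst hyp
      rw [Function.update_self]
      by_cases hAp : A ⊆ (bl y).toFinset
      · rw [h9 A hAp, sqCoeff_mul]
      · rw [hsupp A hA hAp, hoth₂, htab y hy A hA, h.supp y hpD A (hsub hA) hAp]
        intro A' hA' heq
        exact hAp ((haddr hpD hpD heq).1 ▸ hA')
    · rw [Function.update_of_ne hyp, hoth₂, htab y hy A hA]
      intro A' hA' heq
      exact hyp (haddr (Finset.mem_of_mem_erase hy) hpD heq).2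
  · intro y hy A hA hAy
    by_cases hyp : y = p
    · subst hyp
      rw [Function.update_self]
      exact hsupp A hA hAy
    · rw [Function.update_of_ne hyp]
      exact h.supp y (Finset.mem_of_mem_erase hy) A (hsub hA) hAy
  · intro y hy
    by_cases hyp : y = p
    · subst hyp
      rw [Function.update_self, Function.update_self, pow_add]
      refine (sqNorm_mul_le _ _ _).trans (mul_le_mul hI.norm ?_ (sqNorm_nonneg _ _)
        (by positivity))
      exact (sqNorm_mono (hsub subset_rfl) _).trans (h.norm y hpD)
    · rw [Function.update_of_ne hyp, Function.update_of_ne hyp]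
      exact (sqNorm_mono (hsub subset_rfl) _).trans (h.norm y (Finset.mem_of_mem_erase hy))
  · have h1 := h.le_card
    rw [← Finset.add_sum_erase D b hxD, ← Finset.add_sum_erase _ b hpD'] at h1
    rw [← Finset.add_sum_erase _ _ hpD', Function.update_self]
    have h2 : ∑ y ∈ (D.erase x).erase p, Function.update b p (b x + e + b p) y =
        ∑ y ∈ (D.erase x).erase p, b y :=
      Finset.sum_congr rfl fun y hy => Function.update_of_ne (Finset.ne_of_mem_erase hy) _ b
    rw [h2]
    omega
  · intro v
    rw [hmemZ', h.mem_gone]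
    constructor
    · rintro (h1 | ⟨h1, h2⟩) y hy
      · exact h1 y (Finset.mem_of_mem_erase hy)
      · exact hrip v h1 h2 y (Finset.mem_of_mem_erase hy) (Finset.ne_of_mem_erase hy)
    · intro h1
      by_cases hvx : v ∈ bl x
      · exact Or.inr ⟨hvx, h1 p hpD'⟩
      · refine Or.inl fun y hy => ?_
        by_cases hyx : y = x
        · exact hyx ▸ hvx
        · exact h1 y (Finset.mem_erase.2 ⟨hyx, hy⟩)
  · intro u v hu hv huv
    rw [hmemZ', not_or, not_and_not_right] at hu hv
    obtain ⟨y, hy, h1, h2⟩ := h.edge u v hu.1 hv.1 huv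
    by_cases hyx : y = x
    · subst hyx
      exact ⟨p, hpD', hu.2 h1, hv.2 h2⟩
    · exact ⟨y, Finset.mem_erase.2 ⟨hyx, hy⟩, h1, h2⟩

/-- The number `t` plays the role of a parent with an empty bag, so that `forgetAll` eliminates
every vertex left. Then only the coefficient at the empty set remains, where `pmPoly G` and the
empty product are one. -/
theorem DPInv.finish {s : State} {Z : Finset (Fin n)} {x : ℕ}
    {P : ℕ → MvPolynomial (Fin n) ℤ} {b : ℕ → ℕ} (h : DPInv k t G bl s {x} Z P b)
    (hBig : Big n t ((k + 1) ^ n) B) (hE : Env t G bl s) (hx : x < t)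
    (h3 : s.reg 3 = x) (h4 : s.reg 4 = t) (hnd : (bl x).Nodup) (hw : (bl x).length ≤ k + 1)
    (ht : bl t = []) :
    Reach B RAM.forgetAll s (forgetAllTime (k + 1)) fun s' =>
      s'.mem 9 x = pmCount G Finset.univ := by
  refine Reach.conseq (h.forgetAll hBig hE hx h3 h4 (by simp) hnd hw (by simp)) le_rfl ?_
  rintro s₁ - - ⟨⟨P', e, hI, -⟩, -⟩
  have hZ : Z ∪ ((bl x).filter (· ∉ bl t)).toFinset = Finset.univ := by
    ext v
    simp only [ht, Finset.mem_union, List.mem_toFinset, List.mem_filter, List.not_mem_nil,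
      Finset.mem_univ, iff_true, h.mem_gone v]
    simp
    tauto
  rw [hZ] at hI
  have h1 := hI.main
  have h2 := hI.tab ∅ (by simp)
  rw [code_empty, zero_mul, zero_add] at h2
  rw [h2, ← h1]
  simp [sqCoeff_mul, pmPoly, sqCoeff_sqPoly, pmCount_empty]

end RAM

namespace RAM

open Exp Cmd

/-! ### Contracting a tree leaf by leaf -/

section Trees

variable {t : ℕ} {H : SimpleGraph (Fin t)} {D : Finset ℕ} {x p : ℕ}

/-- Adjacency of nodes that are given by their numbers. -/
def NodeAdj (H : SimpleGraph (Fin t)) (y z : ℕ) : Prop :=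
  ∃ (hy : y < t) (hz : z < t), H.Adj ⟨y, hy⟩ ⟨z, hz⟩

theorem NodeAdj.symm {y z : ℕ} (h : NodeAdj H y z) : NodeAdj H z y := by
  obtain ⟨hy, hz, h⟩ := h
  exact ⟨hz, hy, h.symm⟩

theorem NodeAdj.ne {y z : ℕ} (h : NodeAdj H y z) : y ≠ z := by
  obtain ⟨hy, hz, h⟩ := h
  exact fun e => h.ne (Fin.ext e)

open Classical in
/-- The neighbors of a node among the nodes in `D`. -/
noncomputable def nbrs (H : SimpleGraph (Fin t)) (D : Finset ℕ) (y : ℕ) : Finset ℕ :=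
  D.filter (NodeAdj H y)

theorem mem_nbrs {y z : ℕ} : z ∈ nbrs H D y ↔ z ∈ D ∧ NodeAdj H y z := by
  simp [nbrs]

/-- The nodes in `D` induce a connected subgraph. -/
def Conn (H : SimpleGraph (Fin t)) (D : Finset ℕ) : Prop :=
  ∀ y ∈ D, ∀ z ∈ D,
    Relation.ReflTransGen (fun a b => NodeAdj H a b ∧ a ∈ D ∧ b ∈ D) y z

/-- A walk can enter and leave the leaf `x` only through `p`, so visits to `x` may be cut out. -/
theorem Conn.erase (h : Conn H D) (hx : nbrs H D x = {p}) : Conn H (D.erase x) := by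
  intro y hy z hz
  rw [Finset.mem_erase] at hy hz
  have hpD : p ∈ D ∧ NodeAdj H x p := mem_nbrs.1 (hx ▸ Finset.mem_singleton_self p)
  have huniq : ∀ w ∈ D, NodeAdj H x w → w = p := fun w hw hwx =>
    Finset.mem_singleton.1 (hx ▸ mem_nbrs.2 ⟨hw, hwx⟩)
  -- While the walk stands at `x`, the shortened walk waits at `p`.
  have key : ∀ w, Relation.ReflTransGen (fun a b => NodeAdj H a b ∧ a ∈ D ∧ b ∈ D) y w →
      (w ≠ x → Relation.ReflTransGen
        (fun a b => NodeAdj H a b ∧ a ∈ D.erase x ∧ b ∈ D.erase x) y w) ∧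
      (w = x → Relation.ReflTransGen
        (fun a b => NodeAdj H a b ∧ a ∈ D.erase x ∧ b ∈ D.erase x) y p) := by
    intro w hw
    induction hw with
    | refl => exact ⟨fun _ => .refl, fun e => absurd e hy.1⟩
    | @tail w w' _ hww ih =>
      obtain ⟨ha, hw, hw'⟩ := hww
      refine ⟨fun hne => ?_, fun e => ?_⟩
      · by_cases hwx : w = x
        · rw [huniq w' hw' (hwx ▸ ha)]
          exact ih.2 hwx
        · exact (ih.1 hwx).tail ⟨ha, Finset.mem_erase.2 ⟨hwx, hw⟩, Finset.mem_erase.2 ⟨hne, hw'⟩⟩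
      · subst e
        rw [← huniq w hw ha.symm]
        exact ih.1 ha.ne
  exact (key z (h y hy.2 z hz.2)).1 hz.1

theorem Conn.exists_walk (h : Conn H (D.erase x)) (hD : ∀ y ∈ D, y < t) (hp : p ∈ D) (hpx : p ≠ x)
    {y : ℕ} (hy : y ∈ D) (hyx : y ≠ x) (hxt : x < t) :
    ∃ w : H.Walk ⟨p, hD p hp⟩ ⟨y, hD y hy⟩, (⟨x, hxt⟩ : Fin t) ∉ w.support := by
  have h1 := h p (Finset.mem_erase.2 ⟨hpx, hp⟩) y (Finset.mem_erase.2 ⟨hyx, hy⟩)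
  have key : ∀ z, Relation.ReflTransGen
        (fun a b => NodeAdj H a b ∧ a ∈ D.erase x ∧ b ∈ D.erase x) p z → ∀ hz : z < t,
      ∃ w : H.Walk ⟨p, hD p hp⟩ ⟨z, hz⟩, (⟨x, hxt⟩ : Fin t) ∉ w.support := by
    intro z hz
    induction hz with
    | refl =>
      intro hz
      refine ⟨.nil, ?_⟩
      simpa using hpx.symm
    | @tail z z' _ hzz ih =>
      intro hz'
      obtain ⟨⟨hz, _, ha⟩, -, h3⟩ := hzz
      obtain ⟨w, hw⟩ := ih hz
      refine ⟨w.concat ha, ?_⟩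
      rw [SimpleGraph.Walk.support_concat]
      simp only [List.mem_append, List.mem_singleton, Fin.mk.injEq, not_or]
      exact ⟨hw, (Finset.ne_of_mem_erase h3).symm⟩
  exact key y h1 (hD y hy)

/-- The remaining nodes other than `x` are connected, so a path from `p` to `y` avoids `x`; preceded
by `x` it is a path of the tree through `p`. -/
theorem bag_of_leaf {V : Type*} {G : SimpleGraph V} (T : TreeDecomposition G (Fin t))
    (h : Conn T.tree D) (hD : ∀ y ∈ D, y < t) (hxD : x ∈ D) (hx : nbrs T.tree D x = {p}) {y : ℕ}
    (hy : y ∈ D) (hyx : y ≠ x) {hpt : p < t} {v : V} (hvx : v ∈ T.bag ⟨x, hD x hxD⟩)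
    (hvy : v ∈ T.bag ⟨y, hD y hy⟩) : v ∈ T.bag ⟨p, hpt⟩ := by
  classical
  obtain ⟨hpD, hxt, _, ha⟩ := mem_nbrs.1 (hx ▸ Finset.mem_singleton_self p)
  have hpx : p ≠ x := fun e => ha.ne (Fin.ext e.symm)
  obtain ⟨w, hw⟩ := (h.erase hx).exists_walk hD hpD hpx hy hyx hxt
  refine T.path_mem _ _ (.cons ha w.bypass) ?_ _ (by simp) v hvx hvy
  rw [SimpleGraph.Walk.cons_isPath_iff]
  exact ⟨w.bypass_isPath, fun hmem => hw (w.support_bypass_subset_support hmem)⟩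

/-- The nodes in `D` induce a tree, and a tree with at least two nodes has a leaf. -/
theorem Conn.eq_singleton (hH : H.IsTree) (h : Conn H D) (hD : ∀ y ∈ D, y < t) (hx : x ∈ D)
    (hleaf : ∀ y ∈ D, (nbrs H D y).card ≠ 1) : D = {x} := by
  classical
  by_contra hne
  set S : Set (Fin t) := {y | (y : ℕ) ∈ D}
  have hpre : (H.induce S).Preconnected := by
    rintro ⟨⟨y, hy⟩, hyD⟩ ⟨⟨z, hz⟩, hzD⟩
    have key : ∀ w, Relation.ReflTransGen (fun a b => NodeAdj H a b ∧ a ∈ D ∧ b ∈ D) y w →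
        ∀ (hw : w < t) (hwD : w ∈ D), (H.induce S).Reachable ⟨⟨y, hy⟩, hyD⟩ ⟨⟨w, hw⟩, hwD⟩ := by
      intro w hw
      induction hw with
      | refl => exact fun _ _ => .refl _
      | @tail w w' _ hww ih =>
        intro hw' hwD'
        obtain ⟨⟨hw, _, ha⟩, hwD, -⟩ := hww
        refine (ih hw hwD).trans (SimpleGraph.Adj.reachable ?_)
        simpa using ha
    exact key z (h y hyD z hzD) hz hzD
  have : Nonempty S := ⟨⟨⟨x, hD x hx⟩, hx⟩⟩
  have hconn : (H.induce S).IsTree :=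
    ⟨⟨hpre⟩, hH.isAcyclic.induce S⟩
  obtain ⟨y, hyD, hyx⟩ : ∃ y ∈ D, y ≠ x := by
    by_contra hcon
    push Not at hcon
    exact hne (Finset.eq_singleton_iff_unique_mem.2 ⟨hx, hcon⟩)
  have : Nontrivial S :=
    ⟨⟨⟨⟨x, hD x hx⟩, hx⟩, ⟨⟨y, hD y hyD⟩, hyD⟩, fun e => hyx (by simpa using e.symm)⟩⟩
  obtain ⟨⟨⟨z, hz⟩, hzD⟩, hdeg⟩ := hconn.exists_vert_degree_one_of_nontrivial
  rw [SimpleGraph.degree_eq_one_iff_existsUnique_adj] at hdeg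
  obtain ⟨⟨⟨w, hw⟩, hwD⟩, hzw, huniq⟩ := hdeg
  refine hleaf z hzD (Finset.card_eq_one.2 ⟨w, Finset.eq_singleton_iff_unique_mem.2 ⟨?_, ?_⟩⟩)
  · exact mem_nbrs.2 ⟨hwD, hz, hw, by simpa using hzw⟩
  · intro w' hw'
    obtain ⟨hwD', _, hw't, ha⟩ := mem_nbrs.1 hw'
    have := huniq ⟨⟨w', hw't⟩, hwD'⟩ (by simpa using ha)
    simpa using this

theorem nbrs_erase (y : ℕ) : nbrs H (D.erase x) y = (nbrs H D y).erase x := by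
  ext z
  simp only [mem_nbrs, Finset.mem_erase]
  tauto

end Trees

end RAM

namespace RAM

open Exp Cmd

variable {n t B k : ℕ} {G : SimpleGraph (Fin n)} {bl : ℕ → List (Fin n)}

/-! ### The main loop -/

/-- Array 7 holds the numbers of neighbors of the nodes in `D`, and array 8 the sums of the numbers
of these neighbors. -/
structure TreeInv (H : SimpleGraph (Fin t)) (s : State) (D : Finset ℕ) : Prop where
  lt : ∀ y ∈ D, y < t
  conn : Conn H D
  deg : ∀ y < t, s.mem 7 y = if y ∈ D then ((nbrs H D y).card : ℤ) else 0
  nbsum : ∀ y ∈ D, s.mem 8 y = ∑ z ∈ nbrs H D y, (z : ℤ)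

theorem DPInv.congr {s s' : State} {D : Finset ℕ} {Z : Finset (Fin n)}
    {P : ℕ → MvPolynomial (Fin n) ℤ} {b : ℕ → ℕ} (h : DPInv k t G bl s D Z P b)
    (h9 : s'.mem 9 = s.mem 9) (h10 : s'.mem 10 = s.mem 10) (h23 : s'.mem 23 = s.mem 23) :
    DPInv k t G bl s' D Z P b :=
  ⟨h10 ▸ h.gone, by rw [ValOK, h23]; exact h.val, h.main, h9 ▸ h.tab, h.supp, h.norm, h.le_card,
    h.mem_gone, h.edge⟩

/-- The leaf `x` of the remaining tree is merged into its neighbor. -/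
def mergeLeaf : Cmd :=
  seq (set 4 (get 8 (var 3))) <| seq merge <| seq (store 7 (var 3) (lit 0)) <|
  seq (store 7 (var 4) (sub (get 7 (var 4)) (lit 1))) <|
  seq (store 8 (var 4) (sub (get 8 (var 4)) (var 3))) <| seq (set 6 (var 4)) (set 3 (var 4))

/-- Sums of node numbers are stored in array 8; this bound is the reason for `Big.sq`. -/
theorem TreeInv.sum_le {H : SimpleGraph (Fin t)} {s : State} {D : Finset ℕ} (h : TreeInv H s D)
    {N : Finset ℕ} (hN : N ⊆ D) : N.card ≤ t ∧ ∑ z ∈ N, z ≤ t * t := by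
  have h1 : N ⊆ Finset.range t := fun z hz => Finset.mem_range.2 (h.lt z (hN hz))
  have h2 : N.card ≤ t := by simpa using Finset.card_le_card h1
  refine ⟨h2, (Finset.sum_le_card_nsmul _ _ t fun z hz => (h.lt z (hN hz)).le).trans ?_⟩
  rw [smul_eq_mul]
  exact Nat.mul_le_mul_right _ h2

theorem Big.cast_lt_of_le_sq {M : ℤ} (h : Big n t M B) {w : ℕ} (hw : w ≤ t * t) :
    |(w : ℤ)| < 2 ^ B := by
  have h1 := h.sq
  have h2 : (w : ℤ) ≤ t * t := by exact_mod_cast hw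
  rw [abs_of_nonneg (by positivity)]
  nlinarith

/-- The sum of the neighbors of a leaf is its only neighbor, so no adjacency lists are needed. The
degree of a removed node is set to zero, and only the entries of `p` change besides. -/
theorem mergeLeaf_spec {T : TreeDecomposition G (Fin t)}
    (hbl : ∀ (y : ℕ) (hy : y < t) (v : Fin n), v ∈ bl y ↔ v ∈ T.bag ⟨y, hy⟩)
    (hnd : ∀ y, (bl y).Nodup) (hw : ∀ y, (bl y).length ≤ k + 1)
    (hBig : Big n t ((k + 1) ^ n) B) {s : State} (hE : Env t G bl s)
    {D : Finset ℕ} {Z : Finset (Fin n)} {P : ℕ → MvPolynomial (Fin n) ℤ} {b : ℕ → ℕ}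
    (hI : DPInv k t G bl s D Z P b) (hT : TreeInv T.tree s D)
    {x : ℕ} (h3 : s.reg 3 = x) (hxD : x ∈ D) (hx : (nbrs T.tree D x).card = 1) :
    Reach B mergeLeaf s (mergeTime (k + 1) + 6) fun s' =>
      ∃ p Z' P' b', nbrs T.tree D x = {p} ∧ p ∈ D.erase x ∧ s'.reg 3 = p ∧ s'.reg 6 = p ∧
        DPInv k t G bl s' (D.erase x) Z' P' b' ∧ TreeInv T.tree s' (D.erase x) := by
  have hB := hBig.one_le
  obtain ⟨p, hxp⟩ := Finset.card_eq_one.1 hx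
  obtain ⟨hpD, hadj⟩ := mem_nbrs.1 (hxp ▸ Finset.mem_singleton_self p)
  have hpx : p ≠ x := hadj.ne.symm
  have hpE : p ∈ D.erase x := Finset.mem_erase.2 ⟨hpx, hpD⟩
  have hpt : p < t := hT.lt p hpD
  have hxt : x < t := hT.lt x hxD
  have hpp : p ≤ t * t := hpt.le.trans (Nat.le_mul_self t)
  have h8 : s.mem 8 x = p := by rw [hT.nbsum x hxD, hxp]; simp
  have hxN : x ∈ nbrs T.tree D p := mem_nbrs.2 ⟨hxD, hadj.symm⟩
  have hnb : ∀ y ∈ D, y ≠ p → nbrs T.tree (D.erase x) y = nbrs T.tree D y := by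
    intro y hy hyp
    rw [nbrs_erase, Finset.erase_eq_of_notMem]
    intro h
    have : y ∈ nbrs T.tree D x := mem_nbrs.2 ⟨hy, (mem_nbrs.1 h).2.symm⟩
    rw [hxp, Finset.mem_singleton] at this
    exact hyp this
  have hsub : nbrs T.tree (D.erase x) p ⊆ D := fun z hz =>
    Finset.mem_of_mem_erase (mem_nbrs.1 hz).1
  have hcard : ((nbrs T.tree (D.erase x) p).card : ℤ) = (nbrs T.tree D p).card - 1 := by
    rw [nbrs_erase, Finset.card_erase_of_mem hxN]
    have := Finset.card_pos.2 ⟨x, hxN⟩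
    omega
  have hsum : ((∑ z ∈ nbrs T.tree (D.erase x) p, z : ℕ) : ℤ) =
      ∑ z ∈ nbrs T.tree D p, (z : ℤ) - x := by
    rw [nbrs_erase, ← Finset.add_sum_erase _ _ hxN]
    push_cast
    ring
  have hle := hT.sum_le hsub
  refine Reach.conseq (m := 1 + (mergeTime (k + 1) + (1 + (1 + (1 + (1 + 1)))))) ?_ (by omega)
    (fun _ _ _ h => h)
  have e0 : (get 8 (var 3)).eval s = p := by simp [Exp.eval, h3, h8]
  refine Reach.seq_set hB rfl (by rw [e0]; exact hBig.cast_lt_of_le_sq hpp) ?_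
  rw [e0]
  have hE₁ : Env t G bl (s.setReg 4 p) := hE.frame (c := set 4 (lit 0))
    ⟨fun r hr => setReg_ne _ _ (by simp only [Cmd.wr, beq_eq_false_iff_ne] at hr; exact hr.symm),
      fun _ _ => rfl⟩ rfl
  refine Reach.seq (DPInv.merge (hI.congr (s' := s.setReg 4 p) rfl rfl rfl) hBig hE₁
    (p := p) hT.lt (by rw [setReg_ne _ _ (by norm_num), h3]) (by simp) hxD hpD hpx.symm hnd hw ?_) ?_
  · intro v hv hvp y hy hyx hvy
    rw [hbl _ hxt] at hv
    rw [hbl _ (hT.lt y hy)] at hvy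
    rw [hbl _ hpt] at hvp
    exact hvp (bag_of_leaf T hT.conn hT.lt hxD hxp hy hyx hv hvy)
  · rintro s₁ - hF₁ ⟨Z', P', b', hI'⟩
    have a3 : s₁.reg 3 = x := by
      rw [hF₁.reg 3 rfl, setReg_ne _ _ (by norm_num), h3]
    have a4 : s₁.reg 4 = p := by rw [hF₁.reg 4 rfl]; simp
    have a7 : s₁.mem 7 = s.mem 7 := by rw [hF₁.mem 7 rfl]; simp
    have a8 : s₁.mem 8 = s.mem 8 := by rw [hF₁.mem 8 rfl]; simp
    have hpx' : (p : ℤ) ≠ x := by exact_mod_cast hpx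
    refine Reach.seq_store hB rfl rfl (by simp [Exp.eval]) ?_
    refine Reach.seq_store hB rfl rfl ?_ (Reach.seq_store hB rfl rfl ?_
      (Reach.seq_set hB rfl ?_ (Reach.set hB rfl ?_ ?_)))
    · simp [Exp.eval, a3, a4, a7, hpx', hT.deg p hpt, hpD]
      rw [← hcard]
      exact hBig.cast_lt_of_le_sq (hle.1.trans (Nat.le_mul_self t))
    · simp [Exp.eval, a3, a4, a8, setMem_apply, hT.nbsum p hpD]
      rw [← hsum]
      exact hBig.cast_lt_of_le_sq hle.2
    · simpa [Exp.eval, a4] using hBig.cast_lt_of_le_sq hpp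
    · simpa [Exp.eval, a4, setReg_reg] using hBig.cast_lt_of_le_sq hpp
    · refine ⟨p, Z', P', b', hxp, hpE, ?_, ?_, hI'.congr ?_ ?_ ?_, ?_⟩
      · simp [Exp.eval, a4, setReg_reg]
      · simp [Exp.eval, a4, setReg_reg]
      · funext z; simp [setMem_apply]
      · funext z; simp [setMem_apply]
      · funext z; simp [setMem_apply]
      · constructor
        · exact fun y hy => hT.lt y (Finset.mem_of_mem_erase hy)
        · exact hT.conn.erase hxp
        · intro y hy
          simp only [Exp.eval, a3, a4, a7, setMem_apply, setReg_mem, setMem_reg, hT.deg y hy,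
            hT.deg p hpt, hpD, Finset.mem_erase, Nat.cast_inj]
          by_cases hyp : y = p
          · subst hyp
            simp [hpx, hpD, hcard]
          · by_cases hyx : y = x
            · simp [hyx, hpx.symm]
            · by_cases hyD : y ∈ D
              · simp [hyp, hyx, hyD, hnb y hyD hyp]
              · simp [hyp, hyx, hyD]
        · intro y hy
          simp only [Exp.eval, a3, a4, a8, setMem_apply, setReg_mem, setMem_reg,
            hT.nbsum p hpD, hT.nbsum y (Finset.mem_of_mem_erase hy), Nat.cast_inj]
          by_cases hyp : y = p
          · subst hyp
            simp [← hsum]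
          · simp [hyp, hnb y (Finset.mem_of_mem_erase hy) hyp]

/-- The loop goes on with the next node. -/
def nextNode : Cmd := seq (set 5 (add (var 5) (lit 1))) (set 3 (var 5))

/-- All leaves of the tree are merged into their neighbors, until one node remains. -/
def treeLoop : Cmd :=
  loop (var 5) (var 2)
    (ite (get 7 (var 3)) (lit 1) nextNode (ite (lit 1) (get 7 (var 3)) nextNode mergeLeaf))

/-- The invariant of the main loop, when it has arrived at the node `i` and has `μ` rounds left. -/
structure LoopInv {T : TreeDecomposition G (Fin t)} (k i x r : ℕ)
    (bl : ℕ → List (Fin n)) (s : State) (D : Finset ℕ) : Prop where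
  env : Env t G bl s
  dp : ∃ Z P b, DPInv k t G bl s D Z P b
  tree : TreeInv T.tree s D
  le : i ≤ t
  reg_i : s.reg 5 = i
  reg_x : s.reg 3 = x
  reg_r : s.reg 6 = r
  root : r ∈ D
  pos : x = i ∨ x ∈ D ∧ i ∉ D ∧ i < t
  done : ∀ y ∈ D, y ≤ i → y ≠ x → (nbrs T.tree D y).card ≠ 1

theorem nextNode_spec {T : TreeDecomposition G (Fin t)} (hBig : Big n t ((k + 1) ^ n) B)
    {s : State} {D : Finset ℕ} {i x r : ℕ} (h : LoopInv (T := T) k i x r bl s D) (hi : i < t)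
    (hx : x ∈ D → (nbrs T.tree D x).card ≠ 1) :
    Reach B nextNode s 2 fun s' => LoopInv (T := T) k (i + 1) (i + 1) r bl s' D := by
  have hB := hBig.one_le
  have hlt : |(i : ℤ) + 1| < 2 ^ B := by
    exact_mod_cast hBig.cast_lt_of_le_sq ((Nat.succ_le_of_lt hi).trans (Nat.le_mul_self t))
  have hF : Frame nextNode s ((s.setReg 5 (i + 1)).setReg 3 (i + 1)) :=
    ⟨fun q hq => by
      simp only [nextNode, Cmd.wr, Bool.or_eq_false_iff, beq_eq_false_iff_ne] at hq
      rw [setReg_ne _ _ hq.2.symm, setReg_ne _ _ hq.1.symm], fun _ _ => rfl⟩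
  refine Reach.seq_set (m := 1) hB rfl (by simpa [Exp.eval, h.reg_i] using hlt)
    (Reach.set hB rfl (by simpa [Exp.eval, h.reg_i] using hlt) ?_)
  simp only [Exp.eval, h.reg_i, setReg_self]
  obtain ⟨Z, P, b, hI⟩ := h.dp
  refine ⟨h.env.frame hF rfl, ⟨Z, P, b, hI.congr rfl rfl rfl⟩,
    ⟨h.tree.lt, h.tree.conn, h.tree.deg, h.tree.nbsum⟩, hi, ?_, ?_, ?_, h.root, .inl rfl, ?_⟩
  · simp [setReg_reg]
  · simp
  · simp [setReg_reg, h.reg_r]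
  · intro y hy hyi hyne
    by_cases hyx : y = x
    · exact hyx ▸ hx (hyx ▸ hy)
    · exact h.done y hy (by omega) hyx

/-- When a leaf is merged, its neighbor is the only node that can become a leaf, and it is examined
at once, while the position `i` stays. So the nodes already passed contain no leaf. A round either
advances `i` or removes a node, so `t - i` plus the number of remaining nodes, initially `2 * t`,
counts the rounds down. -/
theorem treeLoop_spec {T : TreeDecomposition G (Fin t)}
    (hbl : ∀ (y : ℕ) (hy : y < t) (v : Fin n), v ∈ bl y ↔ v ∈ T.bag ⟨y, hy⟩)
    (hnd : ∀ y, (bl y).Nodup) (hw : ∀ y, (bl y).length ≤ k + 1)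
    (hBig : Big n t ((k + 1) ^ n) B) {s : State}
    (h : LoopInv (T := T) k 0 0 0 bl s (Finset.range t)) :
    Reach B treeLoop s (1 + 2 * t * (mergeTime (k + 1) + 9)) fun s' =>
      ∃ r < t, s'.reg 6 = r ∧ Env t G bl s' ∧ ∃ Z P b, DPInv k t G bl s' {r} Z P b := by
  have hB := hBig.one_le
  refine Reach.conseq (Reach.loop (m := mergeTime (k + 1) + 8) hB rfl rfl
    (fun μ s' => ∃ i x r D, LoopInv (T := T) k i x r bl s' D ∧ (t - i) + D.card = μ) ?_ (2 * t)
    ⟨0, 0, 0, _, h, by simp; omega⟩) le_rfl ?_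
  · rintro μ s₁ - - ⟨i, x, r, D, hL, rfl⟩ htest
    simp only [Exp.eval, hL.reg_i, hL.env.reg_t, Nat.cast_lt] at htest
    have hxt : x < t := by
      rcases hL.pos with h | h
      · omega
      · exact hL.tree.lt x h.1
    have hdeg := hL.tree.deg x hxt
    have hcard : 0 < D.card := Finset.card_pos.2 ⟨_, hL.root⟩
    refine ⟨t - (i + 1) + D.card, by omega, ?_⟩
    have hnext : ((x ∈ D → (nbrs T.tree D x).card ≠ 1)) →
        Reach B nextNode s₁ 2 (fun s' => ∃ i' x r D', LoopInv (T := T) k i' x r bl s' D' ∧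
          (t - i') + D'.card = t - (i + 1) + D.card) := fun hx =>
      Reach.conseq (nextNode_spec hBig hL htest hx) le_rfl
        fun s' _ _ h => ⟨_, _, _, _, h, rfl⟩
    have hlow : ¬ s₁.mem 7 x = 1 → x ∈ D → (nbrs T.tree D x).card ≠ 1 := by
      intro h1 hxD h2
      rw [hdeg, if_pos hxD, h2] at h1
      exact h1 rfl
    refine Reach.ite' (m := mergeTime (k + 1) + 7) hB rfl rfl (fun hc => ?_) (fun hc => ?_)
    · refine Reach.conseq (hnext (hlow ?_)) (by omega) (fun _ _ _ h => h)
      simp only [Exp.eval, hL.reg_x] at hc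
      exact hc.ne
    · refine Reach.ite' (m := mergeTime (k + 1) + 6) hB rfl rfl (fun hc' => ?_) (fun hc' => ?_)
      · refine Reach.conseq (hnext (hlow ?_)) (by omega) (fun _ _ _ h => h)
        simp only [Exp.eval, hL.reg_x] at hc'
        exact hc'.ne'
      · simp only [Exp.eval, hL.reg_x] at hc hc'
        have h1 : s₁.mem 7 x = 1 := by omega
        rw [h1] at hdeg
        have hxD : x ∈ D := by
          by_contra hxD
          simp [hxD] at hdeg
        rw [if_pos hxD] at hdeg
        have hx1 : (nbrs T.tree D x).card = 1 := by exact_mod_cast hdeg.symm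
        obtain ⟨Z, P, b, hI⟩ := hL.dp
        refine Reach.conseq (mergeLeaf_spec hbl hnd hw hBig hL.env hI hL.tree hL.reg_x hxD hx1)
          le_rfl ?_
        rintro s' - hF ⟨p, Z', P', b', hxp, hpE, h3, h6, hI', hT'⟩
        refine ⟨i, p, p, D.erase x, ⟨hL.env.frame hF rfl, ⟨Z', P', b', hI'⟩, hT', hL.le,
          (hF.reg 5 rfl).trans hL.reg_i, h3, h6, hpE, .inr ⟨hpE, ?_, htest⟩, ?_⟩, ?_⟩
        · rcases hL.pos with h | h
          · simp [h]
          · exact fun hi => h.2.1 (Finset.mem_of_mem_erase hi)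
        · intro y hy hyi hyp
          have hyx := Finset.ne_of_mem_erase hy
          have hyD := Finset.mem_of_mem_erase hy
          rw [nbrs_erase, Finset.erase_eq_of_notMem]
          · exact hL.done y hyD hyi hyx
          · intro hmem
            have : y ∈ nbrs T.tree D x := mem_nbrs.2 ⟨hyD, (mem_nbrs.1 hmem).2.symm⟩
            rw [hxp, Finset.mem_singleton] at this
            exact hyp this
        · rw [Finset.card_erase_of_mem hxD]
          omega
  · rintro s' - - ⟨⟨_, i, x, r, D, hL, -⟩, htest⟩
    simp only [Exp.eval, hL.reg_i, hL.env.reg_t, Nat.cast_lt] at htest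
    have hi : i = t := le_antisymm hL.le (not_lt.1 htest)
    have hx : x = t := by
      rcases hL.pos with h | h <;> omega
    have hD : D = {r} := hL.tree.conn.eq_singleton T.isTree hL.tree.lt hL.root fun y hy =>
      hL.done y hy (hi ▸ (hL.tree.lt y hy).le) (hx ▸ (hL.tree.lt y hy).ne)
    exact ⟨r, hL.tree.lt r hL.root, hL.reg_r, hL.env, hD ▸ hL.dp⟩

/-- The number of perfect matchings is computed from the prepared data. -/
def dynamicProgram : Cmd :=
  seq (set 5 (lit 0)) <| seq (set 3 (lit 0)) <| seq (set 6 (lit 0)) <| seq treeLoop <|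
  seq (set 3 (var 6)) <| seq (set 4 (var 2)) <| seq forgetAll <| set 0 (get 9 (var 6))

/-- A bound on the number of instructions in `dynamicProgram`. -/
def dynamicProgramTime (t w : ℕ) : ℕ :=
  7 + 2 * t * (mergeTime w + 9) + forgetAllTime w

theorem dynamicProgram_spec {T : TreeDecomposition G (Fin t)} (ht : 1 ≤ t)
    (hbl : ∀ (y : ℕ) (hy : y < t) (v : Fin n), v ∈ bl y ↔ v ∈ T.bag ⟨y, hy⟩) (hblt : bl t = [])
    (hnd : ∀ y, (bl y).Nodup) (hw : ∀ y, (bl y).length ≤ k + 1)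
    (hBig : Big n t ((k + 1) ^ n) B) {s : State} (hE : Env t G bl s)
    {Z : Finset (Fin n)} {P : ℕ → MvPolynomial (Fin n) ℤ} {b : ℕ → ℕ}
    (hI : DPInv k t G bl s (Finset.range t) Z P b) (hT : TreeInv T.tree s (Finset.range t)) :
    Reach B dynamicProgram s (dynamicProgramTime t (k + 1)) fun s' =>
      s'.reg 0 = pmCount G Finset.univ := by
  have hB := hBig.one_le
  refine Reach.conseq (m := 1 + (1 + (1 + ((1 + 2 * t * (mergeTime (k + 1) + 9)) +
    (1 + (1 + (forgetAllTime (k + 1) + 1))))))) ?_ (by rw [dynamicProgramTime]; omega)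
    (fun _ _ _ h => h)
  refine Reach.seq_set hB rfl hBig.zero_lt (Reach.seq_set hB rfl hBig.zero_lt
    (Reach.seq_set hB rfl hBig.zero_lt (Reach.seq (treeLoop_spec (T := T) hbl hnd hw hBig ?_) ?_)))
  · refine ⟨⟨?_, ?_, hE.adj, hE.pw, hE.loc, hE.size, hE.bag⟩, ⟨Z, P, b, hI.congr rfl rfl rfl⟩,
      ⟨hT.lt, hT.conn, hT.deg, hT.nbsum⟩, Nat.zero_le _, ?_, ?_, ?_,
      Finset.mem_range.2 ht, .inl rfl, ?_⟩
    · simp [setReg_reg, hE.reg_n]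
    · simp [setReg_reg, hE.reg_t]
    · simp [setReg_reg, Exp.eval]
    · simp [setReg_reg, Exp.eval]
    · simp [Exp.eval]
    · intro y _ hy hy0
      omega
  · rintro s₁ - - ⟨r, hr, h6, hE₁, Z', P', b', hI'⟩
    have hrt : |(r : ℤ)| < 2 ^ B := hBig.cast_lt_of_le_sq (hr.le.trans (Nat.le_mul_self t))
    have htt : |(t : ℤ)| < 2 ^ B := hBig.cast_lt_of_le_sq (Nat.le_mul_self t)
    refine Reach.seq_set hB rfl (by simpa [Exp.eval, h6] using hrt)
      (Reach.seq_set hB rfl (by simpa [Exp.eval, setReg_reg, hE₁.reg_t] using htt) ?_)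
    refine Reach.seq (DPInv.finish (x := r) (hI'.congr (s' := _) rfl rfl rfl) hBig ?_ hr ?_ ?_
      (hnd r) (hw r) hblt) ?_
    · refine ⟨?_, ?_, hE₁.adj, hE₁.pw, hE₁.loc, hE₁.size, hE₁.bag⟩
      · simp [setReg_reg, hE₁.reg_n]
      · simp [setReg_reg, hE₁.reg_t]
    · simp [setReg_reg, Exp.eval, h6]
    · simp [setReg_reg, Exp.eval, hE₁.reg_t]
    · intro s₂ hg₂ hF₂ h9
      have h6' : s₂.reg 6 = r := by
        rw [hF₂.reg 6 rfl]
        simp [setReg_reg, h6]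
      refine Reach.set hB rfl (hg₂.mem 9 (by norm_num) _) ?_
      simp [Exp.eval, h6', h9]

end RAM

namespace RAM

open Exp Cmd

/-! ### Lists of edges and of bags -/

section Lists

variable {N m : ℕ} {H : SimpleGraph (Fin N)} {a b : ℤ → ℤ}

/-- Every edge is listed in one of as many cells as there are edges. Hence no cell is wasted on
anything else, and no edge is listed twice. -/
theorem ListsEdges.exists_bijective (h : ListsEdges H m a b) :
    ∃ J : H.edgeSet → Fin m, Function.Bijective J ∧ ∀ e, ∃ u v : Fin N,
      a (J e : ℕ) = (u : ℕ) ∧ b (J e : ℕ) = (v : ℕ) ∧ (e : Sym2 (Fin N)) = s(u, v) := by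
  have key : ∀ e : H.edgeSet, ∃ j : Fin m, ∃ u v : Fin N,
      a (j : ℕ) = (u : ℕ) ∧ b (j : ℕ) = (v : ℕ) ∧ (e : Sym2 (Fin N)) = s(u, v) := by
    rintro ⟨e, he⟩
    induction e using Sym2.ind with
    | _ u v =>
      obtain ⟨j, hj, h1 | h1⟩ := (h.2 u v).1 he
      · exact ⟨⟨j, hj⟩, u, v, h1.1, h1.2, rfl⟩
      · exact ⟨⟨j, hj⟩, v, u, h1.1, h1.2, Sym2.eq_swap⟩
  choose J hJ using key
  refine ⟨J, Function.Injective.bijective_of_nat_card_le ?_ ?_, hJ⟩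
  · intro e e' hee
    obtain ⟨u, v, h1, h2, h3⟩ := hJ e
    obtain ⟨u', v', h1', h2', h3'⟩ := hJ e'
    rw [hee, h1'] at h1
    rw [hee, h2'] at h2
    have hu : u = u' := Fin.ext (by exact_mod_cast h1.symm)
    have hv : v = v' := Fin.ext (by exact_mod_cast h2.symm)
    exact Subtype.ext (by rw [h3, h3', hu, hv])
  · rw [Nat.card_fin, Nat.card_coe_set_eq, h.1]

theorem ListsEdges.entry (h : ListsEdges H m a b) {j : ℕ} (hj : j < m) :
    ∃ u v : Fin N, a j = (u : ℕ) ∧ b j = (v : ℕ) ∧ H.Adj u v := by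
  obtain ⟨J, hJ, hJ'⟩ := h.exists_bijective
  obtain ⟨e, he⟩ := hJ.2 ⟨j, hj⟩
  obtain ⟨u, v, h1, h2, h3⟩ := hJ' e
  rw [he] at h1 h2
  refine ⟨u, v, h1, h2, ?_⟩
  rw [← SimpleGraph.mem_edgeSet, ← h3]
  exact e.2

theorem ListsEdges.eq_of_entry_eq (h : ListsEdges H m a b) {i j : ℕ} (hi : i < m) (hj : j < m)
    (hij : a i = a j ∧ b i = b j ∨ a i = b j ∧ b i = a j) : i = j := by
  obtain ⟨J, hJ, hJ'⟩ := h.exists_bijective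
  obtain ⟨e, he⟩ := hJ.2 ⟨i, hi⟩
  obtain ⟨f, hf⟩ := hJ.2 ⟨j, hj⟩
  obtain ⟨u, v, h1, h2, h3⟩ := hJ' e
  obtain ⟨u', v', h1', h2', h3'⟩ := hJ' f
  rw [he] at h1 h2
  rw [hf] at h1' h2'
  simp only at h1 h2 h1' h2'
  have hef : e = f := by
    apply Subtype.ext
    rw [h3, h3', Sym2.eq_iff]
    simp only [h1, h2, h1', h2', Nat.cast_inj] at hij
    simpa only [Fin.ext_iff] using hij
  rw [← hef, he] at hf
  exact congrArg Fin.val hf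

/-- The pair `y, z` is among the first `j` pairs in the arrays `a` and `b`. -/
def Listed (a b : ℤ → ℤ) (j y z : ℕ) : Prop :=
  ∃ i < j, (a i = y ∧ b i = z) ∨ (a i = z ∧ b i = y)

theorem not_listed_zero {y z : ℕ} : ¬ Listed a b 0 y z := by
  rintro ⟨i, hi, -⟩
  omega

theorem listed_succ {j y z u v : ℕ} (hu : a j = u) (hv : b j = v) :
    Listed a b (j + 1) y z ↔ Listed a b j y z ∨ (y = u ∧ z = v) ∨ (y = v ∧ z = u) := by
  constructor
  · rintro ⟨i, hi, h⟩
    rcases Nat.lt_succ_iff_lt_or_eq.1 hi with hi | rfl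
    · exact .inl ⟨i, hi, h⟩
    · rw [hu, hv] at h
      norm_cast at h
      omega
  · rintro (⟨i, hi, h⟩ | ⟨rfl, rfl⟩ | ⟨rfl, rfl⟩)
    · exact ⟨i, by omega, h⟩
    · exact ⟨j, by omega, .inl ⟨hu, hv⟩⟩
    · exact ⟨j, by omega, .inr ⟨hu, hv⟩⟩

/-- Each edge is new when it is read, so degrees and neighbor sums count it once. -/
theorem ListsEdges.not_listed (h : ListsEdges H m a b) {j u v : ℕ} (hj : j < m) (hu : a j = u)
    (hv : b j = v) : ¬ Listed a b j u v ∧ ¬ Listed a b j v u := by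
  constructor
  · rintro ⟨i, hi, h1⟩
    refine hi.ne (h.eq_of_entry_eq (hi.trans hj) hj ?_)
    rw [hu, hv]
    exact h1
  · rintro ⟨i, hi, h1⟩
    refine hi.ne (h.eq_of_entry_eq (hi.trans hj) hj ?_)
    rw [hu, hv]
    exact h1.symm

open Classical in
/-- The second entries of the pairs with a given entry, among the first `j` pairs. -/
noncomputable def listedWith (a b : ℤ → ℤ) (N j y : ℕ) : Finset ℕ :=
  (Finset.range N).filter (Listed a b j y)

theorem mem_listedWith {j y z : ℕ} : z ∈ listedWith a b N j y ↔ z < N ∧ Listed a b j y z := by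
  simp [listedWith]

theorem ListsEdges.listedWith_eq_nbrs (h : ListsEdges H m a b) (y : ℕ) (hy : y < N) :
    listedWith a b N m y = nbrs H (Finset.range N) y := by
  ext z
  rw [mem_listedWith, mem_nbrs, Finset.mem_range]
  refine and_congr_right fun hz => ?_
  constructor
  · exact fun hl => ⟨hy, hz, (h.2 ⟨y, hy⟩ ⟨z, hz⟩).2 hl⟩
  · rintro ⟨_, _, ha⟩
    exact (h.2 ⟨y, hy⟩ ⟨z, hz⟩).1 ha

/-- As with the edges, there are as many cells as vertices, so the listing is a bijection and has no
repetitions. -/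
theorem exists_list_of_entries {n : ℕ} (S : Finset (Fin n)) (f : ℕ → ℤ)
    (h : ∀ v : Fin n, v ∈ S ↔ ∃ j < S.card, f j = (v : ℕ)) :
    ∃ l : List (Fin n), l.length = S.card ∧ l.Nodup ∧ (∀ v, v ∈ l ↔ v ∈ S) ∧
      ∀ (j : ℕ) (hj : j < l.length), f j = ((l[j] : Fin n) : ℕ) := by
  have key : ∀ v : S, ∃ j : Fin S.card, f j = ((v : Fin n) : ℕ) := fun v => by
    obtain ⟨j, hj, h1⟩ := (h v).1 v.2
    exact ⟨⟨j, hj⟩, h1⟩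
  choose J hJ using key
  have hb : Function.Bijective J := by
    refine Function.Injective.bijective_of_nat_card_le (fun v w hvw => ?_) (by simp)
    have := hJ v
    rw [hvw, hJ w] at this
    exact Subtype.ext (Fin.ext (by exact_mod_cast this.symm))
  set e := Equiv.ofBijective J hb
  refine ⟨List.ofFn fun j => (e.symm j : Fin n), by simp, ?_, ?_, ?_⟩
  · rw [List.nodup_ofFn]
    exact Subtype.val_injective.comp e.symm.injective
  · intro v
    rw [List.mem_ofFn]
    constructor
    · rintro ⟨j, rfl⟩
      exact (e.symm j).2
    · intro hv
      exact ⟨e ⟨v, hv⟩, by simp⟩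
  · intro j hj
    rw [List.getElem_ofFn, ← hJ]
    congr 1
    rw [List.length_ofFn] at hj
    exact (congrArg Fin.val (e.apply_symm_apply ⟨j, hj⟩)).symm

end Lists

end RAM

namespace RAM

open Exp Cmd

variable {n t B : ℕ} {M : ℤ} {G : SimpleGraph (Fin n)} {bl : ℕ → List (Fin n)}

/-! ### Preparation of the data -/

theorem Reach.seq_set' {s : State} {Q : State → Prop} {r m : ℕ} {e : Exp} {d : Cmd} (hB : 1 ≤ B)
    (he : e.Safe B s) (hz : |e.eval s| < 2 ^ B) (h : Reach B d (s.setReg r (e.eval s)) m Q) :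
    Reach B (.seq (.set r e) d) s (1 + m) Q :=
  Reach.seq (Reach.set' (Q := fun s' => s' = s.setReg r (e.eval s)) hB he hz rfl)
    fun _ _ _ hs => hs ▸ h

theorem cell_inj {x y i j : ℕ} (hi : i < n) (hj : j < n) :
    (x : ℤ) * n + i = (y : ℤ) * n + j ↔ x = y ∧ i = j := by
  constructor
  · intro h
    have := address_injective (t := n) (x := i) (x' := j) (by omega) (by omega) h
    omega
  · rintro ⟨rfl, rfl⟩
    rfl

/-- The adjacency matrix of the graph is computed from the list of edges. -/
def readGraph : Cmd :=
  .for 36 (var 1) <| seq (set 37 (get 0 (var 36))) <| seq (set 38 (get 1 (var 36))) <|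
    seq (store 6 (add (mul (var 37) (var 0)) (var 38)) (lit 1))
      (store 6 (add (mul (var 38) (var 0)) (var 37)) (lit 1))

open Classical in
theorem readGraph_spec (hBig : Big n t M B) {s : State} {m : ℕ} (h0 : s.reg 0 = n)
    (h1 : s.reg 1 = m) (hm : (m : ℤ) < 2 ^ B) (hG : ListsEdges G m (s.mem 0) (s.mem 1))
    (hblank : ∀ z, s.mem 6 z = 0) :
    Reach B readGraph s (2 + m * 6) fun s' =>
      ∀ u v : Fin n, s'.mem 6 ((u : ℕ) * n + (v : ℕ)) = if G.Adj u v then 1 else 0 := by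
  have hB := hBig.one_le
  refine Reach.conseq (Reach.for (m := 4) hB (fun j s' => ∀ u v : Fin n,
    s'.mem 6 ((u : ℕ) * n + (v : ℕ)) = if Listed (s.mem 0) (s.mem 1) j u v then 1 else 0)
    rfl rfl hm ?_ ?_ ?_) (by omega) ?_
  · intro s' hF
    simp [Exp.eval, hF.reg 1 rfl, h1]
  · intro u v
    simp [hblank, not_listed_zero]
  · intro j hj s₁ hg₁ hF₁ h36 hI
    obtain ⟨u, v, hu, hv, huv⟩ := hG.entry hj
    have e0 : (get 0 (var 36)).eval s₁ = (u : ℕ) := by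
      simp only [Exp.eval, h36, hF₁.mem 0 rfl, hu]
    have hvB := hBig.cast_lt v.2.le
    have huB := hBig.cast_lt u.2.le
    have r0 : s₁.reg 0 = n := (hF₁.reg 0 rfl).trans h0
    have hu' : |((u : ℕ) : ℤ)| < 2 ^ B := by rwa [abs_of_nonneg (by positivity)]
    have hv' : |((v : ℕ) : ℤ)| < 2 ^ B := by rwa [abs_of_nonneg (by positivity)]
    refine Reach.seq_set' (m := 3) hB ⟨trivial, by rw [show s₁.mem 0 _ = _ from e0]; exact hu'⟩
      (by rw [e0]; exact hu') ?_
    rw [e0]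
    have e1 : (get 1 (var 36)).eval (s₁.setReg 37 ((u : ℕ) : ℤ)) = (v : ℕ) := by
      simp [Exp.eval, setReg_reg, h36, hF₁.mem 1 rfl, hv]
    refine Reach.seq_set' (m := 2) hB ⟨trivial, by rw [show State.mem _ 1 _ = _ from e1]; exact hv'⟩
      (by rw [e1]; exact hv') ?_
    rw [e1]
    obtain ⟨s₂, hs₂⟩ : ∃ s₂, s₂ = (s₁.setReg 37 ((u : ℕ) : ℤ)).setReg 38 ((v : ℕ) : ℤ) := ⟨_, rfl⟩
    have q0 : s₂.reg 0 = n := by simp [hs₂, setReg_reg, r0]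
    have q37 : s₂.reg 37 = (u : ℕ) := by simp [hs₂, setReg_reg]
    have q38 : s₂.reg 38 = (v : ℕ) := by simp [hs₂]
    have q6 : s₂.mem 6 = s₁.mem 6 := by simp [hs₂]
    rw [← hs₂]
    refine Reach.seq_store (m := 1) hB rfl rfl hBig.one_lt
      (Reach.store hB rfl rfl hBig.one_lt ?_)
    intro x y
    have hcell : ∀ a b : Fin n, ((x : ℕ) : ℤ) * n + (y : ℕ) = ((a : ℕ) : ℤ) * n + (b : ℕ) ↔
        (x : ℕ) = a ∧ (y : ℕ) = b := fun a b => cell_inj y.2 b.2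
    simp only [Exp.eval, setMem_same, setMem_reg, setReg_mem, hI x y, q0, q37,
      q38, q6, hcell, listed_succ hu hv]
    by_cases c1 : (x : ℕ) = v ∧ (y : ℕ) = u
    · rw [if_pos c1, if_pos (.inr (.inr c1))]
    · by_cases c2 : (x : ℕ) = u ∧ (y : ℕ) = v
      · rw [if_neg c1, if_pos c2, if_pos (.inr (.inl c2))]
      · rw [if_neg c1, if_neg c2]
        exact if_congr (by tauto) rfl rfl
  · intro s' _ _ h u v
    rw [h u v]
    exact if_congr (hG.2 u v).symm rfl rfl

/-- The numbers of neighbors of all nodes, and the sums of their numbers, are computed from the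
list of edges of the tree. -/
def readTree : Cmd :=
  .for 36 (sub (var 2) (lit 1)) <| seq (set 37 (get 2 (var 36))) <|
    seq (set 38 (get 3 (var 36))) <| seq (store 7 (var 37) (add (get 7 (var 37)) (lit 1))) <|
    seq (store 7 (var 38) (add (get 7 (var 38)) (lit 1))) <|
    seq (store 8 (var 37) (add (get 8 (var 37)) (var 38)))
      (store 8 (var 38) (add (get 8 (var 38)) (var 37)))

theorem listedWith_bound (a b : ℤ → ℤ) (j y : ℕ) :
    (listedWith a b t j y).card ≤ t ∧ ∑ z ∈ listedWith a b t j y, z ≤ t * t := by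
  classical
  have h1 : listedWith a b t j y ⊆ Finset.range t := Finset.filter_subset _ _
  have h2 : (listedWith a b t j y).card ≤ t := by simpa using Finset.card_le_card h1
  refine ⟨h2, (Finset.sum_le_card_nsmul _ _ t fun z hz =>
    (Finset.mem_range.1 (h1 hz)).le).trans ?_⟩
  rw [smul_eq_mul]
  exact Nat.mul_le_mul_right _ h2

theorem readTree_spec (hBig : Big n t M B) (ht : 1 ≤ t) {H : SimpleGraph (Fin t)} {s : State}
    (h2 : s.reg 2 = t) (hH : ListsEdges H (t - 1) (s.mem 2) (s.mem 3))
    (hblank7 : ∀ z, s.mem 7 z = 0) (hblank8 : ∀ z, s.mem 8 z = 0) :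
    Reach B readTree s (2 + t * 8) fun s' =>
      ∀ y < t, s'.mem 7 y = (nbrs H (Finset.range t) y).card ∧
        s'.mem 8 y = ∑ z ∈ nbrs H (Finset.range t) y, (z : ℤ) := by
  have hB := hBig.one_le
  have htB : (t : ℤ) < 2 ^ B := by
    simpa using hBig.cast_lt_of_le_sq (Nat.le_mul_self t)
  set L := listedWith (s.mem 2) (s.mem 3) t with hL
  refine Reach.conseq (Reach.for (N := t - 1) (m := 6) hB (fun j s' => ∀ y < t,
    s'.mem 7 y = (L j y).card ∧ s'.mem 8 y = ∑ z ∈ L j y, (z : ℤ))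
    rfl rfl (by omega) ?_ ?_ ?_) (by omega) ?_
  · intro s' hF
    simp only [Exp.eval, hF.reg 2 rfl, h2]
    omega
  · intro y _
    have : L 0 y = ∅ := by
      rw [hL]
      ext z
      simp [mem_listedWith, not_listed_zero]
    simp [this, hblank7, hblank8]
  · intro j hj s₁ hg₁ hF₁ h36 hI
    obtain ⟨⟨u, hut⟩, ⟨v, hvt⟩, hu, hv, huv⟩ := hH.entry hj
    have huv' : u ≠ v := fun e => huv.ne (Fin.ext e)
    simp only at hu hv
    have hnew := hH.not_listed hj hu hv
    have e0 : (get 2 (var 36)).eval s₁ = u := by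
      simp only [Exp.eval, h36, hF₁.mem 2 rfl, hu]
    have hbd : ∀ {w : ℕ}, w ≤ t * t → |(w : ℤ)| < 2 ^ B := hBig.cast_lt_of_le_sq
    have hu' := hbd (hut.le.trans (Nat.le_mul_self t))
    have hv' := hbd (hvt.le.trans (Nat.le_mul_self t))
    have hLu : L (j + 1) u = insert v (L j u) := by
      ext z
      simp only [hL, mem_listedWith, Finset.mem_insert, listed_succ hu hv, huv', false_and,
        or_false, true_and]
      constructor
      · tauto
      · rintro (rfl | h) <;> tauto
    have hLv : L (j + 1) v = insert u (L j v) := by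
      ext z
      simp only [hL, mem_listedWith, Finset.mem_insert, listed_succ hu hv, huv'.symm, false_and,
        false_or, true_and]
      constructor
      · tauto
      · rintro (rfl | h) <;> tauto
    have hLo : ∀ y, y ≠ u → y ≠ v → L (j + 1) y = L j y := by
      intro y hyu hyv
      ext z
      simp [hL, mem_listedWith, listed_succ hu hv, hyu, hyv]
    have hvu : v ∉ L j u := fun h => hnew.1 (mem_listedWith.1 h).2
    have huv'' : u ∉ L j v := fun h => hnew.2 (mem_listedWith.1 h).2
    have c1 : ((L j u).card : ℤ) + 1 = (L (j + 1) u).card := by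
      rw [hLu, Finset.card_insert_of_notMem hvu]; push_cast; rfl
    have c2 : ((L j v).card : ℤ) + 1 = (L (j + 1) v).card := by
      rw [hLv, Finset.card_insert_of_notMem huv'']; push_cast; rfl
    have c3 : (∑ z ∈ L j u, (z : ℤ)) + v = ((∑ z ∈ L (j + 1) u, z : ℕ) : ℤ) := by
      rw [hLu, Finset.sum_insert hvu]; push_cast; ring
    have c4 : (∑ z ∈ L j v, (z : ℤ)) + u = ((∑ z ∈ L (j + 1) v, z : ℕ) : ℤ) := by
      rw [hLv, Finset.sum_insert huv'']; push_cast; ring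
    have b1 := fun y => hbd ((listedWith_bound (t := t) (s.mem 2) (s.mem 3) (j + 1) y).1.trans
      (Nat.le_mul_self t))
    have b2 := fun y => hbd (listedWith_bound (t := t) (s.mem 2) (s.mem 3) (j + 1) y).2
    rw [← hL] at b1 b2
    have huvz : (u : ℤ) ≠ v := by exact_mod_cast huv'
    refine Reach.seq_set' (m := 5) hB ⟨trivial, by rw [show s₁.mem 2 _ = _ from e0]; exact hu'⟩
      (by rw [e0]; exact hu') ?_
    rw [e0]
    have e1 : (get 3 (var 36)).eval (s₁.setReg 37 (u : ℤ)) = v := by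
      simp [Exp.eval, setReg_reg, h36, hF₁.mem 3 rfl, hv]
    refine Reach.seq_set' (m := 4) hB ⟨trivial, by rw [show State.mem _ 3 _ = _ from e1]; exact hv'⟩
      (by rw [e1]; exact hv') ?_
    rw [e1]
    obtain ⟨s₂, hs₂⟩ : ∃ s₂, s₂ = (s₁.setReg 37 u).setReg 38 v := ⟨_, rfl⟩
    have q37 : s₂.reg 37 = u := by simp [hs₂, setReg_reg]
    have q38 : s₂.reg 38 = v := by simp [hs₂]
    have q7 : s₂.mem 7 = s₁.mem 7 := by simp [hs₂]
    have q8 : s₂.mem 8 = s₁.mem 8 := by simp [hs₂]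
    rw [← hs₂]
    have d7 : ∀ {y : ℕ}, y < t → s₁.mem 7 y = (L j y).card := fun hy => (hI _ hy).1
    have d8 : ∀ {y : ℕ}, y < t → s₁.mem 8 y = ∑ z ∈ L j y, (z : ℤ) := fun hy => (hI _ hy).2
    refine Reach.seq_store (m := 3) hB rfl rfl ?_ (Reach.seq_store (m := 2) hB rfl rfl ?_
      (Reach.seq_store (m := 1) hB rfl rfl ?_ (Reach.store hB rfl rfl ?_ ?_)))
    · simp only [Exp.eval, q37, q7, d7 hut, c1]
      exact b1 u
    · simp only [Exp.eval, setMem_reg, setMem_same, q37, q38, q7, huvz.symm, if_false, d7 hvt, c2]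
      exact b1 v
    · simp [Exp.eval, q37, q38, setMem_apply, q8, d8 hut, -Nat.cast_sum, c3]
      exact (le_abs_self _).trans_lt (b2 u)
    · simp [Exp.eval, q37, q38, setMem_apply, q8, huv'.symm, d8 hvt, -Nat.cast_sum, c4]
      exact (le_abs_self _).trans_lt (b2 v)
    · intro y hy
      by_cases hyu : y = u
      · subst hyu
        simp [Exp.eval, q37, q38, setMem_apply, q7, q8, huv', d7 hut, d8 hut, -Nat.cast_sum, c1, c3]
        exact Nat.cast_sum _ _
      · by_cases hyv : y = v
        · subst hyv
          simp [Exp.eval, q37, q38, setMem_apply, q7, q8, hyu, d7 hvt, d8 hvt, -Nat.cast_sum,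
            c2, c4]
          exact Nat.cast_sum _ _
        · simp [Exp.eval, q37, q38, setMem_apply, q7, q8, hyu, hyv, hLo y hyu hyv, d7 hy, d8 hy]
  · intro s' _ _ h y hy
    rw [← hH.listedWith_eq_nbrs y hy]
    exact h y hy

/-- The table of every node is initialized, and the bags are copied. -/
def readBags : Cmd :=
  .for 36 (var 2) <| seq (store 21 (var 36) (get 4 (var 36))) <|
    seq (store 9 (var 36) (lit 1)) <| .for 37 (get 21 (var 36)) <|
    seq (set 38 (get 5 (add (mul (var 36) (var 0)) (var 37)))) <|
    seq (store 22 (add (mul (var 36) (var 0)) (var 37)) (var 38))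
      (store 12 (add (mul (var 36) (var 0)) (var 38)) (lit 1))

/-- The state of the copies after the bags of the first `x` nodes and `j` vertices of the bag of
the node `x` are copied. -/
structure BagsInv (bl : ℕ → List (Fin n)) (x j : ℕ) (s : State) : Prop where
  loc : ∀ (y : ℕ) (v : Fin n), s.mem 12 (y * n + (v : ℕ)) =
    if (y < x ∧ v ∈ bl y) ∨ (y = x ∧ v ∈ (bl x).take j) then 1 else 0
  size : ∀ y < x, s.mem 21 y = (bl y).length
  bag : ∀ y i, (y < x ∨ (y = x ∧ i < j)) → ∀ h : i < (bl y).length,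
    s.mem 22 ((y : ℤ) * n + i) = (((bl y)[i] : Fin n) : ℕ)
  tab : ∀ z : ℤ, 0 ≤ z → s.mem 9 z = if z < x then 1 else 0

/-- Only the cells below `t` of array 9 are set: they are the entries of the empty set, as its code
is zero. Membership in bags is tabulated in array 12 for constant-time tests. -/
theorem readBags_spec (hBig : Big n t M B) {w : ℕ} {s : State} (h0 : s.reg 0 = n)
    (h2 : s.reg 2 = t) (hnd : ∀ y, (bl y).Nodup) (hw : ∀ y, (bl y).length ≤ w)
    (hblt : ∀ y, t ≤ y → bl y = []) (hsize : ∀ y < t, s.mem 4 y = (bl y).length)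
    (hbag : ∀ y < t, ∀ (j : ℕ) (h : j < (bl y).length),
      s.mem 5 ((y : ℤ) * n + j) = (((bl y)[j] : Fin n) : ℕ))
    (h9 : ∀ z, s.mem 9 z = 0) (h12 : ∀ z, s.mem 12 z = 0) :
    Reach B readBags s (2 + t * (6 + w * 5)) fun s' =>
      (∀ (y : ℕ) (v : Fin n), s'.mem 12 (y * n + (v : ℕ)) = if v ∈ bl y then 1 else 0) ∧
      (∀ y < t, s'.mem 21 y = (bl y).length) ∧
      (∀ y < t, ∀ (j : ℕ) (h : j < (bl y).length),
        s'.mem 22 ((y : ℤ) * n + j) = (((bl y)[j] : Fin n) : ℕ)) ∧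
      ∀ z : ℤ, 0 ≤ z → s'.mem 9 z = if z < t then 1 else 0 := by
  have hB := hBig.one_le
  have htB : (t : ℤ) < 2 ^ B := by
    simpa using hBig.cast_lt_of_le_sq (Nat.le_mul_self t)
  have hlen : ∀ y, (bl y).length ≤ n := fun y => by simpa using (hnd y).length_le_card
  refine Reach.conseq (Reach.for (m := 1 + (1 + (2 + w * (3 + 2)))) hB
    (fun x s' => BagsInv bl x 0 s') rfl rfl htB ?_ ?_ ?_) (le_of_eq (by ring)) ?_
  · intro s' hF
    simp [Exp.eval, hF.reg 2 rfl, h2]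
  · constructor
    · simp [h12]
    · simp
    · simp
    · intro z hz
      simp [h9, hz]
  · intro x hx s₁ hg₁ hF₁ h36 hI
    have r0 : s₁.reg 0 = n := (hF₁.reg 0 rfl).trans h0
    have e0 : (get 4 (var 36)).eval s₁ = (bl x).length := by
      simp only [Exp.eval, h36, hF₁.mem 4 rfl, hsize x hx]
    have hlB : |((bl x).length : ℤ)| < 2 ^ B := by
      rw [abs_of_nonneg (by positivity)]
      exact hBig.cast_lt (hlen x)
    refine Reach.seq (m₁ := 1) (Reach.store' (Q := fun s' => s' = s₁.setMem 21 x (bl x).length) hB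
      trivial ⟨trivial, by rw [show s₁.mem 4 _ = _ from e0]; exact hlB⟩ (by rw [e0]; exact hlB)
      (by rw [e0]; simp only [Exp.eval, h36])) ?_
    rintro _ - - rfl
    refine Reach.seq_store hB rfl rfl hBig.one_lt ?_
    obtain ⟨s₂, hs₂⟩ : ∃ s₂, s₂ = (s₁.setMem 21 x (bl x).length).setMem 9 x 1 := ⟨_, rfl⟩
    have q0 : s₂.reg 0 = n := by simp [hs₂, r0]
    have q36 : s₂.reg 36 = x := by simp [hs₂, h36]
    have q5 : s₂.mem 5 = s.mem 5 := by
      rw [← hF₁.mem 5 rfl, hs₂, setMem_ne _ _ _ (by norm_num), setMem_ne _ _ _ (by norm_num)]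
    have q12 : s₂.mem 12 = s₁.mem 12 := by
      rw [hs₂, setMem_ne _ _ _ (by norm_num), setMem_ne _ _ _ (by norm_num)]
    have q22 : s₂.mem 22 = s₁.mem 22 := by
      rw [hs₂, setMem_ne _ _ _ (by norm_num), setMem_ne _ _ _ (by norm_num)]
    have q21 : ∀ y < x + 1, s₂.mem 21 y = (bl y).length := by
      intro y hy
      rw [hs₂, setMem_ne _ _ _ (by norm_num), setMem_same]
      rcases Nat.lt_succ_iff_lt_or_eq.1 hy with h | rfl
      · rw [if_neg (by exact_mod_cast h.ne), hI.size y h]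
      · rw [if_pos rfl]
    have q9 : ∀ z : ℤ, 0 ≤ z → s₂.mem 9 z = if z < (x + 1 : ℕ) then 1 else 0 := by
      intro z hz
      rw [hs₂, setMem_same, setMem_ne _ _ _ (by norm_num), hI.tab z hz]
      push_cast
      split_ifs <;> first | rfl | omega
    simp only [Exp.eval, setMem_reg, h36]
    rw [← hs₂]
    refine Reach.conseq (m := 2 + (bl x).length * (3 + 2)) (Reach.for (N := (bl x).length) hB
      (fun j s' =>
        (∀ (y : ℕ) (v : Fin n), s'.mem 12 (y * n + (v : ℕ)) =
          if (y < x ∧ v ∈ bl y) ∨ (y = x ∧ v ∈ (bl x).take j) then 1 else 0) ∧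
        ∀ y i, (y < x ∨ (y = x ∧ i < j)) → ∀ h : i < (bl y).length,
          s'.mem 22 ((y : ℤ) * n + i) = (((bl y)[i] : Fin n) : ℕ))
      rfl rfl (hBig.cast_lt (hlen x)) ?_ ?_ ?_) ?_ ?_
    · intro s' hF
      simp only [Exp.eval, hF.reg 36 rfl, hF.mem 21 rfl, q36, q21 x (Nat.lt_succ_self x)]
    · simp only [setReg_mem, q12, q22]
      exact ⟨hI.loc, hI.bag⟩
    · rintro j hj s₃ hg₃ hF₃ h37 ⟨hloc, hbg⟩
      have p0 : s₃.reg 0 = n := (hF₃.reg 0 rfl).trans q0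
      have p36 : s₃.reg 36 = x := (hF₃.reg 36 rfl).trans q36
      obtain ⟨v, hv⟩ : ∃ v, v = (bl x)[j] := ⟨_, rfl⟩
      have e1 : (get 5 (add (mul (var 36) (var 0)) (var 37))).eval s₃ = (v : ℕ) := by
        simp only [Exp.eval, p36, p0, h37, hF₃.mem 5 rfl, q5, hbag x hx j hj, hv]
      have hvB : |((v : ℕ) : ℤ)| < 2 ^ B := by
        rw [abs_of_nonneg (by positivity)]
        exact hBig.cast_lt v.2.le
      refine Reach.seq_set' (m := 2) hB ⟨⟨⟨trivial, trivial⟩, trivial⟩, by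
        rw [show s₃.mem 5 _ = _ from e1]; exact hvB⟩ (by rw [e1]; exact hvB) ?_
      rw [e1]
      refine Reach.seq_store (m := 1) hB rfl rfl (by simpa [Exp.eval] using hvB)
        (Reach.store hB rfl rfl hBig.one_lt ?_)
      have hjn : j < n := hj.trans_le (hlen x)
      simp only [Exp.eval, setMem_reg, setReg_mem, setMem_apply, setReg_reg, p0, p36, h37]
      norm_num
      constructor
      · intro y u
        have hc : (y : ℤ) * n + (u : ℕ) = x * n + (v : ℕ) ↔ y = x ∧ (u : ℕ) = v :=
          cell_inj u.2 v.2
        have htk : u ∈ (bl x).take (j + 1) ↔ u ∈ (bl x).take j ∨ u = v := by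
          rw [List.take_succ_eq_append_getElem hj, List.mem_append, List.mem_singleton, hv]
        simp only [hloc y u, hc, htk, Fin.val_inj]
        by_cases hyx : y = x
        · by_cases huv : u = v
          · simp [hyx, huv]
          · simp [hyx, huv]
        · simp [hyx]
      · intro y i hyi hi
        have hc : (y : ℤ) * n + i = x * n + j ↔ y = x ∧ i = j :=
          cell_inj (hi.trans_le (hlen y)) hjn
        simp only [hc]
        by_cases h : y = x ∧ i = j
        · obtain ⟨rfl, rfl⟩ := h
          simp [hv]
        · rw [if_neg h]
          exact hbg y i (by omega) hi
    · have := Nat.mul_le_mul_right (3 + 2) (hw x)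
      omega
    · rintro s₃ - hF₃ ⟨hloc, hbg⟩
      constructor
      · intro y v
        rw [setReg_mem, hloc y v, List.take_length]
        refine if_congr ?_ rfl rfl
        simp only [List.take_zero, List.not_mem_nil, and_false, or_false, Nat.lt_succ_iff_lt_or_eq]
        constructor
        · rintro (h | ⟨rfl, h⟩)
          · exact ⟨.inl h.1, h.2⟩
          · exact ⟨.inr rfl, h⟩
        · rintro ⟨h | rfl, h'⟩
          · exact .inl ⟨h, h'⟩
          · exact .inr ⟨rfl, h'⟩
      · intro y hy
        rw [setReg_mem, hF₃.mem 21 rfl, q21 y hy]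
      · intro y i hyi hi
        refine hbg y i ?_ hi
        rcases hyi with h | h
        · rcases Nat.lt_succ_iff_lt_or_eq.1 h with h | rfl
          · exact .inl h
          · exact .inr ⟨rfl, hi⟩
        · omega
      · intro z hz
        rw [setReg_mem, hF₃.mem 9 rfl, q9 z hz]
  · rintro s' - - h
    refine ⟨fun y v => ?_, h.size, fun y hy j hj => h.bag y j (.inl hy) hj, h.tab⟩
    rw [h.loc y v]
    refine if_congr ?_ rfl rfl
    simp only [List.take_zero, List.not_mem_nil, and_false, or_false, and_iff_right_iff_imp]
    intro hv
    by_contra hy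
    rw [hblt y (not_lt.1 hy)] at hv
    simp at hv

/-- The powers of four are computed. -/
def powers : Cmd :=
  seq (set 38 (lit 1)) <| .for 36 (var 0) <| seq (store 11 (var 36) (var 38))
    (set 38 (mul (var 38) (lit 4)))

theorem powers_spec (hBig : Big n t M B) {s : State} (h0 : s.reg 0 = n) :
    Reach B powers s (3 + n * 4) fun s' => ∀ v : Fin n, s'.mem 11 (v : ℕ) = 4 ^ (v : ℕ) := by
  have hB := hBig.one_le
  have hpow : ∀ {j : ℕ}, j ≤ n → |(4 : ℤ) ^ j| < 2 ^ B := fun hj => by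
    rw [abs_of_nonneg (by positivity)]
    exact (pow_le_pow_right₀ (by norm_num) hj).trans_lt hBig.four_pow_lt
  refine Reach.conseq (m := 1 + (2 + n * (2 + 2))) (Reach.seq_set hB rfl hBig.one_lt (Reach.for hB
    (fun j s' => s'.reg 38 = 4 ^ j ∧ ∀ v : ℕ, v < j → s'.mem 11 v = 4 ^ v) rfl rfl
    (hBig.cast_lt le_rfl) ?_ ?_ ?_)) (by omega) fun s' _ _ h v => h.2 v v.2
  · intro s' hF
    simp only [Exp.eval, hF.reg 0 rfl]
    simpa [setReg_reg] using h0
  · simp [setReg_reg, Exp.eval]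
  · rintro j hj s₁ - - h36 ⟨h38, hI⟩
    refine Reach.seq_store (m := 1) hB rfl rfl (by rw [Exp.eval, h38]; exact hpow hj.le)
      (Reach.set hB rfl ?_ ?_)
    · simp only [Exp.eval, setMem_reg, h38]
      rw [← pow_succ]
      exact hpow hj
    · simp only [Exp.eval, setMem_reg, h38, h36, setReg_reg, setReg_mem, setMem_same]
      refine ⟨by simp [pow_succ], fun v hv => ?_⟩
      rcases Nat.lt_succ_iff_lt_or_eq.1 hv with h | rfl
      · rw [if_neg (by exact_mod_cast h.ne), hI v h]
      · rw [if_pos rfl]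

end RAM

namespace RAM

open Exp Cmd

variable {n t B k : ℕ} {M : ℤ} {G : SimpleGraph (Fin n)} {bl : ℕ → List (Fin n)}

/-- All data are prepared. -/
def prepare : Cmd := seq readGraph <| seq readTree <| seq readBags powers

/-- A bound on the number of instructions in `prepare`. -/
def prepareTime (m n t w : ℕ) : ℕ := 9 + m * 6 + t * 8 + t * (6 + w * 5) + n * 4

theorem Encodes.exists_lists {T : TreeDecomposition G (Fin t)} {s : State} (h : Encodes T s) :
    ∃ bl : ℕ → List (Fin n), (∀ y, (bl y).Nodup) ∧ (∀ y, t ≤ y → bl y = []) ∧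
      (∀ (y : ℕ) (hy : y < t), (bl y).length = (T.bag ⟨y, hy⟩).card ∧
        ∀ v : Fin n, v ∈ bl y ↔ v ∈ T.bag ⟨y, hy⟩) ∧
      ∀ y < t, ∀ (j : ℕ) (hj : j < (bl y).length),
        s.mem 5 ((y : ℤ) * n + j) = (((bl y)[j] : Fin n) : ℕ) := by
  choose l hl using fun x : Fin t =>
    exists_list_of_entries (T.bag x) (fun j => s.mem 5 ((x : ℕ) * n + j)) (h.mem_bag x)
  refine ⟨fun y => if hy : y < t then l ⟨y, hy⟩ else [], fun y => ?_, fun y hy => ?_,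
    fun y hy => ?_, fun y hy j => ?_⟩
  · dsimp only
    split_ifs with hy
    · exact (hl ⟨y, hy⟩).2.1
    · exact List.nodup_nil
  · exact dif_neg (not_lt.2 hy)
  · simp only [hy, dif_pos]
    exact ⟨(hl ⟨y, hy⟩).1, (hl ⟨y, hy⟩).2.2.1⟩
  · simp only [hy, dif_pos]
    exact (hl ⟨y, hy⟩).2.2.2 j

theorem conn_range {H : SimpleGraph (Fin t)} (hH : H.Connected) : Conn H (Finset.range t) := by
  intro y hy z hz
  rw [Finset.mem_range] at hy hz
  have h := (SimpleGraph.reachable_iff_reflTransGen _ _).1 (hH.preconnected ⟨y, hy⟩ ⟨z, hz⟩)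
  exact Relation.ReflTransGen.lift (p := fun a b => NodeAdj H a b ∧ a ∈ Finset.range t ∧
    b ∈ Finset.range t) (fun a : Fin t => (a : ℕ)) (fun a b hab =>
    ⟨⟨a.2, b.2, hab⟩, Finset.mem_range.2 a.2, Finset.mem_range.2 b.2⟩) _ _ h

/-- All polynomials are one. A nonempty set has a positive code, so its entries are at addresses
from `t` on, which are blank. -/
theorem DPInv.initial {T : TreeDecomposition G (Fin t)} {s : State}
    (hbl : ∀ (y : ℕ) (hy : y < t) (v : Fin n), v ∈ bl y ↔ v ∈ T.bag ⟨y, hy⟩)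
    (h10 : ∀ z, s.mem 10 z = 0) (h23 : ∀ z, s.mem 23 z = 0)
    (h9 : ∀ z : ℤ, 0 ≤ z → s.mem 9 z = if z < t then 1 else 0) :
    DPInv k t G bl s (Finset.range t) ∅ (fun _ => 1) fun _ => 0 := by
  constructor
  · simp [h10]
  · exact fun z => .inl (h23 z)
  · simp [pmPoly, sqCoeff_sqPoly]
  · intro y hy A _
    rw [Finset.mem_range] at hy
    have hA := code_nonneg A
    rw [h9 _ (by positivity), sqCoeff_one]
    refine if_congr ⟨fun h => ?_, ?_⟩ rfl rfl
    · by_contra hne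
      have h0 : code A ≠ 0 := fun e => hne (code_injective (e.trans code_empty.symm))
      have h1 : 1 ≤ code A := by omega
      have h2 : (t : ℤ) ≤ code A * t := by nlinarith
      omega
    · rintro rfl
      rw [code_empty]
      omega
  · intro y _ A _ hA
    rw [sqCoeff_one, if_neg]
    rintro rfl
    simp at hA
  · simp [sqNorm_one]
  · simp
  · intro v
    obtain ⟨x, hx⟩ := T.vertex_mem v
    simp only [Finset.notMem_empty, false_iff, not_forall, not_not]
    exact ⟨x, Finset.mem_range.2 x.2, (hbl x x.2 v).2 hx⟩
  · intro u v _ _ huv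
    obtain ⟨x, hx, hx'⟩ := T.edge_mem u v huv
    exact ⟨x, Finset.mem_range.2 x.2, (hbl x x.2 u).2 hx, (hbl x x.2 v).2 hx'⟩

theorem prepare_spec {T : TreeDecomposition G (Fin t)} (ht : 1 ≤ t) {w : ℕ}
    (hbl : ∀ (y : ℕ) (hy : y < t), (bl y).length = (T.bag ⟨y, hy⟩).card ∧
        ∀ v : Fin n, v ∈ bl y ↔ v ∈ T.bag ⟨y, hy⟩) (hblt : ∀ y, t ≤ y → bl y = [])
    (hnd : ∀ y, (bl y).Nodup) (hw : ∀ y, (bl y).length ≤ w) (hBig : Big n t M B) {s : State}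
    (h : Encodes T s) (hm : (G.edgeSet.ncard : ℤ) < 2 ^ B)
    (hbag : ∀ y < t, ∀ (j : ℕ) (hj : j < (bl y).length),
        s.mem 5 ((y : ℤ) * n + j) = (((bl y)[j] : Fin n) : ℕ)) :
    Reach B prepare s (prepareTime G.edgeSet.ncard n t w) fun s' =>
      Env t G bl s' ∧ DPInv k t G bl s' (Finset.range t) ∅ (fun _ => 1) (fun _ => 0) ∧
        TreeInv T.tree s' (Finset.range t) := by
  refine Reach.conseq (m := (2 + G.edgeSet.ncard * 6) + ((2 + t * 8) + ((2 + t * (6 + w * 5)) +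
    (3 + n * 4)))) (Reach.seq (readGraph_spec hBig h.reg_zero h.reg_one hm h.graph_edges
      (h.mem_blank 6 (by norm_num))) ?_) (by rw [prepareTime]; omega) (fun _ _ _ h => h)
  intro s₁ _ hF₁ hadj
  have m₁ : ∀ a, readGraph.wm a = false → 6 ≤ a → ∀ z, s₁.mem a z = 0 := fun a ha h6 z => by
    rw [hF₁.mem a ha, h.mem_blank a h6]
  refine Reach.seq (readTree_spec hBig ht ((hF₁.reg 2 rfl).trans h.reg_two)
    (by rw [hF₁.mem 2 rfl, hF₁.mem 3 rfl]; exact h.tree_edges) (m₁ 7 rfl (by norm_num))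
    (m₁ 8 rfl (by norm_num))) ?_
  intro s₂ _ hF₂ htree
  have m₂ : ∀ a, (readGraph.wm a || readTree.wm a) = false → s₂.mem a = s.mem a := fun a ha => by
    rw [Bool.or_eq_false_iff] at ha
    rw [hF₂.mem a ha.2, hF₁.mem a ha.1]
  have r₂ : ∀ r, (readGraph.wr r || readTree.wr r) = false → s₂.reg r = s.reg r := fun a ha => by
    rw [Bool.or_eq_false_iff] at ha
    rw [hF₂.reg a ha.2, hF₁.reg a ha.1]
  refine Reach.seq (readBags_spec hBig (bl := bl) (w := w) ((r₂ 0 rfl).trans h.reg_zero)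
    ((r₂ 2 rfl).trans h.reg_two) hnd hw hblt ?_ ?_ ?_ ?_) ?_
  · intro y hy
    rw [m₂ 4 rfl, (hbl y hy).1]
    exact h.bag_card ⟨y, hy⟩
  · rw [m₂ 5 rfl]
    exact hbag
  · rw [m₂ 9 rfl]
    exact h.mem_blank 9 (by norm_num)
  · rw [m₂ 12 rfl]
    exact h.mem_blank 12 (by norm_num)
  rintro s₃ - hF₃ ⟨hloc, hsize, hbag', htab⟩
  refine Reach.conseq (powers_spec hBig ((hF₃.reg 0 rfl).trans ((r₂ 0 rfl).trans h.reg_zero)))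
    le_rfl ?_
  intro s₄ _ hF₄ hpow
  refine ⟨⟨?_, ?_, ?_, hpow, ?_, ?_, ?_⟩, DPInv.initial (T := T) (fun y hy => (hbl y hy).2)
    ?_ ?_ ?_, fun y hy => Finset.mem_range.1 hy, conn_range T.isTree.connected, ?_, ?_⟩
  · rw [hF₄.reg 0 rfl, hF₃.reg 0 rfl, r₂ 0 rfl, h.reg_zero]
  · rw [hF₄.reg 2 rfl, hF₃.reg 2 rfl, r₂ 2 rfl, h.reg_two]
  · rw [hF₄.mem 6 rfl, hF₃.mem 6 rfl, hF₂.mem 6 rfl]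
    exact hadj
  · rw [hF₄.mem 12 rfl]
    exact hloc
  · rw [hF₄.mem 21 rfl]
    exact hsize
  · rw [hF₄.mem 22 rfl]
    exact hbag'
  · rw [hF₄.mem 10 rfl, hF₃.mem 10 rfl, m₂ 10 rfl]
    exact h.mem_blank 10 (by norm_num)
  · rw [hF₄.mem 23 rfl, hF₃.mem 23 rfl, m₂ 23 rfl]
    exact h.mem_blank 23 (by norm_num)
  · rw [hF₄.mem 9 rfl]
    exact htab
  · intro y hy
    rw [hF₄.mem 7 rfl, hF₃.mem 7 rfl, if_pos (Finset.mem_range.2 hy)]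
    exact (htree y hy).1
  · intro y hy
    rw [hF₄.mem 8 rfl, hF₃.mem 8 rfl]
    exact (htree y (Finset.mem_range.1 hy)).2

/-- The number of perfect matchings of a graph with a tree decomposition is computed. -/
def countMatchings : Cmd := seq prepare dynamicProgram

theorem countMatchings_spec {T : TreeDecomposition G (Fin t)} (ht : 1 ≤ t)
    (hw : ∀ x, (T.bag x).card ≤ k + 1) (hBig : Big n t ((k + 1) ^ n) B) {s : State}
    (h : Encodes T s) (hm : (G.edgeSet.ncard : ℤ) < 2 ^ B) :
    Reach B countMatchings s
      (prepareTime G.edgeSet.ncard n t (k + 1) + dynamicProgramTime t (k + 1)) fun s' =>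
        s'.reg 0 = pmCount G Finset.univ := by
  obtain ⟨bl, hnd, hblt, hbl, hbag⟩ := h.exists_lists
  have hw' : ∀ y, (bl y).length ≤ k + 1 := by
    intro y
    by_cases hy : y < t
    · rw [(hbl y hy).1]
      exact hw _
    · rw [hblt y (not_lt.1 hy)]
      simp
  refine Reach.seq (prepare_spec (k := k) ht hbl hblt hnd hw' hBig h hm hbag) ?_
  rintro s₁ - - ⟨hE, hI, hT⟩
  exact dynamicProgram_spec ht (fun y hy => (hbl y hy).2) (hblt t le_rfl) hnd hw' hBig hE hI hT

/-! ### The running time -/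

/-- Each edge lies within a bag. This keeps reading the graph within the time bound, where `n ^ 2`
would be too much. -/
theorem ncard_edgeSet_le {V ι : Type*} [Fintype V] [Fintype ι] {G : SimpleGraph V}
    (T : TreeDecomposition G ι) {w : ℕ} (hw : ∀ x, (T.bag x).card ≤ w) :
    G.edgeSet.ncard ≤ Fintype.card ι * w ^ 2 := by
  classical
  have h1 : G.edgeSet ⊆ ↑(Finset.univ.biUnion fun x => (T.bag x).sym2) := by
    intro e he
    induction e using Sym2.ind with
    | _ u v =>
      obtain ⟨x, hu, hv⟩ := T.edge_mem u v he
      simp only [Finset.coe_biUnion, Finset.coe_univ, Set.mem_univ, Set.iUnion_true,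
        Set.mem_iUnion, Finset.mem_coe, Finset.mk_mem_sym2_iff]
      exact ⟨x, hu, hv⟩
  refine (Set.ncard_le_ncard h1 (Finset.finite_toSet _)).trans ?_
  rw [Set.ncard_coe_finset]
  refine Finset.card_biUnion_le.trans ((Finset.sum_le_card_nsmul _ _ (w ^ 2) fun x _ => ?_).trans ?_)
  · rw [Finset.card_sym2, Nat.choose_two_right, Nat.add_sub_cancel]
    refine (Nat.div_le_of_le_mul ?_).trans (Nat.pow_le_pow_left (hw x) 2)
    rcases Nat.eq_zero_or_pos (T.bag x).card with h0 | h0 <;> nlinarith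
  · simp

theorem listSetsTime_le (hk : 1 ≤ k) : listSetsTime (k + 1) ≤ 49 * (k * 2 ^ k) := by
  have hp : 1 ≤ 2 ^ k := Nat.one_le_two_pow
  rw [listSetsTime, pow_succ]
  nlinarith [Nat.mul_le_mul hk hp, Nat.mul_le_mul_left k hp, Nat.mul_le_mul_right (2 ^ k) hk]

theorem transformTime_le (hk : 1 ≤ k) : transformTime (k + 1) ≤ 44 * (k * 2 ^ k) := by
  have hp : 1 ≤ 2 ^ k := Nat.one_le_two_pow
  rw [transformTime, pow_succ]
  nlinarith [Nat.mul_le_mul hk hp, Nat.mul_le_mul_left k hp, Nat.mul_le_mul_right (2 ^ k) hk]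

theorem forgetAllTime_le (hk : 1 ≤ k) : forgetAllTime (k + 1) ≤ 192 * (k ^ 2 * 2 ^ k) := by
  have hp : 1 ≤ 2 ^ k := Nat.one_le_two_pow
  have h1 := listSetsTime_le hk
  have h2 : forgetVertexTime (k + 1) ≤ 91 * (k * 2 ^ k) := by
    rw [forgetVertexTime, pow_succ]
    nlinarith [Nat.mul_le_mul hk hp, Nat.mul_le_mul_left k hp, Nat.mul_le_mul_right (2 ^ k) hk]
  have h3 : 1 ≤ k * 2 ^ k := Nat.mul_le_mul hk hp
  have h4 : 4 + forgetVertexTime (k + 1) ≤ 95 * (k * 2 ^ k) := by omega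
  have h5 := Nat.mul_le_mul (show k + 1 ≤ 2 * k by omega) h4
  have h6 := Nat.mul_le_mul hk h3
  rw [forgetAllTime]
  nlinarith

theorem joinTime_le (hk : 1 ≤ k) : joinTime (k + 1) ≤ 750 * (k ^ 2 * 2 ^ k) := by
  have hp : 1 ≤ 2 ^ k := Nat.one_le_two_pow
  have h1 := listSetsTime_le hk
  have h2 := transformTime_le hk
  have h3 : 1 ≤ k * 2 ^ k := Nat.mul_le_mul hk hp
  have h3' : 2 ^ k ≤ k * 2 ^ k := Nat.le_mul_of_pos_left _ hk
  have h4 := Nat.mul_le_mul hk h3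
  have h4' : k * 2 ^ k ≤ k * (k * 2 ^ k) := Nat.le_mul_of_pos_left _ hk
  have h5 : ((6 + 2 ^ (k + 1) * 10 + transformTime (k + 1)) +
      (6 + 2 ^ (k + 1) * 10 + transformTime (k + 1))) + 2 ≤ 142 * (k * 2 ^ k) := by
    rw [pow_succ]
    omega
  have h6 : ((2 + 2 ^ (k + 1) * (6 + (k + 1 + 1) * 3)) +
      (transformTime (k + 1) + (2 + 2 ^ (k + 1) * 5))) + 2 ≤ 90 * (k * 2 ^ k) := by
    have : 2 ^ (k + 1) * (6 + (k + 1 + 1) * 3) = 24 * 2 ^ k + 6 * (k * 2 ^ k) := by ring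
    rw [this, pow_succ]
    omega
  have h7 := Nat.mul_le_mul (show k + 1 + 1 ≤ 3 * k by omega) h5
  have h8 := Nat.mul_le_mul (show k + 1 + 1 ≤ 3 * k by omega) h6
  have h9 : k ^ 2 * 2 ^ k = k * (k * 2 ^ k) := by ring
  have h10 : 3 * k * (142 * (k * 2 ^ k)) = 426 * (k * (k * 2 ^ k)) := by ring
  have h11 : 3 * k * (90 * (k * 2 ^ k)) = 270 * (k * (k * 2 ^ k)) := by ring
  rw [joinTime, h9]
  omega

/-- With `X = k ^ 2 * 2 ^ k`, each of the `2 * t` rounds takes at most `951 * X` instructions. The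
remaining parts of `2158` are `192` for the last elimination and `24 + 8 + 16` for reading, with
`16` for constants; the `4` is for the powers of four. -/
theorem time_le {c m : ℕ} (hk : 1 ≤ k) (ht : 1 ≤ t) (htn : t ≤ c * n)
    (hm : m ≤ t * (k + 1) ^ 2) :
    prepareTime m n t (k + 1) + dynamicProgramTime t (k + 1) ≤
      (2158 * c + 4) * (n * k ^ 2 * 2 ^ k) := by
  have hp : 1 ≤ 2 ^ k := Nat.one_le_two_pow
  have h1 := forgetAllTime_le hk
  have h2 := joinTime_le hk
  set X := k ^ 2 * 2 ^ k with hX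
  have hkX : k ^ 2 ≤ X := Nat.le_mul_of_pos_right _ hp
  have hk2 : k ≤ k ^ 2 := by nlinarith
  have hX1 : 1 ≤ X := by omega
  have h3 : mergeTime (k + 1) + 9 ≤ 951 * X := by rw [mergeTime]; omega
  have h4 : 2 * t * (mergeTime (k + 1) + 9) ≤ 2 * t * (951 * X) := Nat.mul_le_mul_left _ h3
  have h5 : X ≤ t * X := Nat.le_mul_of_pos_left _ ht
  have h6 : m ≤ t * (4 * X) := by
    refine hm.trans (Nat.mul_le_mul_left _ ?_)
    nlinarith
  have h7 : t * (6 + (k + 1) * 5) ≤ t * (16 * X) := Nat.mul_le_mul_left _ (by omega)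
  have h8 : t ≤ t * X := Nat.le_mul_of_pos_right _ hX1
  have h9 : n ≤ n * X := Nat.le_mul_of_pos_right _ hX1
  have h10 : t * X ≤ c * n * X := Nat.mul_le_mul_right _ htn
  have e1 : 2 * t * (951 * X) = 1902 * (t * X) := by ring
  have e2 : t * (4 * X) = 4 * (t * X) := by ring
  have e3 : t * (16 * X) = 16 * (t * X) := by ring
  have e4 : (2158 * c + 4) * (n * k ^ 2 * 2 ^ k) = 2158 * (c * n * X) + 4 * (n * X) := by
    rw [hX]; ring
  rw [e4, prepareTime, dynamicProgramTime]
  omega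

/-- Let `L` be the logarithm; it is positive as `1 ≤ k`. From `k + 1 ≤ 2 ^ (2 * L)`, the table
condition needs `n + 4 * n + 4 * n * L` bits, and the node numbers need `2 * (c * n + 1)`. Both are
less than `(2 * c + 12) * (n * L)`. -/
theorem big_of_le {c : ℕ} (hn : 1 ≤ n) (hk : 1 ≤ k) (htn : t ≤ c * n) :
    Big n t ((k + 1) ^ n) ((2 * c + 12) * (n * Nat.log 2 (k + 1))) := by
  set L := Nat.log 2 (k + 1) with hL
  have hL1 : 1 ≤ L := Nat.log_pos (by norm_num) (by omega)
  have hnL : n ≤ n * L := Nat.le_mul_of_pos_right _ hL1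
  have hkL : k + 1 ≤ 2 ^ (2 * L) :=
    (Nat.lt_pow_succ_log_self (by norm_num) (k + 1)).le.trans
      (Nat.pow_le_pow_right (by norm_num) (by omega))
  have hB : (2 * c + 12) * (n * L) = 2 * (c * (n * L)) + 12 * (n * L) := by ring
  have hc : c * n ≤ c * (n * L) := Nat.mul_le_mul_left _ hnL
  constructor
  · omega
  · have h1 : 2 * 4 ^ n = 2 ^ (2 * n + 1) := by
      rw [pow_succ, pow_mul]; ring
    have h2 : 2 * 4 ^ n ≤ 2 ^ ((2 * c + 12) * (n * L)) := by
      rw [h1]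
      exact Nat.pow_le_pow_right (by norm_num) (by omega)
    exact_mod_cast h2
  · have h1 : t + 1 ≤ 2 ^ (c * n + 1) :=
      (Nat.add_le_add_right htn 1).trans Nat.lt_two_pow_self.le
    have h2 : (t + 1) ^ 2 < 2 ^ ((2 * c + 12) * (n * L)) := by
      refine (Nat.pow_le_pow_left h1 2).trans_lt ?_
      rw [← pow_mul]
      exact Nat.pow_lt_pow_right (by norm_num) (by omega)
    exact_mod_cast h2
  · exact one_le_pow₀ (by linarith [Nat.cast_nonneg (α := ℤ) k])
  · have h1 : n + 1 ≤ 2 ^ n := Nat.lt_two_pow_self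
    have h2 : ((k + 1) ^ n) ^ 2 ≤ 2 ^ (4 * (n * L)) := by
      refine (Nat.pow_le_pow_left (Nat.pow_le_pow_left hkL n) 2).trans_eq ?_
      rw [← pow_mul, ← pow_mul]
      ring_nf
    have h3 : (16 : ℕ) ^ n = 2 ^ (4 * n) := by rw [pow_mul]; norm_num
    have h4 : (n + 1) * (16 ^ n * ((k + 1) ^ n) ^ 2) < 2 ^ ((2 * c + 12) * (n * L)) := by
      refine (Nat.mul_le_mul h1 (Nat.mul_le_mul h3.le h2)).trans_lt ?_
      rw [← pow_add, ← pow_add]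
      exact Nat.pow_lt_pow_right (by norm_num) (by omega)
    exact_mod_cast h4

theorem Encodes.good {T : TreeDecomposition G (Fin t)} {s : State} (h : Encodes T s)
    (hBig : Big n t M B) (hm : (G.edgeSet.ncard : ℤ) < 2 ^ B) : Good B s := by
  constructor
  · intro r
    match r with
    | 0 =>
      rw [h.reg_zero, abs_of_nonneg (by positivity)]
      exact hBig.cast_lt le_rfl
    | 1 =>
      rw [h.reg_one, abs_of_nonneg (by positivity)]
      exact hm
    | 2 =>
      rw [h.reg_two]
      exact hBig.cast_lt_of_le_sq (Nat.le_mul_self t)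
    | r + 3 =>
      rw [h.reg_blank _ (by omega)]
      exact hBig.zero_lt
  · intro a ha j
    rw [h.mem_blank a ha]
    exact hBig.zero_lt

theorem ncard_edgeSet_lt {c : ℕ} (hn : 1 ≤ n) (hk : 1 ≤ k) :
    (G.edgeSet.ncard : ℤ) < 2 ^ ((2 * c + 12) * (n * Nat.log 2 (k + 1))) := by
  classical
  have hL1 : 1 ≤ Nat.log 2 (k + 1) := Nat.log_pos (by norm_num) (by omega)
  have hnL : n ≤ n * Nat.log 2 (k + 1) := Nat.le_mul_of_pos_right _ hL1
  have h1 : G.edgeSet.ncard ≤ n * n := by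
    rw [← SimpleGraph.coe_edgeFinset, Set.ncard_coe_finset]
    refine G.card_edgeFinset_le_card_choose_two.trans ?_
    rw [Fintype.card_fin, Nat.choose_two_right]
    exact (Nat.div_le_self _ _).trans (Nat.mul_le_mul_left _ (Nat.sub_le _ _))
  have h2 : n * n < 2 ^ (2 * n) := by
    rw [two_mul, pow_add]
    exact Nat.mul_lt_mul'' Nat.lt_two_pow_self Nat.lt_two_pow_self
  have h3 : 2 ^ (2 * n) ≤ 2 ^ ((2 * c + 12) * (n * Nat.log 2 (k + 1))) := by
    refine Nat.pow_le_pow_right (by norm_num) ?_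
    nlinarith [Nat.zero_le (c * (n * Nat.log 2 (k + 1)))]
  exact_mod_cast h1.trans_lt (h2.trans_le h3)

end RAM

/-! ### The theorem -/

theorem TreeDecomposition.card_bag_le {V ι : Type*} [Fintype ι] {G : SimpleGraph V}
    (T : TreeDecomposition G ι) (x : ι) : (T.bag x).card ≤ T.width + 1 := by
  have : (T.bag x).card ≤ Finset.univ.sup fun x => (T.bag x).card :=
    Finset.le_sup (f := fun x => (T.bag x).card) (Finset.mem_univ x)
  rw [TreeDecomposition.width]
  omega

theorem TreeDecomposition.width_le {V ι : Type*} [Fintype V] [Fintype ι] {G : SimpleGraph V}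
    (T : TreeDecomposition G ι) : T.width ≤ Fintype.card V := by
  have : (Finset.univ.sup fun x => (T.bag x).card) ≤ Fintype.card V :=
    Finset.sup_le fun x _ => Finset.card_le_univ _
  rw [TreeDecomposition.width]
  omega

theorem mainTheorem3 :
    ∃ P : RAM.Cmd, ∀ c A : ℕ, ∃ C : ℕ,
      ∀ i : RAM.ArithCost, i.IsRegular A →
      ∀ (n t k : ℕ) (G : SimpleGraph (Fin n)) (T : TreeDecomposition G (Fin t)),
        T.width = k → 1 ≤ k → t ≤ c * n →
        ∀ s : RAM.State, RAM.Encodes T s →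
          ∃ (τ : ℕ) (s' : RAM.State), RAM.Exec i P s τ s' ∧
            s'.reg 0 = ({M : G.Subgraph | M.IsPerfectMatching}.ncard : ℤ) ∧
            τ ≤ C * (n * k ^ 2 * 2 ^ k * i.mul (n * Nat.log 2 (k + 1))) := by
  -- The factors are the constant of the program, that of the number of instructions, and the price
  -- `A ^ (2 * c + 12)` of passing from `n * Nat.log 2 (k + 1)` bits to the word length in
  -- `big_of_le`.
  refine ⟨RAM.countMatchings, fun c A =>
    ⟨RAM.countMatchings.con A * (2158 * c + 4) * A ^ (2 * c + 12), ?_⟩⟩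
  rintro i hi n t k G T hwidth hk htn s hs
  have hw : ∀ x, (T.bag x).card ≤ k + 1 := fun x => hwidth ▸ T.card_bag_le x
  -- A decomposition of positive width needs a vertex.
  have hn : 1 ≤ n := by
    have := T.width_le
    rw [Fintype.card_fin] at this
    omega
  have ht : 1 ≤ t := by
    obtain ⟨x⟩ := T.isTree.connected.nonempty
    exact Nat.one_le_of_lt x.2
  have hBig := RAM.big_of_le hn hk htn
  have hm := RAM.ncard_edgeSet_lt (G := G) (c := c) hn hk
  obtain ⟨s', h0, -, -, h⟩ := RAM.countMatchings_spec ht hw hBig hs hm (hs.good hBig hm)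
  obtain ⟨τ, hexec, hτ⟩ := h A i hi
  refine ⟨τ, s', hexec, ?_, hτ.trans ?_⟩
  · rw [h0, pmCount_univ]
  · have h1 := RAM.time_le hk ht htn (by simpa using RAM.ncard_edgeSet_le T hw)
    have h2 := hi.mul_le (le_refl ((2 * c + 12) * (n * Nat.log 2 (k + 1))))
    refine (Nat.mul_le_mul (Nat.mul_le_mul_left _ h1) h2).trans_eq ?_
    ring
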